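/- Let $a>0$, $\gamma>1$, $L>0$, $T_0\in\mathbb R$, and let $\underline\rho>0$, $\underline u$ be constants with $\underline u>\underline c:=\sqrt{a\gamma}\,\underline\rho^{(\gamma-1)/2}$. Let $\alpha\in C^2(\mathbb R)$ be $1$-periodic with $\int_0^t\alpha(s)\,ds\ge 0$ for all $t\ge 0$ and $\int_0^1\alpha(s)\,ds=0$. Put $$r_\alpha(t)=\tfrac12 e^{\int_0^t\alpha(s)\,ds}\,\underline u-\tfrac{\underline c}{\gamma-1},\qquad s_\alpha(t)=\tfrac12 e^{\int_0^t\alpha(s)\,ds}\,\underline u+\tfrac{\underline c}{\gamma-1},$$ $$\lambda_1(r,s)=r+s-\tfrac{\gamma-1}{2}(s-r),\qquad \lambda_2(r,s)=r+s+\tfrac{\gamma-1}{2}(s-r),\qquad \Lambda(r,s)=\operatorname{diag}\Big(\tfrac1{\lambda_1(r,s)},\tfrac1{\lambda_2(r,s)}\Big).$$ With $x$ as the evolution variable, consider for $m=(m_1,m_2)^T=(r-r_\alpha,\,s-s_\alpha)^T$ the Cauchy problem $$m_x+\Lambda(r,s)\,m_t=\frac{\alpha(t)}2\,\Lambda(r,s)\begin{pmatrix}m_1+m_2\\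 m_1+m_2\end{pmatrix},\qquad m(t,0)=m_0(t):=(r_l(t)-r_\alpha(t),\,s_l(t)-s_\alpha(t))^T, \tag{c1}$$ where $r_l,s_l$ are $1$-periodic and $m_0$ is of class $H^2$ on every bounded interval. A time-periodic solution is a function $m$ on $\mathbb R\times[0,L]$, $1$-periodic and continuous in $t$, with $m\in C([0,L];H^2([T_0,T_0+1]))\cap C^1([0,L];H^1([T_0,T_0+1]))$, such that $\lambda_1,\lambda_2\neq 0$ along $(r,s)=(r_\alpha+m_1,s_\alpha+m_2)$, the equation holds for every $x\in[0,L]$ and almost every $t\in(T_0,T_0+1)$, and $m(t,0)=m_0(t)$ for all $t$. (Functions in $H^2$ are identified with their continuous representatives.) **Theorem.** There are constants $\varepsilon_0>0$ and $C_0>0$, depending only on $a,\gamma,\underline\rho,\underline u,L,T_0,\alpha$, such that for every $\varepsilon\in(0,\varepsilon_0)$ and every such $m_0$ with $\|m_0\|_{H^2([T_0,T_0+1])}\le\varepsilon$, the problem (c1) has a unique time-periodic solution $m$, and it satisfies $$\sup_{x\in[0,L]}\|m(\cdot,x)\|_{H^2([T_0,T_0+1])}+\sup_{x\in[0,L]}\|\partial_x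 m(\cdot,x)\|_{H^1([T_0,T_0+1])}\le C_0\,\varepsilon .$$ -/

import Mathlib

open MeasureTheory Set
open scoped ContDiff ENNReal

noncomputable section

namespace EulerPeriodic

/-- The plane in which the pair `(m₁, m₂)` takes its values, with its Euclidean norm. -/
abbrev Plane : Type := EuclideanSpace ℝ (Fin 2)

/-- `L²((a, b); ℝ²)`. -/
abbrev L2 (a b : ℝ) : Type := Lp Plane 2 (volume.restrict (Ioo a b))

/-- Test functions on the open interval `(a, b)`. -/
def IsTest (a b : ℝ) (φ : ℝ → ℝ) : Prop :=
  ContDiff ℝ ∞ φ ∧ HasCompactSupport φ ∧ tsupport φ ⊆ Ioo a b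

/-- `g` is the weak derivative of `f` on `(a, b)`. -/
def HasWeakDeriv (a b : ℝ) (f g : L2 a b) : Prop :=
  ∀ φ : ℝ → ℝ, IsTest a b φ →
    ∫ t in Ioo a b, deriv φ t • f t = -∫ t in Ioo a b, φ t • g t

theorem integrable_test_smul {a b : ℝ} (f : L2 a b) {ψ : ℝ → ℝ} (hc : Continuous ψ)
    (hs : HasCompactSupport ψ) :
    Integrable (fun t => ψ t • f t) (volume.restrict (Ioo a b)) := by
  have hf : Integrable f (volume.restrict (Ioo a b)) :=
    (Lp.memLp f).integrable (by norm_num)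
  obtain ⟨C, hC⟩ := hs.exists_bound_of_continuous hc
  exact hf.bdd_smul C hc.aestronglyMeasurable (Filter.Eventually.of_forall hC)

theorem IsTest.deriv_cont {a b : ℝ} {φ : ℝ → ℝ} (h : IsTest a b φ) : Continuous (deriv φ) :=
  h.1.continuous_deriv (by simp)

theorem HasWeakDeriv.add {a b : ℝ} {f g f' g' : L2 a b} (h : HasWeakDeriv a b f g)
    (h' : HasWeakDeriv a b f' g') : HasWeakDeriv a b (f + f') (g + g') := by
  intro φ hφ
  have e1 : ∫ t in Ioo a b, deriv φ t • (f + f' : L2 a b) t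
      = ∫ t in Ioo a b, (deriv φ t • f t + deriv φ t • f' t) := by
    refine integral_congr_ae ?_
    filter_upwards [Lp.coeFn_add f f'] with t ht
    rw [ht, Pi.add_apply, smul_add]
  have e2 : ∫ t in Ioo a b, φ t • (g + g' : L2 a b) t
      = ∫ t in Ioo a b, (φ t • g t + φ t • g' t) := by
    refine integral_congr_ae ?_
    filter_upwards [Lp.coeFn_add g g'] with t ht
    rw [ht, Pi.add_apply, smul_add]
  rw [e1, e2, integral_add (integrable_test_smul f hφ.deriv_cont hφ.2.1.deriv)
      (integrable_test_smul f' hφ.deriv_cont hφ.2.1.deriv),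
    integral_add (integrable_test_smul g hφ.1.continuous hφ.2.1)
      (integrable_test_smul g' hφ.1.continuous hφ.2.1), h φ hφ, h' φ hφ, neg_add]

theorem HasWeakDeriv.smul {a b : ℝ} {f g : L2 a b} (c : ℝ) (h : HasWeakDeriv a b f g) :
    HasWeakDeriv a b (c • f) (c • g) := by
  intro φ hφ
  have e1 : ∫ t in Ioo a b, deriv φ t • (c • f : L2 a b) t
      = ∫ t in Ioo a b, c • (deriv φ t • f t) := by
    refine integral_congr_ae ?_
    filter_upwards [Lp.coeFn_smul c f] with t ht
    rw [ht, Pi.smul_apply, smul_comm]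
  have e2 : ∫ t in Ioo a b, φ t • (c • g : L2 a b) t
      = ∫ t in Ioo a b, c • (φ t • g t) := by
    refine integral_congr_ae ?_
    filter_upwards [Lp.coeFn_smul c g] with t ht
    rw [ht, Pi.smul_apply, smul_comm]
  rw [e1, e2, integral_smul, integral_smul, h φ hφ, smul_neg]

theorem HasWeakDeriv.zero (a b : ℝ) : HasWeakDeriv a b 0 0 := by
  have h : ∀ ψ : ℝ → ℝ, ∫ t in Ioo a b, ψ t • (0 : L2 a b) t = 0 := by
    intro ψ
    rw [integral_eq_zero_of_ae]
    filter_upwards [Lp.coeFn_zero Plane 2 (volume.restrict (Ioo a b))] with t ht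
    rw [ht]
    simp
  intro φ _
  rw [h, h, neg_zero]

/-- The Sobolev space `Hᵏ([a, b]; ℝ²)`. An element is stored together with its weak derivatives,
as the tuple `(f, f', …, f⁽ᵏ⁾)` of elements of `L²`; the norm is
`(‖f‖² + ‖f'‖² + ⋯ + ‖f⁽ᵏ⁾‖²)^(1/2)` with `L²` norms on the right. -/
def Sobolev (a b : ℝ) (k : ℕ) : Submodule ℝ (PiLp 2 fun _ : Fin (k + 1) => L2 a b) where
  carrier := {u | ∀ j : Fin k, HasWeakDeriv a b (u j.castSucc) (u j.succ)}
  add_mem' hu hv j := (hu j).add (hv j)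
  zero_mem' _ := HasWeakDeriv.zero a b
  smul_mem' c _ hu j := (hu j).smul c

/-- The `j`-th weak derivative of an element of `Hᵏ`. -/
def wderiv {a b : ℝ} {k : ℕ} (u : Sobolev a b k) (j : Fin (k + 1)) : L2 a b := u.1 j

/-- The function `f` is a representative of the element `u` of `Hᵏ([a, b]; ℝ²)`. -/
def Represents {a b : ℝ} {k : ℕ} (f : ℝ → Plane) (u : Sobolev a b k) : Prop :=
  f =ᵐ[volume.restrict (Ioo a b)] wderiv u 0

/-- The inclusion of `H²` in `H¹`. -/
def incl {a b : ℝ} (u : Sobolev a b 2) : Sobolev a b 1 :=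
  ⟨WithLp.toLp 2 fun j : Fin 2 => u.1 j.castSucc, fun j => u.2 j.castSucc⟩

/-- The sound speed `√(aγ) ρ^((γ-1)/2)` of the pressure law `p = a ρ^γ`. -/
def soundSpeed (a γ ρ : ℝ) : ℝ := √(a * γ) * ρ ^ ((γ - 1) / 2)

/-- The background velocity `exp(∫₀ᵗ α) u`. -/
def bgVelocity (α : ℝ → ℝ) (u t : ℝ) : ℝ := Real.exp (∫ τ in (0 : ℝ)..t, α τ) * u

/-- The background Riemann invariants `(r_α, s_α)`, where `c` is the constant sound speed. -/
def bgRiemann (γ c u : ℝ) (α : ℝ → ℝ) (t : ℝ) : Plane :=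
  !₂[bgVelocity α u t / 2 - c / (γ - 1), bgVelocity α u t / 2 + c / (γ - 1)]

/-- The eigenvalues `(λ₁, λ₂) = (u - c, u + c)` in terms of `w = (r, s)`, where
`r = (u - 2c/(γ-1))/2` and `s = (u + 2c/(γ-1))/2`, so that `u = r + s` and
`c = (γ-1)(s-r)/2`. -/
def eigenvalue (γ : ℝ) (w : Plane) : Fin 2 → ℝ :=
  ![(w 0 + w 1) - (γ - 1) / 2 * (w 1 - w 0), (w 0 + w 1) + (γ - 1) / 2 * (w 1 - w 0)]

/-- The derivative `∂ₓm`, computed in `H¹`, of a curve `x ↦ m(·, x)`, `x ∈ [0, L]`, in `H²`. -/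
def dx {a b : ℝ} (L : ℝ) (M : ℝ → Sobolev a b 2) (x : ℝ) : Sobolev a b 1 :=
  derivWithin (fun y => incl (M y)) (Icc 0 L) x

/-- `m = m(t, x)` is a time-periodic solution (period `1`), in the class
`C([0, L]; H²([T₀, T₀+1])) ∩ C¹([0, L]; H¹([T₀, T₀+1]))`, of the Cauchy problem
`mₓ + Λ mₜ = (α/2) Λ (m₁ + m₂, m₁ + m₂)`, `m(t, 0) = m₀(t)`, where
`Λ = diag(1/λ₁(r, s), 1/λ₂(r, s))` and `(r, s) = w(t) + m` with the background `w`.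
`M x` is `m(·, x)` seen as an element of `H²`. -/
structure IsPeriodicSolution (γ L T₀ : ℝ) (α : ℝ → ℝ) (w m₀ : ℝ → Plane)
    (m : ℝ → ℝ → Plane) (M : ℝ → Sobolev T₀ (T₀ + 1) 2) : Prop where
  periodic : ∀ x ∈ Icc 0 L, ∀ t, m (t + 1) x = m t x
  /-- For each `x`, the continuous representative is used. -/
  continuous : ∀ x ∈ Icc 0 L, Continuous fun t => m t x
  represents : ∀ x ∈ Icc 0 L, Represents (fun t => m t x) (M x)
  continuousOn : ContinuousOn M (Icc 0 L)
  contDiffOn : ContDiffOn ℝ 1 (fun x => incl (M x)) (Icc 0 L)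
  /-- The coefficients `1/λ₁` and `1/λ₂` are defined. -/
  eigenvalue_ne_zero : ∀ x ∈ Icc 0 L, ∀ t, ∀ i, eigenvalue γ (w t + m t x) i ≠ 0
  equation : ∀ x ∈ Icc 0 L, ∀ᵐ t ∂(volume.restrict (Ioo T₀ (T₀ + 1))), ∀ i : Fin 2,
    wderiv (dx L M x) 0 t i + 1 / eigenvalue γ (w t + m t x) i * wderiv (M x) 1 t i
      = α t / 2 * (1 / eigenvalue γ (w t + m t x) i) * (m t x 0 + m t x 1)
  initial : ∀ t, m t 0 = m₀ t

end EulerPeriodic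

end

open EulerPeriodic

noncomputable section

namespace EulerPeriodic

open Function Filter Topology

/-! With `x` as time, the system is a pair of scalar transport equations with speeds `1/λᵢ`, coupled
through the speeds and through a source of the size of `m`. The hypotheses on `α` make the
background velocity periodic and at least `u`, so both eigenvalues stay above `u - c > 0` and remain
positive under small perturbations. No decay is needed: on the fixed interval `[0, L]`, Gronwall
growth costs only a constant factor.

Existence comes from an iteration of linear transport equations, with speed and source frozen at the
previous iterate. It runs in `C^{1,1/2}` in `t`, a class that contains the `H²` data and in which
characteristics give explicit formulas. Composition with the flow costs a fixed factor, so one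
exponential majorant bounds all iterates (`integral_majorant_eq`, `adm_iterStep`). Differences
contract in the sup norm (`abs_iterStep_sub_le`), and the derivatives converge by interpolation with
the Hölder bound (`abs_deriv_sub_le`). The limit is a classical solution (`exists_fixedPoint`).

The delicate point is the second `t`-derivative: differentiating the equation of `∂ₜmᵢ` brings in
second derivatives of the other component. With `κ = (γ - 1) / 2`, `bᵢ = 1/λᵢ` and `aᵢ = ∂ₓmᵢ`, the
equation of `aᵢ` along its own characteristic contains the foreign terms `aᵢ aⱼ` and `α aⱼ`. Since
the background gap is constant, the gap `σ = s - r` has derivative `-2κ bᵢ σ aⱼ` there. Hence a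
power of `σ` as a factor removes the first foreign term, and a primitive in `σ` as a summand removes
the second. The new variable `V` solves a scalar Riccati equation whose coefficients contain `m` but
none of its derivatives (`riccati_along`). So `V` at `x` inherits absolute continuity from `V` at
`0`, and the derivative of `∂ₜmᵢ` has the form `c₀ + c₁ (g ∘ θ)`, where `θ` is the foot of the
characteristic (`ae_hasDerivAt`, `exists_transportedDeriv`). A change of variables and the density
of continuous functions in `L²` give bounds and continuity in `x` (`continuousOn_lp_transported`),
hence a curve in the required Sobolev spaces (`exists_sobolev_curve`).

Uniqueness is an `L²` energy estimate (`inner_le`). The regularity of the speeds is taken from the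
constructed solution; of the competitor only a bound for its `x`-derivative enters, so it need not
be small. -/

/-! ### Mean slopes and integrals with parameters. -/

theorem abs_intervalIntegral_le {g : ℝ → ℝ} {B : ℝ} (hg : ∀ y, |g y| ≤ B) (x y : ℝ) :
    |∫ η in x..y, g η| ≤ B * |y - x| := by
  rw [← Real.norm_eq_abs]
  exact intervalIntegral.norm_integral_le_of_norm_le_const fun τ _ => hg τ

/-- The mean over `[s, s']` of the function `g y`. -/
def meanSlope (g : ℝ → ℝ → ℝ) (y s s' : ℝ) : ℝ := ∫ τ in (0 : ℝ)..1, g y (s + τ * (s' - s))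

theorem meanSlope_self (g : ℝ → ℝ → ℝ) (y s : ℝ) : meanSlope g y s s = g y s := by
  simp [meanSlope]

/-- Hadamard's lemma, the fundamental theorem of calculus along the segment from `s` to `s'`. The
factor is continuous in all arguments, also on the diagonal, so exact identities for differences
turn into derivatives on setting `s' = s`. -/
theorem sub_eq_meanSlope_mul {v vt : ℝ → ℝ → ℝ} (hvt : Continuous (uncurry vt))
    (hd : ∀ x t, HasDerivAt (v x) (vt x t) t) (y s s' : ℝ) :
    v y s' - v y s = meanSlope vt y s s' * (s' - s) := by
  have hd : ∀ τ ∈ uIcc (0 : ℝ) 1, HasDerivAt (fun τ => v y (s + τ * (s' - s)))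
      (vt y (s + τ * (s' - s)) * (s' - s)) τ := fun τ _ => by
    have h1 : HasDerivAt (fun τ : ℝ => s + τ * (s' - s)) (s' - s) τ := by
      simpa using ((hasDerivAt_id τ).mul_const (s' - s)).const_add s
    exact (hd y _).comp τ h1
  have hc : Continuous fun τ => vt y (s + τ * (s' - s)) * (s' - s) :=
    (hvt.comp (by fun_prop : Continuous fun τ : ℝ => (y, s + τ * (s' - s)))).mul_const _
  have := intervalIntegral.integral_eq_sub_of_hasDerivAt hd (hc.intervalIntegrable _ _)
  rw [intervalIntegral.integral_mul_const] at this
  rw [meanSlope, this]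
  simp

theorem continuous_meanSlope {g : ℝ → ℝ → ℝ} (hg : Continuous (uncurry g)) {X : Type*}
    [TopologicalSpace X] {y s s' : X → ℝ} (hy : Continuous y) (hs : Continuous s)
    (hs' : Continuous s') : Continuous fun p => meanSlope g (y p) (s p) (s' p) := by
  refine intervalIntegral.continuous_parametric_intervalIntegral_of_continuous' ?_ 0 1
  exact hg.comp (by fun_prop :
    Continuous fun q : X × ℝ => (y q.1, s q.1 + q.2 * (s' q.1 - s q.1)))

theorem continuous_integral_comp {X : Type*} [TopologicalSpace X] {g : X → ℝ → ℝ}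
    (hg : Continuous (uncurry g)) {x y : X → ℝ} (hx : Continuous x) (hy : Continuous y) :
    Continuous fun p => ∫ η in x p..y p, g p η := by
  have e (p : X) : ∫ η in x p..y p, g p η =
      (∫ η in (0 : ℝ)..y p, g p η) - ∫ η in (0 : ℝ)..x p, g p η := by
    have hi : ∀ u v : ℝ, IntervalIntegrable (g p) volume u v :=
      fun u v => (hg.comp (by fun_prop : Continuous fun η : ℝ => (p, η))).intervalIntegrable u v
    rw [intervalIntegral.integral_interval_sub_left (hi _ _) (hi _ _)]
  simp_rw [e]
  exact (intervalIntegral.continuous_parametric_intervalIntegral_of_continuous hg hy).sub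
    (intervalIntegral.continuous_parametric_intervalIntegral_of_continuous hg hx)

/-! ### The flow of a bounded speed field. -/

/-- A bounded continuous speed `b x t`, continuously differentiable in `t` with bounded derivative
`bt`. -/
structure IsField (b bt : ℝ → ℝ → ℝ) (B : ℝ) : Prop where
  cont : Continuous (uncurry b)
  cont_t : Continuous (uncurry bt)
  deriv : ∀ x t, HasDerivAt (b x) (bt x t) t
  bound : ∀ x t, |b x t| ≤ B
  bound_t : ∀ x t, |bt x t| ≤ B

/-- The solution `ψ` of `ψ' y = b y (ψ y)` with `ψ x = t`. -/
def flow (b : ℝ → ℝ → ℝ) (x t : ℝ) : ℝ → ℝ :=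
  Classical.epsilon fun ψ => ψ x = t ∧ ∀ y, HasDerivAt ψ (b y (ψ y)) y

namespace IsField

variable {b bt : ℝ → ℝ → ℝ} {B : ℝ}

theorem nonneg (h : IsField b bt B) : 0 ≤ B := (abs_nonneg _).trans (h.bound 0 0)

theorem lipschitz (h : IsField b bt B) (x : ℝ) : LipschitzWith B.toNNReal (b x) := by
  refine lipschitzWith_of_nnnorm_deriv_le (fun t => (h.deriv x t).differentiableAt) fun t => ?_
  rw [(h.deriv x t).deriv, ← NNReal.coe_le_coe, Real.coe_toNNReal _ h.nonneg]
  exact h.bound_t x t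

theorem exists_local (h : IsField b bt B) {N x : ℝ} (hx : x ∈ Icc (-N) N) (t : ℝ) :
    ∃ ψ : ℝ → ℝ, ψ x = t ∧ ∀ y ∈ Ioo (-N) N, HasDerivAt ψ (b y (ψ y)) y := by
  have hN : 0 ≤ N := by linarith [hx.1, hx.2]
  -- The speed is bounded by `B` on the whole line, so the radius is free; `B * (2 * N)` is the
  -- farthest a solution can travel within `[-N, N]`.
  have pl : IsPicardLindelof b (tmin := -N) (tmax := N) ⟨x, hx⟩ t
      (B * (2 * N)).toNNReal 0 B.toNNReal B.toNNReal := by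
    refine ⟨fun y _ => (h.lipschitz y).lipschitzOnWith, fun s _ => ?_, fun y _ s _ => ?_, ?_⟩
    · exact (h.cont.comp (by fun_prop : Continuous fun y : ℝ => (y, s))).continuousOn
    · rw [Real.coe_toNNReal _ h.nonneg]
      exact h.bound y s
    · rw [Real.coe_toNNReal _ h.nonneg, Real.coe_toNNReal _ (mul_nonneg h.nonneg (by linarith))]
      have : max (N - x) (x - -N) ≤ 2 * N := max_le (by linarith [hx.1]) (by linarith [hx.2])
      simpa using mul_le_mul_of_nonneg_left this h.nonneg
  obtain ⟨ψ, h0, h1⟩ := pl.exists_eq_forall_mem_Icc_hasDerivWithinAt₀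
  exact ⟨ψ, h0, fun y hy => (h1 y (Ioo_subset_Icc_self hy)).hasDerivAt (Icc_mem_nhds hy.1 hy.2)⟩

theorem exists_global (h : IsField b bt B) (x t : ℝ) :
    ∃ ψ : ℝ → ℝ, ψ x = t ∧ ∀ y, HasDerivAt ψ (b y (ψ y)) y := by
  have hx (n : ℕ) : x ∈ Icc (-(n + 1 + |x|)) (n + 1 + |x|) := by
    constructor <;> linarith [neg_abs_le x, le_abs_self x, (Nat.cast_nonneg n : (0 : ℝ) ≤ n)]
  choose ψ h0 h1 using fun n : ℕ => h.exists_local (hx n) t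
  have agree {n m : ℕ} (hnm : n ≤ m) {y : ℝ} (hy : y ∈ Ioo (-(n + 1 + |x|)) (n + 1 + |x|)) :
      ψ n y = ψ m y := by
    have hc : (n : ℝ) ≤ m := by exact_mod_cast hnm
    refine ODE_solution_unique_of_mem_Ioo (s := fun _ => univ) (t₀ := x)
      (fun y _ => (h.lipschitz y).lipschitzOnWith) ?_ (fun y hy => ⟨h1 n y hy, trivial⟩)
      (fun y hy => ⟨h1 m y ⟨by linarith [hy.1], by linarith [hy.2]⟩, trivial⟩)
      ((h0 n).trans (h0 m).symm) hy
    constructor <;> linarith [neg_abs_le x, le_abs_self x, (Nat.cast_nonneg n : (0 : ℝ) ≤ n)]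
  have mem (y : ℝ) : y ∈ Ioo (-((⌈|y|⌉₊ : ℝ) + 1 + |x|)) (⌈|y|⌉₊ + 1 + |x|) := by
    have := Nat.le_ceil |y|
    constructor <;> linarith [neg_abs_le y, le_abs_self y, abs_nonneg x]
  -- The pasted function uses at `y` a local solution whose interval contains `y`. Near `y` it
  -- agrees with the single local solution of index `⌈|y|⌉₊ + 1`, hence it is differentiable there.
  refine ⟨fun y => ψ ⌈|y|⌉₊ y, h0 _, fun y => ?_⟩
  set m := ⌈|y|⌉₊ + 1
  have key : ∀ᶠ z in 𝓝 y, ψ ⌈|z|⌉₊ z = ψ m z := by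
    have : ∀ᶠ z in 𝓝 y, |z| < |y| + 1 :=
      continuous_abs.continuousAt.eventually_lt continuousAt_const (by simp)
    filter_upwards [this] with z hz
    refine agree (Nat.ceil_le.2 ?_) (mem z)
    have := Nat.le_ceil |y|
    push_cast [m]
    linarith
  have hy := mem y
  have := h1 m y ⟨by push_cast [m]; linarith [hy.1], by push_cast [m]; linarith [hy.2]⟩
  rw [← key.self_of_nhds] at this
  exact this.congr_of_eventuallyEq key

theorem flow_spec (h : IsField b bt B) (x t : ℝ) :
    flow b x t x = t ∧ ∀ y, HasDerivAt (flow b x t) (b y (flow b x t y)) y :=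
  Classical.epsilon_spec (h.exists_global x t)

theorem flow_self (h : IsField b bt B) (x t : ℝ) : flow b x t x = t := (h.flow_spec x t).1

theorem hasDerivAt_flow (h : IsField b bt B) (x t y : ℝ) :
    HasDerivAt (flow b x t) (b y (flow b x t y)) y := (h.flow_spec x t).2 y

theorem flow_unique (h : IsField b bt B) {x t : ℝ} {ψ : ℝ → ℝ} (h0 : ψ x = t)
    (h1 : ∀ y, HasDerivAt ψ (b y (ψ y)) y) : ψ = flow b x t :=
  ODE_solution_unique_univ (s := fun _ => univ) (t₀ := x)
    (fun y => (h.lipschitz y).lipschitzOnWith) (fun y => ⟨h1 y, trivial⟩)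
    (fun y => ⟨h.hasDerivAt_flow x t y, trivial⟩) (by rw [h0, h.flow_self])

theorem flow_flow (h : IsField b bt B) (x t y z : ℝ) :
    flow b y (flow b x t y) z = flow b x t z :=
  congrFun (h.flow_unique rfl (h.hasDerivAt_flow x t)).symm z

theorem flow_add_one (h : IsField b bt B) (hp : ∀ x t, b x (t + 1) = b x t) (x t y : ℝ) :
    flow b x (t + 1) y = flow b x t y + 1 := by
  refine (congrFun (h.flow_unique (ψ := fun y => flow b x t y + 1) ?_ fun y => ?_) y).symm
  · simp [h.flow_self]
  · rw [hp]
    exact (h.hasDerivAt_flow x t y).add_const 1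

theorem continuous_flow_right (h : IsField b bt B) (x t : ℝ) : Continuous (flow b x t) :=
  continuous_iff_continuousAt.2 fun y => (h.hasDerivAt_flow x t y).continuousAt

/-- The distance of two characteristics solves a linear equation whose coefficient is the mean slope
of `b` between them. The resulting exponential formula is exact; it yields the Lipschitz bound and
the differentiability in `t` together. -/
theorem flow_sub_flow (h : IsField b bt B) (x t t' y : ℝ) :
    flow b x t' y - flow b x t y = (t' - t) * Real.exp (∫ η in x..y,
      meanSlope bt η (flow b x t η) (flow b x t' η)) := by
  set S : ℝ → ℝ := fun η =>
    meanSlope bt η (flow b x t η) (flow b x t' η) with hS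
  have hc : Continuous S := continuous_meanSlope h.cont_t continuous_id (h.continuous_flow_right x t)
    (h.continuous_flow_right x t')
  set D : ℝ → ℝ := fun y => (flow b x t' y - flow b x t y) * Real.exp (-∫ η in x..y, S η) with hD
  have hd (y : ℝ) : HasDerivAt D 0 y := by
    have h1 : HasDerivAt (fun y => ∫ η in x..y, S η) (S y) y :=
      intervalIntegral.integral_hasDerivAt_right (hc.intervalIntegrable _ _)
        hc.stronglyMeasurable.stronglyMeasurableAtFilter hc.continuousAt
    have h2 := ((h.hasDerivAt_flow x t' y).sub (h.hasDerivAt_flow x t y)).mul h1.neg.exp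
    refine h2.congr_deriv ?_
    rw [sub_eq_meanSlope_mul h.cont_t h.deriv]
    simp only [Pi.sub_apply, Pi.neg_apply, hS]
    ring
  have hconst : D y = D x := is_const_of_deriv_eq_zero (fun y => (hd y).differentiableAt)
    (fun y => (hd y).deriv) y x
  simp only [hD, h.flow_self, intervalIntegral.integral_same, neg_zero, Real.exp_zero,
    mul_one] at hconst
  rw [← hconst, mul_assoc, ← Real.exp_add]
  simp

theorem abs_meanSlope_le (h : IsField b bt B) (y s s' : ℝ) :
    |meanSlope bt y s s'| ≤ B := by
  have := intervalIntegral.norm_integral_le_of_norm_le_const (a := (0 : ℝ)) (b := 1)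
    (f := fun τ => bt y (s + τ * (s' - s))) (C := B) (fun τ _ => h.bound_t _ _)
  simpa [meanSlope] using this

theorem abs_flow_sub_flow_le (h : IsField b bt B) (x t t' y : ℝ) :
    |flow b x t' y - flow b x t y| ≤ Real.exp (B * |y - x|) * |t' - t| := by
  rw [h.flow_sub_flow, abs_mul, Real.abs_exp, mul_comm]
  gcongr
  exact (le_abs_self _).trans (abs_intervalIntegral_le (fun y => h.abs_meanSlope_le _ _ _) x y)

theorem abs_flow_sub_le (h : IsField b bt B) (x t y z : ℝ) :
    |flow b x t y - flow b x t z| ≤ B * |y - z| := by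
  have := convex_univ.norm_image_sub_le_of_norm_hasDerivWithin_le (f := flow b x t)
    (fun y _ => (h.hasDerivAt_flow x t y).hasDerivWithinAt) (fun y _ => h.bound _ _)
    (mem_univ z) (mem_univ y)
  simpa using this

/-- Lipschitz dependence on `t` and on `y` is already known. Moving the starting point to `x'`
reduces to moving `t`, since the trajectory of `(x, t)` passes through `flow b x t x'` at `x'`. -/
theorem continuous_flow (h : IsField b bt B) :
    Continuous fun p : ℝ × ℝ × ℝ => flow b p.1 p.2.1 p.2.2 := by
  refine continuous_iff_continuousAt.2 fun ⟨x, t, y⟩ => ?_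
  have key (p : ℝ × ℝ × ℝ) : dist (flow b p.1 p.2.1 p.2.2) (flow b x t y) ≤
      Real.exp (B * |p.2.2 - p.1|) * (|p.2.1 - t| + B * |x - p.1|) + B * |p.2.2 - y| := by
    obtain ⟨x', t', y'⟩ := p
    dsimp only
    have h1 := h.abs_flow_sub_le x t y' y
    have h2 := h.abs_flow_sub_flow_le x' (flow b x t x') t' y'
    rw [h.flow_flow] at h2
    have h3 : |t' - flow b x t x'| ≤ |t' - t| + B * |x - x'| := by
      have := h.abs_flow_sub_le x t x x'
      rw [h.flow_self] at this
      exact (abs_sub_le _ t _).trans (by gcongr)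
    rw [Real.dist_eq]
    refine (abs_sub_le _ (flow b x t y') _).trans (add_le_add (h2.trans ?_) h1)
    gcongr
  refine tendsto_iff_dist_tendsto_zero.2 (squeeze_zero (fun _ => dist_nonneg) key ?_)
  have hc : Continuous fun p : ℝ × ℝ × ℝ =>
      Real.exp (B * |p.2.2 - p.1|) * (|p.2.1 - t| + B * |x - p.1|) + B * |p.2.2 - y| := by
    fun_prop
  simpa using hc.tendsto (x, t, y)

theorem continuous_flow_comp (h : IsField b bt B) {X : Type*} [TopologicalSpace X]
    {x t y : X → ℝ} (hx : Continuous x) (ht : Continuous t) (hy : Continuous y) :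
    Continuous fun p => flow b (x p) (t p) (y p) :=
  h.continuous_flow.comp (hx.prodMk (ht.prodMk hy))

end IsField

/-- The difference quotient of the flow. -/
def flowSlope (b bt : ℝ → ℝ → ℝ) (x t t' y : ℝ) : ℝ :=
  Real.exp (∫ η in x..y, meanSlope bt η (flow b x t η) (flow b x t' η))

/-- The `t`-derivative of the flow. -/
def flowDeriv (b bt : ℝ → ℝ → ℝ) (x t y : ℝ) : ℝ := Real.exp (∫ η in x..y, bt η (flow b x t η))

namespace IsField

variable {b bt : ℝ → ℝ → ℝ} {B : ℝ}

theorem flowSlope_self (b bt : ℝ → ℝ → ℝ) (x t y : ℝ) :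
    flowSlope b bt x t t y = flowDeriv b bt x t y := by
  simp [flowSlope, flowDeriv, meanSlope_self]

theorem continuous_flowSlope_comp (h : IsField b bt B) {X : Type*} [TopologicalSpace X]
    {x t t' y : X → ℝ} (hx : Continuous x) (ht : Continuous t) (ht' : Continuous t')
    (hy : Continuous y) : Continuous fun p => flowSlope b bt (x p) (t p) (t' p) (y p) := by
  refine Real.continuous_exp.comp (continuous_integral_comp (g := fun p η =>
    meanSlope bt η (flow b (x p) (t p) η) (flow b (x p) (t' p) η)) ?_ hx hy)
  exact continuous_meanSlope h.cont_t continuous_snd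
    (h.continuous_flow_comp (hx.comp continuous_fst) (ht.comp continuous_fst) continuous_snd)
    (h.continuous_flow_comp (hx.comp continuous_fst) (ht'.comp continuous_fst) continuous_snd)

/-- By `flow_sub_flow` the difference quotient is `flowSlope`, which is continuous up to `t' = t`.
-/
theorem hasDerivAt_flow_left (h : IsField b bt B) (x t y : ℝ) :
    HasDerivAt (fun t => flow b x t y) (flowDeriv b bt x t y) t := by
  rw [hasDerivAt_iff_tendsto_slope]
  have hc : Continuous fun t' => flowSlope b bt x t t' y :=
    h.continuous_flowSlope_comp continuous_const continuous_const continuous_id continuous_const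
  rw [← flowSlope_self]
  refine (hc.tendsto t).mono_left nhdsWithin_le_nhds |>.congr' ?_
  filter_upwards [self_mem_nhdsWithin] with t' ht'
  have : t' - t ≠ 0 := sub_ne_zero.2 ht'
  rw [slope_def_field, h.flow_sub_flow]
  field_simp
  rfl

theorem continuous_flowDeriv_comp (h : IsField b bt B) {X : Type*} [TopologicalSpace X]
    {x t y : X → ℝ} (hx : Continuous x) (ht : Continuous t) (hy : Continuous y) :
    Continuous fun p => flowDeriv b bt (x p) (t p) (y p) := by
  refine Real.continuous_exp.comp (continuous_integral_comp (g := fun p η =>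
    bt η (flow b (x p) (t p) η)) ?_ hx hy)
  exact h.cont_t.comp (continuous_snd.prodMk (h.continuous_flow_comp (hx.comp continuous_fst)
    (ht.comp continuous_fst) continuous_snd))

theorem flowDeriv_le (h : IsField b bt B) (x t y : ℝ) :
    flowDeriv b bt x t y ≤ Real.exp (B * |y - x|) :=
  Real.exp_le_exp.2 ((le_abs_self _).trans (abs_intervalIntegral_le (fun _ => h.bound_t _ _) x y))

theorem flowDeriv_pos (b bt : ℝ → ℝ → ℝ) (x t y : ℝ) : 0 < flowDeriv b bt x t y :=
  Real.exp_pos _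

theorem le_flowDeriv (h : IsField b bt B) (x t y : ℝ) :
    Real.exp (-(B * |y - x|)) ≤ flowDeriv b bt x t y :=
  Real.exp_le_exp.2 ((abs_le.1 (abs_intervalIntegral_le (fun _ => h.bound_t _ _) x y)).1)

end IsField

/-! ### The linear transport equation along characteristics. -/

theorem hasDerivAt_primitive {g : ℝ → ℝ} (hg : Continuous g) (a y : ℝ) :
    HasDerivAt (fun y => ∫ η in a..y, g η) (g y) y :=
  intervalIntegral.integral_hasDerivAt_right (hg.intervalIntegrable _ _)
    hg.stronglyMeasurable.stronglyMeasurableAtFilter hg.continuousAt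

theorem hasDerivAt_integral_of_continuous {F F' : ℝ → ℝ → ℝ} (hF : Continuous (uncurry F))
    (hF' : Continuous (uncurry F')) (hd : ∀ t y, HasDerivAt (fun t => F t y) (F' t y) t)
    (a c t : ℝ) : HasDerivAt (fun t => ∫ y in a..c, F t y) (∫ y in a..c, F' t y) t := by
  obtain ⟨C, hC⟩ := ((isCompact_closedBall t 1).prod (isCompact_uIcc (a := a) (b := c))
    ).exists_bound_of_continuousOn hF'.continuousOn
  have hc (s : ℝ) : Continuous (F s) := hF.comp (by fun_prop : Continuous fun y : ℝ => (s, y))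
  have hc' (s : ℝ) : Continuous (F' s) := hF'.comp (by fun_prop : Continuous fun y : ℝ => (s, y))
  refine (intervalIntegral.hasDerivAt_integral_of_dominated_loc_of_deriv_le (μ := volume)
    (bound := fun _ => C) (Metric.closedBall_mem_nhds t one_pos)
    (Eventually.of_forall fun s => (hc s).aestronglyMeasurable) ((hc t).intervalIntegrable _ _)
    (hc' t).aestronglyMeasurable (Eventually.of_forall fun y hy s hs => ?_)
    (by simp) (Eventually.of_forall fun y _ s _ => hd s y)).2
  exact hC (s, y) ⟨hs, uIoc_subset_uIcc hy⟩

/-- If `v` is continuously differentiable in its second variable, then moving that variable along a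
differentiable curve contributes the expected term to the derivative. -/
theorem hasDerivAt_sub_along {v vt : ℝ → ℝ → ℝ} (hvt : Continuous (uncurry vt))
    (hd : ∀ x t, HasDerivAt (v x) (vt x t) t) {ψ : ℝ → ℝ} {ψ' x : ℝ} (hψ : HasDerivAt ψ ψ' x) :
    HasDerivAt (fun y => v y (ψ y) - v y (ψ x)) (vt x (ψ x) * ψ') x := by
  have key (y : ℝ) := sub_eq_meanSlope_mul hvt hd y (ψ x) (ψ y)
  rw [hasDerivAt_iff_tendsto_slope]
  have hS : Continuous fun p : ℝ × ℝ => meanSlope vt p.1 (ψ x) p.2 :=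
    continuous_meanSlope hvt continuous_fst continuous_const continuous_snd
  have h1 : Tendsto (fun y => meanSlope vt y (ψ x) (ψ y)) (𝓝 x) (𝓝 (vt x (ψ x))) := by
    have := (hS.tendsto (x, ψ x)).comp (continuousAt_id.prodMk hψ.continuousAt)
    simpa [Function.comp_def, meanSlope_self] using this
  refine ((h1.mono_left nhdsWithin_le_nhds).mul (hasDerivAt_iff_tendsto_slope.1 hψ)).congr
    fun y => ?_
  rw [slope_def_field, slope_def_field, key]
  simp only [sub_self, mul_div_assoc, sub_zero]

theorem hasDerivAt_along {v vt : ℝ → ℝ → ℝ} (hvt : Continuous (uncurry vt))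
    (hd : ∀ x t, HasDerivAt (v x) (vt x t) t) {ψ : ℝ → ℝ} {ψ' vx x : ℝ} (hψ : HasDerivAt ψ ψ' x)
    (hx : HasDerivAt (fun y => v y (ψ x)) vx x) :
    HasDerivAt (fun y => v y (ψ y)) (vx + vt x (ψ x) * ψ') x :=
  (hx.add (hasDerivAt_sub_along hvt hd hψ)).congr_of_eventuallyEq
    (Eventually.of_forall fun y => by simp)

/-- The solution of `v_x + b v_t = f`, `v 0 = v₀`. -/
def transport (b f : ℝ → ℝ → ℝ) (v₀ : ℝ → ℝ) (x t : ℝ) : ℝ :=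
  v₀ (flow b x t 0) + ∫ y in (0 : ℝ)..x, f y (flow b x t y)

/-- The `t`-derivative of `transport b f v₀`. -/
def transportDeriv (b bt ft : ℝ → ℝ → ℝ) (v₀' : ℝ → ℝ) (x t : ℝ) : ℝ :=
  v₀' (flow b x t 0) * flowDeriv b bt x t 0 +
    ∫ y in (0 : ℝ)..x, ft y (flow b x t y) * flowDeriv b bt x t y

namespace IsField

variable {b bt : ℝ → ℝ → ℝ} {B : ℝ}

theorem transport_zero (h : IsField b bt B) (f : ℝ → ℝ → ℝ) (v₀ : ℝ → ℝ) (t : ℝ) :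
    transport b f v₀ 0 t = v₀ t := by
  simp [transport, h.flow_self]

theorem transportDeriv_zero (h : IsField b bt B) (ft : ℝ → ℝ → ℝ) (v₀' : ℝ → ℝ) (t : ℝ) :
    transportDeriv b bt ft v₀' 0 t = v₀' t := by
  simp [transportDeriv, h.flow_self, flowDeriv]

theorem continuous_along (h : IsField b bt B) {f : ℝ → ℝ → ℝ} (hf : Continuous (uncurry f)) :
    Continuous (uncurry fun (p : ℝ × ℝ) y => f y (flow b p.1 p.2 y)) :=
  hf.comp (continuous_snd.prodMk (h.continuous_flow_comp (continuous_fst.comp continuous_fst)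
    (continuous_snd.comp continuous_fst) continuous_snd))

theorem continuous_along_mul (h : IsField b bt B) {f : ℝ → ℝ → ℝ} (hf : Continuous (uncurry f)) :
    Continuous (uncurry fun (p : ℝ × ℝ) y => f y (flow b p.1 p.2 y) * flowDeriv b bt p.1 p.2 y) :=
  (h.continuous_along hf).mul (h.continuous_flowDeriv_comp (continuous_fst.comp continuous_fst)
    (continuous_snd.comp continuous_fst) continuous_snd)

theorem continuous_transport (h : IsField b bt B) {f : ℝ → ℝ → ℝ} {v₀ : ℝ → ℝ}
    (hf : Continuous (uncurry f)) (hv : Continuous v₀) :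
    Continuous (uncurry (transport b f v₀)) :=
  (hv.comp (h.continuous_flow_comp continuous_fst continuous_snd continuous_const)).add
    (intervalIntegral.continuous_parametric_intervalIntegral_of_continuous (h.continuous_along hf)
      continuous_fst)

theorem continuous_transportDeriv (h : IsField b bt B) {ft : ℝ → ℝ → ℝ} {v₀' : ℝ → ℝ}
    (hf : Continuous (uncurry ft)) (hv : Continuous v₀') :
    Continuous (uncurry (transportDeriv b bt ft v₀')) :=
  ((hv.comp (h.continuous_flow_comp continuous_fst continuous_snd continuous_const)).mul
    (h.continuous_flowDeriv_comp continuous_fst continuous_snd continuous_const)).add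
    (intervalIntegral.continuous_parametric_intervalIntegral_of_continuous
      (h.continuous_along_mul hf) continuous_fst)

theorem hasDerivAt_transport (h : IsField b bt B) {f ft : ℝ → ℝ → ℝ} {v₀ v₀' : ℝ → ℝ}
    (hf : Continuous (uncurry f)) (hft : Continuous (uncurry ft))
    (hd : ∀ x t, HasDerivAt (f x) (ft x t) t) (hd₀ : ∀ t, HasDerivAt v₀ (v₀' t) t) (x t : ℝ) :
    HasDerivAt (transport b f v₀ x) (transportDeriv b bt ft v₀' x t) t := by
  refine ((hd₀ _).comp t (h.hasDerivAt_flow_left x t 0)).add ?_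
  have hx : Continuous fun q : ℝ × ℝ => ((x, q.1), q.2) := by fun_prop
  exact hasDerivAt_integral_of_continuous (F := fun t y => f y (flow b x t y))
    (F' := fun t y => ft y (flow b x t y) * flowDeriv b bt x t y)
    ((h.continuous_along hf).comp hx) ((h.continuous_along_mul hft).comp hx)
    (fun t y => (hd y _).comp t (h.hasDerivAt_flow_left x t y)) 0 x t

theorem hasDerivAt_transport_along (h : IsField b bt B) {f : ℝ → ℝ → ℝ} {v₀ : ℝ → ℝ}
    (hf : Continuous (uncurry f)) (x t y : ℝ) :
    HasDerivAt (fun y => transport b f v₀ y (flow b x t y)) (f y (flow b x t y)) y := by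
  simp only [transport, h.flow_flow]
  have hc : Continuous fun y => f y (flow b x t y) :=
    (h.continuous_along hf).comp (by fun_prop : Continuous fun y : ℝ => ((x, t), y))
  exact (hasDerivAt_primitive hc 0 y).const_add _

/-- The speed need not be differentiable in `x`, so the formula cannot be differentiated in `x` term
by term. Along the characteristic through `(x, t)` the derivative is `f`; removing the part due to
the motion in `t` leaves the derivative at fixed `t`. -/
theorem hasDerivAt_transport_left (h : IsField b bt B) {f ft : ℝ → ℝ → ℝ} {v₀ v₀' : ℝ → ℝ}
    (hf : Continuous (uncurry f)) (hft : Continuous (uncurry ft))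
    (hd : ∀ x t, HasDerivAt (f x) (ft x t) t) (hd₀ : ∀ t, HasDerivAt v₀ (v₀' t) t)
    (hv₀' : Continuous v₀') (x t : ℝ) :
    HasDerivAt (fun y => transport b f v₀ y t)
      (f x t - b x t * transportDeriv b bt ft v₀' x t) x := by
  have h1 := h.hasDerivAt_transport_along (v₀ := v₀) hf x t x
  have h2 := hasDerivAt_sub_along (h.continuous_transportDeriv hft hv₀')
    (h.hasDerivAt_transport hf hft hd hd₀) (h.hasDerivAt_flow x t x)
  refine ((h1.sub h2).congr_of_eventuallyEq (Eventually.of_forall fun y => ?_)).congr_deriv ?_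
  · simp [h.flow_self]
  · simp [h.flow_self, mul_comm]

/-- This is the differentiated equation `∂ₓvₜ + b ∂ₜvₜ = fₜ - bₜ vₜ`, read along characteristics
only: `vₜ` need not be differentiable in `x` or in `t` separately. The integrating factor `exp A`
absorbs `bₜ`. -/
theorem hasDerivAt_transportDeriv_along (h : IsField b bt B) {ft : ℝ → ℝ → ℝ} {v₀' : ℝ → ℝ}
    (hft : Continuous (uncurry ft)) (x t y : ℝ) :
    HasDerivAt (fun y => transportDeriv b bt ft v₀' y (flow b x t y))
      (ft y (flow b x t y) -
        bt y (flow b x t y) * transportDeriv b bt ft v₀' y (flow b x t y)) y := by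
  have hx : Continuous fun y : ℝ => ((x, t), y) := by fun_prop
  have hβ : Continuous fun y => bt y (flow b x t y) := (h.continuous_along h.cont_t).comp hx
  have hφ : Continuous fun y => ft y (flow b x t y) := (h.continuous_along hft).comp hx
  set β : ℝ → ℝ := fun y => bt y (flow b x t y)
  set A : ℝ → ℝ := fun y => ∫ η in (0 : ℝ)..y, β η with hA
  have hAd (y : ℝ) : HasDerivAt A (β y) y := hasDerivAt_primitive hβ 0 y
  have hAc : Continuous A := continuous_iff_continuousAt.2 fun y => (hAd y).continuousAt
  have e (y : ℝ) : transportDeriv b bt ft v₀' y (flow b x t y) = Real.exp (-A y) *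
      (v₀' (flow b x t 0) + ∫ η in (0 : ℝ)..y, ft η (flow b x t η) * Real.exp (A η)) := by
    have e1 (z : ℝ) : flowDeriv b bt y (flow b x t y) z = Real.exp (-A y) * Real.exp (A z) := by
      rw [← Real.exp_add, flowDeriv]
      congr 1
      simp_rw [h.flow_flow]
      rw [neg_add_eq_sub, hA, intervalIntegral.integral_interval_sub_left
        (hβ.intervalIntegrable _ _) (hβ.intervalIntegrable _ _)]
    simp only [transportDeriv, h.flow_flow, e1]
    rw [mul_add, ← intervalIntegral.integral_const_mul]
    congr 1
    · simp [hA]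
      ring
    · congr 1
      ext η
      ring
  simp_rw [e]
  refine ((hAd y).neg.exp.mul ((hasDerivAt_primitive (hφ.mul hAc.rexp) 0 y).const_add _)
    ).congr_deriv ?_
  have : Real.exp (-A y) * Real.exp (A y) = 1 := by rw [← Real.exp_add]; simp
  simp only [Pi.neg_apply, Pi.mul_apply]
  linear_combination ft y (flow b x t y) * this

theorem transport_add_one (h : IsField b bt B) (hp : ∀ x t, b x (t + 1) = b x t)
    {f : ℝ → ℝ → ℝ} {v₀ : ℝ → ℝ} (hf : ∀ x t, f x (t + 1) = f x t) (hv : ∀ t, v₀ (t + 1) = v₀ t)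
    (x t : ℝ) : transport b f v₀ x (t + 1) = transport b f v₀ x t := by
  simp [transport, h.flow_add_one hp, hf, hv]

/-- Sup bound for the transport equation with vanishing data. -/
theorem abs_le_integral (h : IsField b bt B) {v vt r : ℝ → ℝ → ℝ} {ρ : ℝ → ℝ} {L : ℝ}
    (hv : Continuous (uncurry v)) (hvt : Continuous (uncurry vt))
    (hd : ∀ x t, HasDerivAt (v x) (vt x t) t)
    (hx : ∀ x ∈ Ioo 0 L, ∀ t, HasDerivAt (fun y => v y t) (r x t - b x t * vt x t) x)
    (h0 : ∀ t, v 0 t = 0) (hρ : Continuous ρ) (hr : ∀ x ∈ Ioo 0 L, ∀ t, |r x t| ≤ ρ x)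
    {x : ℝ} (hxL : x ∈ Icc 0 L) (t : ℝ) : |v x t| ≤ ∫ y in (0 : ℝ)..x, ρ y := by
  have hcF : Continuous fun y => v y (flow b x t y) :=
    hv.comp (continuous_id.prodMk (h.continuous_flow_right x t))
  have hdF : ∀ y ∈ Ioo 0 x, HasDerivAt (fun y => v y (flow b x t y)) (r y (flow b x t y)) y := by
    intro y hy
    have := hasDerivAt_along hvt hd (h.hasDerivAt_flow x t y)
      (hx y ⟨hy.1, hy.2.trans_le hxL.2⟩ (flow b x t y))
    refine this.congr_deriv ?_
    ring
  have hP (y : ℝ) : HasDerivAt (fun y => ∫ η in (0 : ℝ)..y, ρ η) (ρ y) y :=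
    hasDerivAt_primitive hρ 0 y
  have hPc : Continuous fun y => ∫ η in (0 : ℝ)..y, ρ η :=
    continuous_iff_continuousAt.2 fun y => (hP y).continuousAt
  -- For either sign `s`, the integral of `ρ` minus `s v` is nondecreasing along the characteristic
  -- and vanishes at `0`. The two signs give the absolute value.
  have bound (s : ℝ) (hs : |s| = 1) : s * v x t ≤ ∫ y in (0 : ℝ)..x, ρ y := by
    have mono : MonotoneOn (fun y => (∫ η in (0 : ℝ)..y, ρ η) - s * v y (flow b x t y))
        (Icc 0 x) := by
      refine monotoneOn_of_deriv_nonneg (convex_Icc 0 x)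
        (hPc.sub (hcF.const_mul s)).continuousOn ?_ ?_
      · rw [interior_Icc]
        exact fun y hy =>
          ((hP y).sub ((hdF y hy).const_mul s)).differentiableAt.differentiableWithinAt
      · rw [interior_Icc]
        intro y hy
        rw [((hP y).fun_sub ((hdF y hy).const_mul s)).deriv, sub_nonneg]
        refine (le_abs_self _).trans ?_
        rw [abs_mul, hs, one_mul]
        exact hr y ⟨hy.1, hy.2.trans_le hxL.2⟩ _
    have := mono (left_mem_Icc.2 hxL.1) (right_mem_Icc.2 hxL.1) hxL.1
    simp only [intervalIntegral.integral_same, h0, h.flow_self] at this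
    linarith
  have h1 := bound 1 (by simp)
  have h2 := bound (-1) (by simp)
  exact abs_le.2 ⟨by linarith, by linarith⟩

end IsField

/-! ### Calculus in `C^{1,1/2}` and estimates for transport. -/

/-- `f` is of class `C^{1,1/2}` with derivative `f'` and all relevant bounds at most `g`. -/
structure Reg (g : ℝ) (f f' : ℝ → ℝ) : Prop where
  deriv : ∀ t, HasDerivAt f (f' t) t
  bound : ∀ t, |f t| ≤ g
  bound' : ∀ t, |f' t| ≤ g
  holder : ∀ t s, |f' t - f' s| ≤ g * √|t - s|

namespace Reg

variable {g g₁ g₂ : ℝ} {f f' h h' : ℝ → ℝ}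

theorem nonneg (hf : Reg g f f') : 0 ≤ g := (abs_nonneg _).trans (hf.bound 0)

theorem mono (hf : Reg g₁ f f') (hg : g₁ ≤ g₂) : Reg g₂ f f' where
  deriv := hf.deriv
  bound t := (hf.bound t).trans hg
  bound' t := (hf.bound' t).trans hg
  holder t s := (hf.holder t s).trans (by gcongr)

theorem zero (hg : 0 ≤ g) : Reg g (fun _ => 0) (fun _ => 0) where
  deriv t := hasDerivAt_const t 0
  bound t := by simpa using hg
  bound' t := by simpa using hg
  holder t s := by simpa using mul_nonneg hg (Real.sqrt_nonneg _)

theorem add (hf : Reg g₁ f f') (hh : Reg g₂ h h') :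
    Reg (g₁ + g₂) (fun t => f t + h t) (fun t => f' t + h' t) where
  deriv t := (hf.deriv t).add (hh.deriv t)
  bound t := (abs_add_le _ _).trans (add_le_add (hf.bound t) (hh.bound t))
  bound' t := (abs_add_le _ _).trans (add_le_add (hf.bound' t) (hh.bound' t))
  holder t s := by
    rw [add_sub_add_comm, add_mul]
    exact (abs_add_le _ _).trans (add_le_add (hf.holder t s) (hh.holder t s))

theorem const_mul (hf : Reg g f f') (c : ℝ) :
    Reg (|c| * g) (fun t => c * f t) (fun t => c * f' t) where
  deriv t := (hf.deriv t).const_mul c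
  bound t := by rw [abs_mul]; gcongr; exact hf.bound t
  bound' t := by rw [abs_mul]; gcongr; exact hf.bound' t
  holder t s := by
    rw [← mul_sub, abs_mul, mul_assoc]
    gcongr
    exact hf.holder t s

theorem abs_sub_le (hf : Reg g f f') (t s : ℝ) : |f t - f s| ≤ g * |t - s| := by
  have := convex_univ.norm_image_sub_le_of_norm_hasDerivWithin_le (f := f)
    (fun y _ => (hf.deriv y).hasDerivWithinAt) (fun y _ => hf.bound' y) (mem_univ s) (mem_univ t)
  simpa using this

theorem abs_sub_le_sqrt (hf : Reg g f f') (t s : ℝ) : |f t - f s| ≤ 2 * g * √|t - s| := by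
  have h0 := hf.nonneg
  rcases le_total |t - s| 1 with h1 | h1
  · have h2 : |t - s| ≤ √|t - s| := Real.le_sqrt_of_sq_le (by nlinarith [abs_nonneg (t - s)])
    calc |f t - f s| ≤ g * |t - s| := hf.abs_sub_le t s
      _ ≤ 2 * g * √|t - s| := by nlinarith [Real.sqrt_nonneg |t - s|]
  · have h2 : 1 ≤ √|t - s| := Real.one_le_sqrt.2 h1
    calc |f t - f s| ≤ |f t| + |f s| := abs_sub _ _
      _ ≤ g + g := add_le_add (hf.bound t) (hf.bound s)
      _ ≤ 2 * g * √|t - s| := by nlinarith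

/-- The constant is `6 = 1 + 2 + 2 + 1`: the Hölder estimate of the product rule has four
differences, and each difference of an undifferentiated factor costs `2` by `abs_sub_le_sqrt`. -/
theorem mul (hf : Reg g₁ f f') (hh : Reg g₂ h h') :
    Reg (6 * g₁ * g₂) (fun t => f t * h t) (fun t => f' t * h t + f t * h' t) := by
  have h1 := hf.nonneg
  have h2 := hh.nonneg
  have h12 := mul_nonneg h1 h2
  have prod {a b x y : ℝ} (hx : |a| ≤ x) (hy : |b| ≤ y) : |a * b| ≤ x * y := by
    rw [abs_mul]
    exact mul_le_mul hx hy (abs_nonneg _) ((abs_nonneg _).trans hx)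
  refine ⟨fun t => (hf.deriv t).mul (hh.deriv t), fun t => ?_, fun t => ?_, fun t s => ?_⟩
  · exact (prod (hf.bound t) (hh.bound t)).trans (by nlinarith)
  · exact (abs_add_le _ _).trans ((add_le_add (prod (hf.bound' t) (hh.bound t))
      (prod (hf.bound t) (hh.bound' t))).trans (by nlinarith))
  · have e : f' t * h t + f t * h' t - (f' s * h s + f s * h' s) =
        ((f' t - f' s) * h t + f' s * (h t - h s)) +
          ((f t - f s) * h' t + f s * (h' t - h' s)) := by ring
    rw [e]
    calc _ ≤ (g₁ * √|t - s| * g₂ + g₁ * (2 * g₂ * √|t - s|)) +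
          (2 * g₁ * √|t - s| * g₂ + g₁ * (g₂ * √|t - s|)) :=
        (abs_add_le _ _).trans (add_le_add
          ((abs_add_le _ _).trans (add_le_add (prod (hf.holder t s) (hh.bound t))
            (prod (hf.bound' s) (hh.abs_sub_le_sqrt t s))))
          ((abs_add_le _ _).trans (add_le_add (prod (hf.abs_sub_le_sqrt t s) (hh.bound' t))
            (prod (hf.bound s) (hh.holder t s)))))
      _ = 6 * g₁ * g₂ * √|t - s| := by ring

/-- The first summand serves the sup bound and the second the derivative bound. The Hölder bound
uses the second and the third, the latter coming from the variation of `1 / f²`. -/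
theorem inv (hf : Reg g f f') {c : ℝ} (hc : 0 < c) (hcf : ∀ t, c ≤ f t) :
    Reg (c⁻¹ + g * c⁻¹ ^ 2 + 4 * g ^ 2 * c⁻¹ ^ 3) (fun t => (f t)⁻¹)
      (fun t => -f' t / f t ^ 2) := by
  have hg := hf.nonneg
  have hpos (t : ℝ) : 0 < f t := hc.trans_le (hcf t)
  have hi (t : ℝ) : |(f t)⁻¹| ≤ c⁻¹ := by
    rw [abs_of_pos (inv_pos.2 (hpos t))]
    exact inv_anti₀ hc (hcf t)
  have hci : 0 < c⁻¹ := inv_pos.2 hc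
  have hi2 (t s : ℝ) : |(f t)⁻¹ * (f s)⁻¹| ≤ c⁻¹ ^ 2 := by
    rw [abs_mul, sq]
    exact mul_le_mul (hi t) (hi s) (abs_nonneg _) hci.le
  have e (t : ℝ) : -f' t / f t ^ 2 = -(f' t * ((f t)⁻¹ * (f t)⁻¹)) := by
    have := (hpos t).ne'
    field_simp
  refine ⟨fun t => (hf.deriv t).fun_inv (hpos t).ne', fun t => ?_, fun t => ?_, fun t s => ?_⟩
  · have h1 := mul_nonneg hg (sq_nonneg c⁻¹)
    have h2 := mul_nonneg (sq_nonneg g) (pow_nonneg hci.le 3)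
    exact (hi t).trans (by linarith)
  · rw [e, abs_neg, abs_mul]
    calc |f' t| * |(f t)⁻¹ * (f t)⁻¹| ≤ g * c⁻¹ ^ 2 :=
          mul_le_mul (hf.bound' t) (hi2 t t) (abs_nonneg _) hg
      _ ≤ _ := by nlinarith [mul_nonneg (sq_nonneg g) (pow_nonneg hci.le 3)]
  · have hd : (f t)⁻¹ - (f s)⁻¹ = (f s - f t) * ((f t)⁻¹ * (f s)⁻¹) := by
      have := (hpos t).ne'
      have := (hpos s).ne'
      field_simp
    have hdi : |(f t)⁻¹ - (f s)⁻¹| ≤ 2 * g * √|t - s| * c⁻¹ ^ 2 := by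
      rw [hd, abs_mul, abs_sub_comm]
      exact mul_le_mul (hf.abs_sub_le_sqrt t s) (hi2 t s) (abs_nonneg _) (by positivity)
    have e2 : -f' t / f t ^ 2 - -f' s / f s ^ 2 = -((f' t - f' s) * ((f t)⁻¹ * (f t)⁻¹) +
        f' s * (((f t)⁻¹ + (f s)⁻¹) * ((f t)⁻¹ - (f s)⁻¹))) := by
      rw [e, e]
      ring
    rw [e2, abs_neg]
    have hsum : |(f t)⁻¹ + (f s)⁻¹| ≤ c⁻¹ + c⁻¹ :=
      (abs_add_le _ _).trans (add_le_add (hi t) (hi s))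
    calc _ ≤ |f' t - f' s| * |(f t)⁻¹ * (f t)⁻¹| +
          |f' s| * (|(f t)⁻¹ + (f s)⁻¹| * |(f t)⁻¹ - (f s)⁻¹|) := by
          refine (abs_add_le _ _).trans ?_
          rw [abs_mul, abs_mul (f' s), abs_mul ((f t)⁻¹ + (f s)⁻¹)]
      _ ≤ g * √|t - s| * c⁻¹ ^ 2 + g * ((c⁻¹ + c⁻¹) * (2 * g * √|t - s| * c⁻¹ ^ 2)) := by
          gcongr
          · exact hf.holder t s
          · exact hi2 t t
          · exact hf.bound' s
      _ = (g * c⁻¹ ^ 2 + 4 * g ^ 2 * c⁻¹ ^ 3) * √|t - s| := by ring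
      _ ≤ _ := by
          gcongr
          linarith

/-- The derivatives of two `C^{1,1/2}` functions that are close are close. -/
theorem abs_deriv_sub_le (hf : Reg g f f') (hh : Reg g h h') {η : ℝ}
    (hη : ∀ t, |f t - h t| ≤ η) {s : ℝ} (hs : 0 < s) (t : ℝ) :
    |f' t - h' t| ≤ 2 * η / s + 2 * g * √s := by
  have hd (t : ℝ) : HasDerivAt (fun t => f t - h t) (f' t - h' t) t := (hf.deriv t).sub (hh.deriv t)
  -- At some point within distance `s` of `t` the derivatives differ by at most `2η/s`; the Hölder
  -- bounds carry this back to `t`. The length `s` is left free in order to balance the two errors.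
  obtain ⟨ξ, hξ, e⟩ := exists_hasDerivAt_eq_slope (fun t => f t - h t) (fun t => f' t - h' t)
    (by linarith : t < t + s) (fun y _ => (hd y).continuousAt.continuousWithinAt)
    (fun y _ => hd y)
  have h1 : |f' ξ - h' ξ| ≤ 2 * η / s := by
    rw [e, abs_div, add_sub_cancel_left, abs_of_pos hs]
    gcongr
    exact (abs_sub _ _).trans (by linarith [hη (t + s), hη t])
  have hr : √|t - ξ| ≤ √s := by
    apply Real.sqrt_le_sqrt
    rw [abs_sub_comm, abs_of_pos (sub_pos.2 hξ.1)]
    linarith [hξ.2]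
  have hg := hf.nonneg
  have h2 : |f' t - f' ξ| ≤ g * √s := (hf.holder t ξ).trans (by gcongr)
  have h3 : |h' t - h' ξ| ≤ g * √s := (hh.holder t ξ).trans (by gcongr)
  have e2 : f' t - h' t = (f' ξ - h' ξ) + ((f' t - f' ξ) - (h' t - h' ξ)) := by ring
  rw [e2]
  refine (abs_add_le _ _).trans ?_
  linarith [abs_sub (f' t - f' ξ) (h' t - h' ξ)]

/-- With `e = exp (B L)`, the Hölder bound has a contribution `e² g` from the variation of `f'` and
`e² L B g` from that of `flowDeriv`. The factor in front of `g` does not depend on `f`. -/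
theorem comp_flow {b bt : ℝ → ℝ → ℝ} {B : ℝ} (hb : IsField b bt B)
    (hbr : ∀ x, Reg B (b x) (bt x)) (hf : Reg g f f') {L x y : ℝ} (hL : |y - x| ≤ L) :
    Reg (Real.exp (B * L) ^ 2 * (1 + L * B) * g) (fun t => f (flow b x t y))
      (fun t => f' (flow b x t y) * flowDeriv b bt x t y) := by
  have hB := hb.nonneg
  have hg := hf.nonneg
  have hL0 : 0 ≤ L := (abs_nonneg _).trans hL
  set e := Real.exp (B * L) with he
  have he1 : 1 ≤ e := Real.one_le_exp (by positivity)
  have hmono {z : ℝ} (hz : |z - x| ≤ L) : Real.exp (B * |z - x|) ≤ e :=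
    Real.exp_le_exp.2 (by gcongr)
  have hE (t : ℝ) : |flowDeriv b bt x t y| ≤ e := by
    rw [abs_of_pos (IsField.flowDeriv_pos _ _ _ _ _)]
    exact (hb.flowDeriv_le x t y).trans (hmono hL)
  have hΦ (t s : ℝ) {z : ℝ} (hz : |z - x| ≤ L) :
      √|flow b x t z - flow b x s z| ≤ e * √|t - s| := by
    calc √|flow b x t z - flow b x s z| ≤ √(e * |t - s|) := by
          apply Real.sqrt_le_sqrt
          exact (hb.abs_flow_sub_flow_le x s t z).trans (by gcongr; exact hmono hz)
      _ = √e * √|t - s| := Real.sqrt_mul (by positivity) _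
      _ ≤ e * √|t - s| := by gcongr; exact (Real.sqrt_le_iff.2 ⟨by positivity, by nlinarith⟩)
  have hEh (t s : ℝ) : |flowDeriv b bt x t y - flowDeriv b bt x s y| ≤
      e * (B * (e * √|t - s|) * L) := by
    have hc (t : ℝ) : Continuous fun η => bt η (flow b x t η) :=
      (hb.continuous_along hb.cont_t).comp (by fun_prop : Continuous fun η : ℝ => ((x, t), η))
    set I : ℝ → ℝ := fun t => ∫ η in x..y, bt η (flow b x t η) with hI
    have hIb (t : ℝ) : I t ≤ B * L := (le_abs_self _).trans
      ((abs_intervalIntegral_le (fun _ => hb.bound_t _ _) x y).trans (by gcongr))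
    have hId : |I t - I s| ≤ B * (e * √|t - s|) * L := by
      have e1 : I t - I s = ∫ η in x..y, (bt η (flow b x t η) - bt η (flow b x s η)) :=
        (intervalIntegral.integral_sub ((hc t).intervalIntegrable _ _)
          ((hc s).intervalIntegrable _ _)).symm
      rw [e1, ← Real.norm_eq_abs]
      refine (intervalIntegral.norm_integral_le_of_norm_le_const (C := B * (e * √|t - s|))
        fun z hz => ?_).trans (by gcongr)
      refine ((hbr z).holder _ _).trans ?_
      gcongr
      refine hΦ t s (le_trans ?_ hL)
      rcases le_total x y with h | h
      · rw [uIoc_of_le h] at hz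
        rw [abs_of_nonneg (by linarith [hz.1]), abs_of_nonneg (by linarith)]
        linarith [hz.2]
      · rw [uIoc_of_ge h] at hz
        rw [abs_of_nonpos (by linarith [hz.2]), abs_of_nonpos (by linarith)]
        linarith [hz.1]
    have hexp {u v : ℝ} (hu : u ≤ B * L) (huv : v ≤ u) :
        |Real.exp u - Real.exp v| ≤ e * |u - v| := by
      have h1 : 0 ≤ Real.exp u - Real.exp v := sub_nonneg.2 (Real.exp_le_exp.2 huv)
      rw [abs_of_nonneg h1, abs_of_nonneg (sub_nonneg.2 huv)]
      have h2 : Real.exp v = Real.exp u * Real.exp (v - u) := by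
        rw [← Real.exp_add]; congr 1; ring
      have h3 := Real.add_one_le_exp (v - u)
      have h4 : Real.exp u ≤ e := Real.exp_le_exp.2 hu
      have h5 := Real.exp_pos u
      rw [h2]
      nlinarith [sub_nonneg.2 huv]
    have : |Real.exp (I t) - Real.exp (I s)| ≤ e * |I t - I s| := by
      rcases le_total (I s) (I t) with h | h
      · exact hexp (hIb t) h
      · rw [abs_sub_comm, abs_sub_comm (I t)]
        exact hexp (hIb s) h
    exact this.trans (by gcongr)
  have hee : 1 ≤ e ^ 2 := one_le_pow₀ he1
  have hLB : 0 ≤ L * B := by positivity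
  refine ⟨fun t => (hf.deriv _).comp t (hb.hasDerivAt_flow_left x t y), fun t => ?_, fun t => ?_,
    fun t s => ?_⟩
  · calc |f (flow b x t y)| ≤ 1 * 1 * g := by simpa using hf.bound _
      _ ≤ _ := by gcongr; linarith
  · rw [abs_mul]
    calc |f' (flow b x t y)| * |flowDeriv b bt x t y| ≤ g * e := by
          gcongr
          exacts [hf.bound' _, hE t]
      _ = e ^ 1 * 1 * g := by ring
      _ ≤ _ := by
          gcongr
          exacts [by norm_num, by linarith]
  · have e1 : f' (flow b x t y) * flowDeriv b bt x t y - f' (flow b x s y) * flowDeriv b bt x s y =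
        (f' (flow b x t y) - f' (flow b x s y)) * flowDeriv b bt x t y +
          f' (flow b x s y) * (flowDeriv b bt x t y - flowDeriv b bt x s y) := by ring
    rw [e1]
    refine (abs_add_le _ _).trans ?_
    rw [abs_mul, abs_mul]
    calc _ ≤ g * (e * √|t - s|) * e + g * (e * (B * (e * √|t - s|) * L)) := by
          gcongr
          · exact (hf.holder _ _).trans (by gcongr; exact hΦ t s hL)
          · exact hE t
          · exact hf.bound' _
          · exact hEh t s
      _ = e ^ 2 * (1 + L * B) * g * √|t - s| := by ring

/-- Both terms of Duhamel's formula are compositions with the flow, so `comp_flow` applies to each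
slice and is integrated in `y`. The bound is linear in data and source, and the speed enters only
through `B`; this is what a Gronwall argument for the iteration needs. -/
theorem transport {b bt f ft : ℝ → ℝ → ℝ} {v₀ v₀' : ℝ → ℝ} {B G₀ L : ℝ} {F : ℝ → ℝ}
    (hb : IsField b bt B) (hbr : ∀ x, Reg B (b x) (bt x))
    (hf : Continuous (uncurry f)) (hft : Continuous (uncurry ft))
    (hfr : ∀ x, Reg (F x) (f x) (ft x)) (hF : Continuous F) (hv : Reg G₀ v₀ v₀')
    {x : ℝ} (hx : x ∈ Icc 0 L) :
    Reg (Real.exp (B * L) ^ 2 * (1 + L * B) * (G₀ + ∫ y in (0 : ℝ)..x, F y))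
      (transport b f v₀ x) (transportDeriv b bt ft v₀' x) := by
  set C := Real.exp (B * L) ^ 2 * (1 + L * B)
  have h0 : Reg (C * G₀) _ _ := hv.comp_flow hb hbr
    (by rw [zero_sub, abs_neg, abs_of_nonneg hx.1]; exact hx.2 : |0 - x| ≤ L)
  have hy {y : ℝ} (hy : y ∈ Ioc 0 x) : Reg (C * F y) _ _ := (hfr y).comp_flow hb hbr (x := x)
    (by rw [abs_sub_comm, abs_of_nonneg] <;> linarith [hy.1, hy.2, hx.2] : |y - x| ≤ L)
  have hc (t : ℝ) : Continuous fun y : ℝ => ((x, t), y) := by fun_prop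
  have hc1 (t : ℝ) : Continuous fun y => f y (flow b x t y) := (hb.continuous_along hf).comp (hc t)
  have hc2 (t : ℝ) : Continuous fun y => ft y (flow b x t y) * flowDeriv b bt x t y :=
    (hb.continuous_along_mul hft).comp (hc t)
  have hCF : Continuous fun y => C * F y := hF.const_mul C
  have int_le {k : ℝ → ℝ} {s : ℝ} (hk : ∀ y ∈ Ioc 0 x, |k y| ≤ C * F y * s) :
      |∫ y in (0 : ℝ)..x, k y| ≤ C * (∫ y in (0 : ℝ)..x, F y) * s := by
    rw [← Real.norm_eq_abs, ← intervalIntegral.integral_const_mul,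
      ← intervalIntegral.integral_mul_const]
    exact intervalIntegral.norm_integral_le_of_norm_le hx.1 (Eventually.of_forall hk)
      ((hCF.mul_const s).intervalIntegrable _ _)
  refine ⟨fun t => hb.hasDerivAt_transport hf hft (fun x => (hfr x).deriv) hv.deriv x t,
    fun t => ?_, fun t => ?_, fun t s => ?_⟩
  · have := int_le (s := 1) fun y h => ((hy h).bound t).trans_eq (mul_one _).symm
    rw [mul_one] at this
    rw [mul_add]
    exact (abs_add_le _ _).trans (add_le_add (h0.bound t) this)
  · have := int_le (s := 1) fun y h => ((hy h).bound' t).trans_eq (mul_one _).symm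
    rw [mul_one] at this
    rw [mul_add]
    exact (abs_add_le _ _).trans (add_le_add (h0.bound' t) this)
  · have := int_le fun y h => (hy h).holder t s
    rw [intervalIntegral.integral_sub ((hc2 t).intervalIntegrable _ _)
      ((hc2 s).intervalIntegrable _ _)] at this
    simp only [transportDeriv]
    rw [mul_add, add_mul, add_sub_add_comm]
    exact (abs_add_le _ _).trans (add_le_add (h0.holder t s) this)

end Reg

/-! ### Speeds and sources of the quasilinear system. -/

/-- The eigenvalues in the symmetric form `λᵢ = (1 + κ) zᵢ + (1 - κ) zⱼ`, `j ≠ i`,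
`κ = (γ - 1) / 2`. -/
def lam (κ : ℝ) (i : Fin 2) (z : Fin 2 → ℝ) : ℝ := (1 + κ) * z i + (1 - κ) * z (i + 1)

/-- The norm of the linear forms `lam κ i`. -/
def lamNorm (κ : ℝ) : ℝ := |1 + κ| + |1 - κ|

theorem lam_sub (κ : ℝ) (i : Fin 2) (z z' : Fin 2 → ℝ) :
    lam κ i z - lam κ i z' = lam κ i fun j => z j - z' j := by
  simp only [lam]
  ring

theorem lam_add (κ : ℝ) (i : Fin 2) (z z' : Fin 2 → ℝ) :
    (lam κ i fun j => z j + z' j) = lam κ i z + lam κ i z' := by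
  simp only [lam]
  ring

theorem abs_lam_le {κ d : ℝ} {z : Fin 2 → ℝ} (hz : ∀ j, |z j| ≤ d) (i : Fin 2) :
    |lam κ i z| ≤ lamNorm κ * d := by
  rw [lam, lamNorm, add_mul |1 + κ|]
  refine (abs_add_le _ _).trans ?_
  rw [abs_mul, abs_mul]
  gcongr
  exacts [hz _, hz _]

theorem lamNorm_pos (κ : ℝ) : 0 < lamNorm κ := by
  have := abs_add_le (1 + κ) (1 - κ)
  rw [show 1 + κ + (1 - κ) = 2 by ring, abs_two] at this
  rw [lamNorm]
  linarith

/-- The characteristic speeds `1 / λᵢ` along `w + m`. -/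
def speed (κ : ℝ) (w : Fin 2 → ℝ → ℝ) (m : Fin 2 → ℝ → ℝ → ℝ) (i : Fin 2) (x t : ℝ) : ℝ :=
  (lam κ i fun j => w j t + m j x t)⁻¹

/-- The `t`-derivative of `speed`. -/
def speedDeriv (κ : ℝ) (w w' : Fin 2 → ℝ → ℝ) (m p : Fin 2 → ℝ → ℝ → ℝ) (i : Fin 2) (x t : ℝ) :
    ℝ :=
  -(lam κ i fun j => w' j t + p j x t) / (lam κ i fun j => w j t + m j x t) ^ 2

/-- The right-hand sides `(α / 2) (m₁ + m₂) / λᵢ`. -/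
def src (κ : ℝ) (α : ℝ → ℝ) (w : Fin 2 → ℝ → ℝ) (m : Fin 2 → ℝ → ℝ → ℝ) (i : Fin 2) (x t : ℝ) :
    ℝ :=
  1 / 2 * α t * speed κ w m i x t * (m 0 x t + m 1 x t)

/-- The `t`-derivative of `src`. -/
def srcDeriv (κ : ℝ) (α α' : ℝ → ℝ) (w w' : Fin 2 → ℝ → ℝ) (m p : Fin 2 → ℝ → ℝ → ℝ) (i : Fin 2)
    (x t : ℝ) : ℝ :=
  (1 / 2 * α' t * speed κ w m i x t + 1 / 2 * α t * speedDeriv κ w w' m p i x t) *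
      (m 0 x t + m 1 x t) +
    1 / 2 * α t * speed κ w m i x t * (p 0 x t + p 1 x t)

/-- The assumptions on the background `w` and on the damping coefficient `α`. -/
structure IsBackground (κ c A : ℝ) (α α' : ℝ → ℝ) (w w' : Fin 2 → ℝ → ℝ) : Prop where
  c_pos : 0 < c
  reg_α : Reg A α α'
  reg_w : ∀ i, Reg A (w i) (w' i)
  cont_α' : Continuous α'
  cont_w' : ∀ i, Continuous (w' i)
  le_lam : ∀ i t, 2 * c ≤ lam κ i fun j => w j t
  per_α : ∀ t, α (t + 1) = α t
  per_w : ∀ i t, w i (t + 1) = w i t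

/-- `m` is a small `C^{1,1/2}` perturbation with `t`-derivative `p`, bounded by `G`. -/
structure Adm (κ c : ℝ) (G : ℝ → ℝ) (m p : Fin 2 → ℝ → ℝ → ℝ) : Prop where
  cont : ∀ i, Continuous (uncurry (m i))
  cont' : ∀ i, Continuous (uncurry (p i))
  reg : ∀ i x, Reg (G x) (m i x) (p i x)
  per : ∀ i x t, m i x (t + 1) = m i x t
  le_one : ∀ x, G x ≤ 1
  le_c : ∀ x, lamNorm κ * G x ≤ c

/-- A bound for the `C^{1,1/2}` norm of `speed`. -/
def speedBound (κ c A : ℝ) : ℝ :=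
  c⁻¹ + lamNorm κ * (A + 1) * c⁻¹ ^ 2 + 4 * (lamNorm κ * (A + 1)) ^ 2 * c⁻¹ ^ 3

/-- A bound for the `C^{1,1/2}` norm of `src`, relative to that of `m`. -/
def srcBound (κ c A : ℝ) : ℝ := 36 * A * speedBound κ c A

namespace IsBackground

variable {κ c A : ℝ} {α α' : ℝ → ℝ} {w w' : Fin 2 → ℝ → ℝ} {G : ℝ → ℝ}
  {m p n q : Fin 2 → ℝ → ℝ → ℝ}

theorem A_nonneg (h : IsBackground κ c A α α' w w') : 0 ≤ A := h.reg_α.nonneg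

/-- The background leaves room `2 * c`, of which an admissible perturbation uses at most `c`. -/
theorem c_le_lam (h : IsBackground κ c A α α' w w') (hm : Adm κ c G m p) (i : Fin 2) (x t : ℝ) :
    c ≤ lam κ i fun j => w j t + m j x t := by
  rw [lam_add]
  have h1 := h.le_lam i t
  have h2 := (abs_lam_le (κ := κ) (fun j => (hm.reg j x).bound t) i).trans (hm.le_c x)
  have h3 := neg_abs_le (lam κ i fun j => m j x t)
  linarith

theorem lam_pos (h : IsBackground κ c A α α' w w') (hm : Adm κ c G m p) (i : Fin 2) (x t : ℝ) :
    0 < lam κ i fun j => w j t + m j x t := h.c_pos.trans_le (h.c_le_lam hm i x t)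

theorem reg_lam (h : IsBackground κ c A α α' w w') (hm : Adm κ c G m p) (i : Fin 2) (x : ℝ) :
    Reg (lamNorm κ * (A + 1)) (fun t => lam κ i fun j => w j t + m j x t)
      (fun t => lam κ i fun j => w' j t + p j x t) := by
  refine ((((h.reg_w i).add (hm.reg i x)).const_mul (1 + κ)).add
    (((h.reg_w (i + 1)).add (hm.reg (i + 1) x)).const_mul (1 - κ))).mono ?_
  rw [← add_mul]
  unfold lamNorm
  gcongr
  exact hm.le_one x

theorem reg_speed (h : IsBackground κ c A α α' w w') (hm : Adm κ c G m p) (i : Fin 2) (x : ℝ) :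
    Reg (speedBound κ c A) (speed κ w m i x) (speedDeriv κ w w' m p i x) :=
  (h.reg_lam hm i x).inv h.c_pos (h.c_le_lam hm i x)

theorem reg_src (h : IsBackground κ c A α α' w w') (hm : Adm κ c G m p) (i : Fin 2) (x : ℝ) :
    Reg (srcBound κ c A * G x) (src κ α w m i x) (srcDeriv κ α α' w w' m p i x) := by
  refine (((h.reg_α.const_mul (1 / 2)).mul (h.reg_speed hm i x)).mul
    ((hm.reg 0 x).add (hm.reg 1 x))).mono (le_of_eq ?_)
  -- Two product estimates contribute `6` each; the factor `1 / 2` cancels against the two copies of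
  -- `G x`. Hence `36`.
  rw [abs_of_pos (by norm_num), srcBound]
  ring

theorem cont_lam {u : Fin 2 → ℝ → ℝ} {v : Fin 2 → ℝ → ℝ → ℝ} (hu : ∀ i, Continuous (u i))
    (hv : ∀ i, Continuous (uncurry (v i))) (i : Fin 2) :
    Continuous (uncurry fun x t => lam κ i fun j => u j t + v j x t) := by
  have (j : Fin 2) : Continuous fun y : ℝ × ℝ => u j y.2 + v j y.1 y.2 :=
    ((hu j).comp continuous_snd).add (hv j)
  exact ((this i).const_mul _).add ((this (i + 1)).const_mul _)

theorem cont_w (h : IsBackground κ c A α α' w w') (i : Fin 2) : Continuous (w i) :=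
  continuous_iff_continuousAt.2 fun t => ((h.reg_w i).deriv t).continuousAt

theorem cont_α (h : IsBackground κ c A α α' w w') : Continuous α :=
  continuous_iff_continuousAt.2 fun t => (h.reg_α.deriv t).continuousAt

theorem cont_speed (h : IsBackground κ c A α α' w w') (hm : Adm κ c G m p) (i : Fin 2) :
    Continuous (uncurry (speed κ w m i)) :=
  (cont_lam h.cont_w hm.cont i).inv₀ fun y => (h.lam_pos hm i y.1 y.2).ne'

theorem cont_speedDeriv (h : IsBackground κ c A α α' w w') (hm : Adm κ c G m p) (i : Fin 2) :
    Continuous (uncurry (speedDeriv κ w w' m p i)) :=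
  (cont_lam h.cont_w' hm.cont' i).neg.div ((cont_lam h.cont_w hm.cont i).pow 2)
    fun y => pow_ne_zero 2 (h.lam_pos hm i y.1 y.2).ne'

theorem cont_src (h : IsBackground κ c A α α' w w') (hm : Adm κ c G m p) (i : Fin 2) :
    Continuous (uncurry (src κ α w m i)) :=
  ((((h.cont_α.comp continuous_snd).const_mul _).mul (h.cont_speed hm i)).mul
    ((hm.cont 0).add (hm.cont 1)))

theorem cont_srcDeriv (h : IsBackground κ c A α α' w w') (hm : Adm κ c G m p) (i : Fin 2) :
    Continuous (uncurry (srcDeriv κ α α' w w' m p i)) :=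
  ((((((h.cont_α'.comp continuous_snd).const_mul _).mul (h.cont_speed hm i)).add
    (((h.cont_α.comp continuous_snd).const_mul _).mul (h.cont_speedDeriv hm i)))).mul
    ((hm.cont 0).add (hm.cont 1))).add
  ((((h.cont_α.comp continuous_snd).const_mul _).mul (h.cont_speed hm i)).mul
    ((hm.cont' 0).add (hm.cont' 1)))

theorem isField (h : IsBackground κ c A α α' w w') (hm : Adm κ c G m p) (i : Fin 2) :
    IsField (speed κ w m i) (speedDeriv κ w w' m p i) (speedBound κ c A) where
  cont := h.cont_speed hm i
  cont_t := h.cont_speedDeriv hm i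
  deriv x := (h.reg_speed hm i x).deriv
  bound x := (h.reg_speed hm i x).bound
  bound_t x := (h.reg_speed hm i x).bound'

theorem per_speed (h : IsBackground κ c A α α' w w') (hm : Adm κ c G m p) (i : Fin 2) (x t : ℝ) :
    speed κ w m i x (t + 1) = speed κ w m i x t := by
  simp only [speed, h.per_w, hm.per]

theorem per_src (h : IsBackground κ c A α α' w w') (hm : Adm κ c G m p) (i : Fin 2) (x t : ℝ) :
    src κ α w m i x (t + 1) = src κ α w m i x t := by
  simp only [src, h.per_speed hm, h.per_α, hm.per]

theorem speedBound_nonneg (h : IsBackground κ c A α α' w w') : 0 ≤ speedBound κ c A := by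
  have := h.A_nonneg
  have := (lamNorm_pos κ).le
  have := h.c_pos
  unfold speedBound
  positivity

theorem abs_speed_le (h : IsBackground κ c A α α' w w') (hm : Adm κ c G m p) (i : Fin 2)
    (x t : ℝ) : |speed κ w m i x t| ≤ c⁻¹ := by
  rw [speed, abs_of_pos (inv_pos.2 (h.lam_pos hm i x t))]
  exact inv_anti₀ h.c_pos (h.c_le_lam hm i x t)

theorem abs_speed_sub_le (h : IsBackground κ c A α α' w w') (hm : Adm κ c G m p)
    (hn : Adm κ c G n q) {x t d : ℝ} (hd : ∀ j, |m j x t - n j x t| ≤ d) (i : Fin 2) :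
    |speed κ w m i x t - speed κ w n i x t| ≤ lamNorm κ * c⁻¹ ^ 2 * d := by
  have e : speed κ w m i x t - speed κ w n i x t =
      -(lam κ i fun j => m j x t - n j x t) * (speed κ w m i x t * speed κ w n i x t) := by
    have h1 := (h.lam_pos hm i x t).ne'
    have h2 := (h.lam_pos hn i x t).ne'
    have h3 := lam_sub κ i (fun j => w j t + m j x t) (fun j => w j t + n j x t)
    simp only [add_sub_add_left_eq_sub] at h3
    rw [← h3, speed, speed]
    field_simp
    ring
  rw [e, abs_mul, abs_neg, abs_mul]
  have hc := inv_nonneg.2 h.c_pos.le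
  calc _ ≤ lamNorm κ * d * (c⁻¹ * c⁻¹) := by
        have h1 := abs_lam_le (κ := κ) hd i
        gcongr
        · exact (abs_nonneg _).trans h1
        · exact h.abs_speed_le hm i x t
        · exact h.abs_speed_le hn i x t
    _ = _ := by ring

theorem abs_src_sub_le (h : IsBackground κ c A α α' w w') (hm : Adm κ c G m p)
    (hn : Adm κ c G n q) {x t d : ℝ} (hd : ∀ j, |m j x t - n j x t| ≤ d) (i : Fin 2) :
    |src κ α w m i x t - src κ α w n i x t| ≤ A * (lamNorm κ * c⁻¹ ^ 2 + c⁻¹) * d := by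
  have e : src κ α w m i x t - src κ α w n i x t = 1 / 2 * α t *
      ((speed κ w m i x t - speed κ w n i x t) * (m 0 x t + m 1 x t) +
        speed κ w n i x t * ((m 0 x t - n 0 x t) + (m 1 x t - n 1 x t))) := by
    simp only [src]
    ring
  rw [e, abs_mul, abs_mul, abs_of_pos (by norm_num : (0 : ℝ) < 1 / 2)]
  have hA := h.A_nonneg
  have hd0 : 0 ≤ d := (abs_nonneg _).trans (hd 0)
  have hc := inv_nonneg.2 h.c_pos.le
  have hl := (lamNorm_pos κ).le
  have hm' (j : Fin 2) : |m j x t| ≤ 1 := ((hm.reg j x).bound t).trans (hm.le_one x)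
  calc _ ≤ 1 / 2 * A * (lamNorm κ * c⁻¹ ^ 2 * d * (1 + 1) + c⁻¹ * (d + d)) := by
        gcongr
        · exact h.reg_α.bound t
        · refine (abs_add_le _ _).trans ?_
          rw [abs_mul, abs_mul]
          gcongr
          · exact h.abs_speed_sub_le hm hn hd i
          · exact (abs_add_le _ _).trans (add_le_add (hm' 0) (hm' 1))
          · exact h.abs_speed_le hn i x t
          · exact (abs_add_le _ _).trans (add_le_add (hd 0) (hd 1))
    _ = _ := by ring

end IsBackground

/-! ### The iteration and its fixed point. -/

/-- The projection of `ℝ` onto `[0, L]`. -/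
def clamp (L x : ℝ) : ℝ := max 0 (min x L)

theorem continuous_clamp (L : ℝ) : Continuous (clamp L) := by
  unfold clamp
  fun_prop

theorem clamp_mem {L : ℝ} (hL : 0 ≤ L) (x : ℝ) : clamp L x ∈ Icc 0 L :=
  ⟨le_max_left _ _, max_le hL (min_le_right _ _)⟩

theorem clamp_of_mem {L x : ℝ} (hx : x ∈ Icc 0 L) : clamp L x = x := by
  rw [clamp, min_eq_left hx.2, max_eq_right hx.1]

/-- One step of the iteration. -/
def iterStep (κ L : ℝ) (α : ℝ → ℝ) (w : Fin 2 → ℝ → ℝ) (m₀ : Fin 2 → ℝ → ℝ)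
    (m : Fin 2 → ℝ → ℝ → ℝ) (i : Fin 2) (x : ℝ) : ℝ → ℝ :=
  transport (speed κ w m i) (src κ α w m i) (m₀ i) (clamp L x)

/-- The `t`-derivative of `iterStep`. -/
def iterStepDeriv (κ L : ℝ) (α α' : ℝ → ℝ) (w w' : Fin 2 → ℝ → ℝ) (m₀' : Fin 2 → ℝ → ℝ)
    (m p : Fin 2 → ℝ → ℝ → ℝ) (i : Fin 2) (x : ℝ) : ℝ → ℝ :=
  transportDeriv (speed κ w m i) (speedDeriv κ w w' m p i) (srcDeriv κ α α' w w' m p i) (m₀' i)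
    (clamp L x)

/-- The growth constant of `C^{1,1/2}` norms along the transport equation. -/
def transportBound (κ c A L : ℝ) : ℝ :=
  Real.exp (speedBound κ c A * L) ^ 2 * (1 + L * speedBound κ c A)

/-- The majorant of the iterates. -/
def majorant (κ c A L ε x : ℝ) : ℝ :=
  2 * transportBound κ c A L * ε *
    Real.exp (2 * transportBound κ c A L * srcBound κ c A * clamp L x)

/-- The Lipschitz constant of one step of the iteration. -/
def stepLip (κ c A : ℝ) : ℝ :=
  A * (lamNorm κ * c⁻¹ ^ 2 + c⁻¹) + lamNorm κ * c⁻¹ ^ 2 + 1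

namespace IsBackground

variable {κ c A L ε : ℝ} {α α' : ℝ → ℝ} {w w' m₀ m₀' : Fin 2 → ℝ → ℝ} {G : ℝ → ℝ}
  {m p n q : Fin 2 → ℝ → ℝ → ℝ}

theorem transportBound_pos (h : IsBackground κ c A α α' w w') (hL : 0 ≤ L) :
    0 < transportBound κ c A L := by
  have := h.speedBound_nonneg
  unfold transportBound
  positivity

theorem srcBound_nonneg (h : IsBackground κ c A α α' w w') : 0 ≤ srcBound κ c A := by
  have := h.speedBound_nonneg
  have := h.A_nonneg
  unfold srcBound
  positivity

theorem continuous_majorant : Continuous (majorant κ c A L ε) := by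
  have := continuous_clamp L
  unfold majorant
  fun_prop

/-- The majorant is designed so that the transport estimate with source bound `srcBound * majorant`
returns exactly half of it on `[0, L]`: up to the factor `srcBound`, it is the derivative of `ε exp
(2TSx)`. -/
theorem integral_majorant_eq {x : ℝ} (hx : x ∈ Icc 0 L) :
    transportBound κ c A L *
      (ε + ∫ y in (0 : ℝ)..x, srcBound κ c A * majorant κ c A L ε y) =
      transportBound κ c A L * ε * Real.exp (2 * transportBound κ c A L * srcBound κ c A * x) := by
  set T := transportBound κ c A L with hT
  set S := srcBound κ c A with hS
  have hi : ∫ y in (0 : ℝ)..x, S * majorant κ c A L ε y = ε * Real.exp (2 * T * S * x) - ε := by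
    have hd (y : ℝ) : HasDerivAt (fun y => ε * Real.exp (2 * T * S * y))
        (S * (2 * T * ε * Real.exp (2 * T * S * y))) y := by
      have := (((hasDerivAt_id y).const_mul (2 * T * S)).exp).const_mul ε
      refine this.congr_deriv ?_
      simp only [id]
      ring
    have hc : Continuous fun y => S * (2 * T * ε * Real.exp (2 * T * S * y)) := by fun_prop
    rw [intervalIntegral.integral_congr (g := fun y => S * (2 * T * ε * Real.exp (2 * T * S * y))),
      intervalIntegral.integral_eq_sub_of_hasDerivAt (fun y _ => hd y) (hc.intervalIntegrable _ _)]
    · simp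
    · intro y hy
      rw [uIcc_of_le hx.1] at hy
      simp only [majorant, clamp_of_mem ⟨hy.1, hy.2.trans hx.2⟩, ← hT, ← hS]
  rw [hi]
  ring

/-- The class of functions below the majorant is invariant. The constants of the transport estimate
are the same for all its members, because `speedBound` does not involve `m`. -/
theorem adm_iterStep (h : IsBackground κ c A α α' w w') (hL : 0 ≤ L) (hε : 0 ≤ ε)
    (hm₀ : ∀ i, Reg ε (m₀ i) (m₀' i)) (hm₀' : ∀ i, Continuous (m₀' i))
    (hper : ∀ i t, m₀ i (t + 1) = m₀ i t)
    (hm : Adm κ c (majorant κ c A L ε) m p) :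
    Adm κ c (majorant κ c A L ε) (iterStep κ L α w m₀ m) (iterStepDeriv κ L α α' w w' m₀' m p) where
  cont i := ((h.isField hm i).continuous_transport (h.cont_src hm i)
    (continuous_iff_continuousAt.2 fun t => ((hm₀ i).deriv t).continuousAt)).comp
    (((continuous_clamp L).comp continuous_fst).prodMk continuous_snd)
  cont' i := ((h.isField hm i).continuous_transportDeriv (h.cont_srcDeriv hm i) (hm₀' i)).comp
    (((continuous_clamp L).comp continuous_fst).prodMk continuous_snd)
  reg i x := by
    have hT := h.transportBound_pos hL
    refine (Reg.transport (h.isField hm i) (h.reg_speed hm i) (h.cont_src hm i)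
      (h.cont_srcDeriv hm i) (h.reg_src hm i) (continuous_majorant.const_mul _) (hm₀ i)
      (clamp_mem hL x)).mono ?_
    refine (integral_majorant_eq (clamp_mem hL x)).trans_le ?_
    unfold majorant
    gcongr
    linarith
  per i x t := (h.isField hm i).transport_add_one (h.per_speed hm i) (h.per_src hm i) (hper i) _ _
  le_one := hm.le_one
  le_c := hm.le_c

theorem hasDerivAt_iterStep (h : IsBackground κ c A α α' w w')
    (hm₀ : ∀ i, Reg ε (m₀ i) (m₀' i)) (hm₀' : ∀ i, Continuous (m₀' i))
    (hm : Adm κ c G m p) (i : Fin 2) {x : ℝ} (hx : x ∈ Ioo 0 L) (t : ℝ) :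
    HasDerivAt (fun y => iterStep κ L α w m₀ m i y t)
      (src κ α w m i x t - speed κ w m i x t * iterStepDeriv κ L α α' w w' m₀' m p i x t) x := by
  have := (h.isField hm i).hasDerivAt_transport_left (h.cont_src hm i) (h.cont_srcDeriv hm i)
    (fun x => (h.reg_src hm i x).deriv) (hm₀ i).deriv (hm₀' i) x t
  rw [iterStepDeriv, clamp_of_mem (Ioo_subset_Icc_self hx)]
  refine this.congr_of_eventuallyEq ?_
  filter_upwards [Icc_mem_nhds hx.1 hx.2] with y hy
  rw [iterStep, clamp_of_mem hy]

/-- Let `M` be the image of `m`. The difference of the images is transported with the speed of `n`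
and has source `(src m - src n) - (speed m - speed n) ∂ₜM`. The last factor is bounded by
admissibility; one derivative is lost, so the estimate is in the sup norm only. -/
theorem abs_iterStep_sub_le (h : IsBackground κ c A α α' w w') (hL : 0 ≤ L) (hε : 0 ≤ ε)
    (hm₀ : ∀ i, Reg ε (m₀ i) (m₀' i)) (hm₀' : ∀ i, Continuous (m₀' i))
    (hper : ∀ i t, m₀ i (t + 1) = m₀ i t)
    (hm : Adm κ c (majorant κ c A L ε) m p) (hn : Adm κ c (majorant κ c A L ε) n q)
    {d : ℝ → ℝ} (hd : Continuous d)
    (hmn : ∀ x ∈ Icc 0 L, ∀ t j, |m j x t - n j x t| ≤ d x) {x : ℝ} (hx : x ∈ Icc 0 L)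
    (t : ℝ) (i : Fin 2) :
    |iterStep κ L α w m₀ m i x t - iterStep κ L α w m₀ n i x t| ≤
      stepLip κ c A * ∫ y in (0 : ℝ)..x, d y := by
  have hM := h.adm_iterStep hL hε hm₀ hm₀' hper hm
  have hN := h.adm_iterStep hL hε hm₀ hm₀' hper hn
  rw [← intervalIntegral.integral_const_mul]
  refine (h.isField hn i).abs_le_integral (L := L)
    (v := fun x t => iterStep κ L α w m₀ m i x t - iterStep κ L α w m₀ n i x t)
    (vt := fun x t => iterStepDeriv κ L α α' w w' m₀' m p i x t -
      iterStepDeriv κ L α α' w w' m₀' n q i x t)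
    (r := fun x t => src κ α w m i x t - src κ α w n i x t -
      (speed κ w m i x t - speed κ w n i x t) * iterStepDeriv κ L α α' w w' m₀' m p i x t)
    ((hM.cont i).sub (hN.cont i)) ((hM.cont' i).sub (hN.cont' i))
    (fun x t => ((hM.reg i x).deriv t).sub ((hN.reg i x).deriv t)) (fun x hx t => ?_)
    (fun t => ?_) (hd.const_mul _) (fun x hx t => ?_) hx t
  · refine ((h.hasDerivAt_iterStep hm₀ hm₀' hm i hx t).sub
      (h.hasDerivAt_iterStep hm₀ hm₀' hn i hx t)).congr_deriv ?_
    ring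
  · simp [iterStep, clamp_of_mem (left_mem_Icc.2 hL), (h.isField hm i).transport_zero,
      (h.isField hn i).transport_zero]
  · have h1 := h.abs_src_sub_le hm hn (hmn x (Ioo_subset_Icc_self hx) t) i
    have h2 := h.abs_speed_sub_le hm hn (hmn x (Ioo_subset_Icc_self hx) t) i
    have h3 := ((hM.reg i x).bound' t).trans (hM.le_one x)
    have hd0 : 0 ≤ d x := (abs_nonneg _).trans (hmn x (Ioo_subset_Icc_self hx) t 0)
    have hd1 : 0 ≤ lamNorm κ * c⁻¹ ^ 2 * d x := (abs_nonneg _).trans h2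
    calc _ ≤ A * (lamNorm κ * c⁻¹ ^ 2 + c⁻¹) * d x + lamNorm κ * c⁻¹ ^ 2 * d x * 1 := by
          refine (abs_sub _ _).trans (add_le_add h1 ?_)
          rw [abs_mul]
          gcongr
      _ ≤ stepLip κ c A * d x := by
          unfold stepLip
          linarith

theorem stepLip_pos (h : IsBackground κ c A α α' w w') : 0 < stepLip κ c A := by
  have := h.A_nonneg
  have := h.c_pos
  have := (lamNorm_pos κ).le
  unfold stepLip
  positivity

/-- The iteration has a fixed point of class `C^{1,1/2}`. -/
theorem exists_fixedPoint (h : IsBackground κ c A α α' w w') (hL : 0 ≤ L) (hε : 0 ≤ ε)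
    (hm₀ : ∀ i, Reg ε (m₀ i) (m₀' i)) (hm₀' : ∀ i, Continuous (m₀' i))
    (hper : ∀ i t, m₀ i (t + 1) = m₀ i t)
    (hone : ∀ x, majorant κ c A L ε x ≤ 1) (hc : ∀ x, lamNorm κ * majorant κ c A L ε x ≤ c) :
    ∃ m p, Adm κ c (majorant κ c A L ε) m p ∧ (∀ i, m i = iterStep κ L α w m₀ m i) ∧
      ∀ i, p i = iterStepDeriv κ L α α' w w' m₀' m p i := by
  set G := majorant κ c A L ε with hG
  have hG0 (x : ℝ) : 0 ≤ G x := by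
    have := h.transportBound_pos hL
    simp only [hG, majorant]
    positivity
  set S : (Fin 2 → ℝ → ℝ → ℝ) × (Fin 2 → ℝ → ℝ → ℝ) →
      (Fin 2 → ℝ → ℝ → ℝ) × (Fin 2 → ℝ → ℝ → ℝ) := fun a =>
    (iterStep κ L α w m₀ a.1, iterStepDeriv κ L α α' w w' m₀' a.1 a.2) with hS
  set s : ℕ → (Fin 2 → ℝ → ℝ → ℝ) × (Fin 2 → ℝ → ℝ → ℝ) := fun k => S^[k] 0 with hs
  have hs_succ (k : ℕ) : s (k + 1) = S (s k) := iterate_succ_apply' S k 0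
  have adm (k : ℕ) : Adm κ c G (s k).1 (s k).2 := by
    induction k with
    | zero => exact ⟨fun i => continuous_const, fun i => continuous_const,
        fun i x => Reg.zero (hG0 x), fun i x t => rfl, hone, hc⟩
    | succ k ih =>
      rw [hs_succ]
      exact h.adm_iterStep hL hε hm₀ hm₀' hper ih
  have hb (k : ℕ) (i : Fin 2) (x t : ℝ) : |(s k).1 i x t| ≤ 1 :=
    (((adm k).reg i x).bound t).trans (hone x)
  set K := stepLip κ c A with hK
  have hKpos : 0 < K := h.stepLip_pos
  set D := 2 * Real.exp (2 * K * L) with hD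
  -- The weight `exp (2Kx)` turns the Volterra estimate into a contraction: integrating it and
  -- multiplying by `K` produces a factor `1/2`, for any length `L`.
  have step (k : ℕ) : ∀ x ∈ Icc 0 L, ∀ t i, |(s (k + 1)).1 i x t - (s k).1 i x t| ≤
      2 * (1 / 2) ^ k * Real.exp (2 * K * x) := by
    induction k with
    | zero =>
      intro x hx t i
      have h1 : 1 ≤ Real.exp (2 * K * x) := Real.one_le_exp (by have := hx.1; positivity)
      have := abs_sub ((s 1).1 i x t) ((s 0).1 i x t)
      have := hb 1 i x t
      have := hb 0 i x t
      rw [pow_zero, zero_add]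
      linarith
    | succ k ih =>
      intro x hx t i
      rw [hs_succ (k + 1), hs_succ k]
      refine (h.abs_iterStep_sub_le hL hε hm₀ hm₀' hper (hs_succ k ▸ adm (k + 1)) (adm k)
        (d := fun x => 2 * (1 / 2) ^ k * Real.exp (2 * K * x)) (by fun_prop)
        (fun x hx t i => by have := ih x hx t i; rwa [hs_succ k] at this) hx t i).trans ?_
      have hd (y : ℝ) : HasDerivAt (fun y => (1 / 2) ^ k * Real.exp (2 * K * y) / K)
          (2 * (1 / 2) ^ k * Real.exp (2 * K * y)) y := by
        have := ((((hasDerivAt_id y).const_mul (2 * K)).exp).const_mul ((1 / 2 : ℝ) ^ k)).div_const K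
        refine this.congr_deriv ?_
        simp only [id]
        field_simp
      rw [intervalIntegral.integral_eq_sub_of_hasDerivAt (fun y _ => hd y)
        (Continuous.intervalIntegrable (by fun_prop) _ _), ← hK, mul_sub, mul_div_cancel₀ _ hKpos.ne',
        mul_div_cancel₀ _ hKpos.ne', pow_succ]
      have : (0 : ℝ) < (1 / 2) ^ k := by positivity
      simp only [mul_zero, Real.exp_zero]
      linarith
  have clamped (k : ℕ) (i : Fin 2) (x : ℝ) : (s k).1 i x = (s k).1 i (clamp L x) := by
    cases k with
    | zero => rfl
    | succ k => rw [hs_succ]; simp only [hS, iterStep, clamp_of_mem (clamp_mem hL x)]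
  have step' (k : ℕ) (i : Fin 2) (x t : ℝ) :
      dist ((s k).1 i x t) ((s (k + 1)).1 i x t) ≤ D * (1 / 2) ^ k := by
    rw [clamped, clamped (k + 1), dist_comm, Real.dist_eq]
    have hx := clamp_mem hL x
    refine (step k _ hx t i).trans ?_
    have : Real.exp (2 * K * clamp L x) ≤ Real.exp (2 * K * L) :=
      Real.exp_le_exp.2 (by have := hx.2; gcongr)
    have h2 : (0 : ℝ) < (1 / 2) ^ k := by positivity
    rw [hD]
    nlinarith
  have lim (i : Fin 2) (x t : ℝ) : ∃ l, Tendsto (fun k => (s k).1 i x t) atTop (𝓝 l) :=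
    cauchySeq_tendsto_of_complete
      (cauchySeq_of_le_geometric _ _ (by norm_num) (fun k => step' k i x t))
  choose m hm using lim
  have err (k : ℕ) (i : Fin 2) (x t : ℝ) : |(s k).1 i x t - m i x t| ≤ 2 * D * (1 / 2) ^ k := by
    have := dist_le_of_le_geometric_of_tendsto _ _ (by norm_num) (fun k => step' k i x t)
      (hm i x t) k
    rw [Real.dist_eq] at this
    refine this.trans (le_of_eq ?_)
    ring
  have half : Tendsto (fun k : ℕ => 2 * D * (1 / 2 : ℝ) ^ k) atTop (𝓝 0) := by
    simpa using (tendsto_pow_atTop_nhds_zero_of_lt_one (r := (1 / 2 : ℝ)) (by norm_num)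
      (by norm_num)).const_mul (2 * D)
  have unif (i : Fin 2) : TendstoUniformly (fun k => uncurry ((s k).1 i)) (uncurry (m i)) atTop := by
    rw [Metric.tendstoUniformly_iff]
    intro e he
    filter_upwards [half.eventually (gt_mem_nhds he)] with k hk y
    rw [dist_comm]
    exact (err k i y.1 y.2).trans_lt hk
  have cauchy (i : Fin 2) : ∀ e > 0, ∃ N, ∀ k ≥ N, ∀ l ≥ N, ∀ x t,
      |(s k).2 i x t - (s l).2 i x t| < e := by
    intro e he
    -- With step `r` and sup distance at most `e * r / 8`, `abs_deriv_sub_le` gives `e / 4 + e / 4 <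
    -- e`. Each of the two iterates contributes `e * r / 16` to that distance.
    set r := (e / 8) ^ 2 with hr
    have hr0 : 0 < r := by positivity
    obtain ⟨N, hN⟩ := (half.eventually (gt_mem_nhds (by positivity : 0 < e * r / 16))).exists
    refine ⟨N, fun k hk l hl x t => ?_⟩
    have hmon {k : ℕ} (hk : N ≤ k) : 2 * D * (1 / 2 : ℝ) ^ k ≤ 2 * D * (1 / 2 : ℝ) ^ N := by
      have : (1 / 2 : ℝ) ^ k ≤ (1 / 2) ^ N := pow_le_pow_of_le_one (by norm_num) (by norm_num) hk
      have : 0 < D := by positivity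
      gcongr
    have key := (((adm k).reg i x).mono (hone x)).abs_deriv_sub_le
      (((adm l).reg i x).mono (hone x)) (η := e * r / 8) (fun t => ?_) hr0 t
    · refine key.trans_lt ?_
      rw [hr, Real.sqrt_sq (by positivity)]
      field_simp
      norm_num
    · have h1 := abs_sub_le ((s k).1 i x t) (m i x t) ((s l).1 i x t)
      have h2 := err k i x t
      have h3 := err l i x t
      rw [abs_sub_comm] at h3
      linarith [hmon hk, hmon hl]
  have lim' (i : Fin 2) (x t : ℝ) : ∃ l, Tendsto (fun k => (s k).2 i x t) atTop (𝓝 l) := by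
    refine cauchySeq_tendsto_of_complete (Metric.cauchySeq_iff.2 fun e he => ?_)
    obtain ⟨N, hN⟩ := cauchy i e he
    exact ⟨N, fun k hk l hl => hN k hk l hl x t⟩
  choose p hp using lim'
  have unif' (i : Fin 2) : TendstoUniformly (fun k => uncurry ((s k).2 i)) (uncurry (p i)) atTop := by
    rw [Metric.tendstoUniformly_iff]
    intro e he
    obtain ⟨N, hN⟩ := cauchy i (e / 2) (by positivity)
    filter_upwards [eventually_ge_atTop N] with k hk y
    have : |p i y.1 y.2 - (s k).2 i y.1 y.2| ≤ e / 2 :=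
      le_of_tendsto (((hp i y.1 y.2).sub_const _).abs)
        (by filter_upwards [eventually_ge_atTop N] with l hl using (hN l hl k hk _ _).le)
    exact this.trans_lt (by linarith)
  have admL : Adm κ c G m p := by
    refine ⟨fun i => (unif i).continuous (Frequently.of_forall fun k => (adm k).cont i),
      fun i => (unif' i).continuous (Frequently.of_forall fun k => (adm k).cont' i),
      fun i x => ⟨fun t => ?_, fun t => ?_, fun t => ?_, fun t r => ?_⟩, fun i x t => ?_, hone, hc⟩
    · refine hasDerivAt_of_tendstoUniformly (f := fun k => (s k).1 i x)
        (f' := fun k => (s k).2 i x) ?_ (Eventually.of_forall fun k => ((adm k).reg i x).deriv)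
        (fun t => hm i x t) t
      exact (unif' i).comp fun t => (x, t)
    · exact le_of_tendsto' (hm i x t).abs fun k => ((adm k).reg i x).bound t
    · exact le_of_tendsto' (hp i x t).abs fun k => ((adm k).reg i x).bound' t
    · exact le_of_tendsto' ((hp i x t).sub (hp i x r)).abs fun k => ((adm k).reg i x).holder t r
    · refine tendsto_nhds_unique (hm i x (t + 1)) ?_
      simp_rw [(adm _).per]
      exact hm i x t
  have admN := h.adm_iterStep hL hε hm₀ hm₀' hper admL
  -- Sup-norm convergence suffices here, since `abs_iterStep_sub_le` does not compare derivatives.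
  have fix (i : Fin 2) : m i = iterStep κ L α w m₀ m i := by
    ext x t
    have e1 : m i x t = m i (clamp L x) t := by
      refine tendsto_nhds_unique (hm i x t) ?_
      simp_rw [clamped _ i x]
      exact hm i _ t
    have e2 : iterStep κ L α w m₀ m i x t = iterStep κ L α w m₀ m i (clamp L x) t := by
      simp only [iterStep, clamp_of_mem (clamp_mem hL x)]
    rw [e1, e2]
    refine tendsto_nhds_unique ((hm i _ t).comp (tendsto_add_atTop_nat 1)) ?_
    rw [tendsto_iff_dist_tendsto_zero]
    have hx := clamp_mem hL x
    refine squeeze_zero (fun _ => dist_nonneg) (g := fun k : ℕ => K * (2 * D * (1 / 2) ^ k * clamp L x))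
      (fun k => ?_) ?_
    · have := h.abs_iterStep_sub_le hL hε hm₀ hm₀' hper (adm k) admL
        (d := fun _ => 2 * D * (1 / 2) ^ k) continuous_const (fun x _ t i => err k i x t) hx t i
      simp only [intervalIntegral.integral_const, sub_zero, smul_eq_mul] at this
      rw [Function.comp_apply, hs_succ, Real.dist_eq, mul_comm _ (clamp L x)]
      exact this
    · simpa using (half.mul_const (clamp L x)).const_mul K
  refine ⟨m, p, admL, fix, fun i => ?_⟩
  ext x t
  -- Both `p` and the derivative produced by the iteration are the `t`-derivative of the same
  -- function.
  have h1 := (admL.reg i x).deriv t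
  rw [fix i] at h1
  exact h1.unique ((admN.reg i x).deriv t)

end IsBackground

/-! ### Riccati equations along characteristics and propagation of absolute continuity. -/

/-- Absolute continuity of a function whose increments are controlled by those of an absolutely
continuous function after a monotone Lipschitz change of variable. -/
theorem absolutelyContinuousOnInterval_of_abs_sub_le {F G θ : ℝ → ℝ} {a b C K : ℝ}
    (hG : AbsolutelyContinuousOnInterval G (θ a) (θ b)) (hθ : Monotone θ)
    (hθK : ∀ s t, |θ s - θ t| ≤ K * |s - t|)
    (hF : ∀ s ∈ uIcc a b, ∀ t ∈ uIcc a b, |F s - F t| ≤ C * (|G (θ s) - G (θ t)| + |s - t|)) :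
    AbsolutelyContinuousOnInterval F a b := by
  rw [absolutelyContinuousOnInterval_iff] at hG ⊢
  intro ε hε
  set D := |C| + 1 with hD
  have hD0 : 0 < D := by positivity
  obtain ⟨δ, hδ, H⟩ := hG (ε / (2 * D)) (by positivity)
  -- The first entry controls the images of the intervals under `θ`, the second the additional term
  -- `|s - t|`.
  refine ⟨min (δ / (|K| + 1)) (ε / (2 * D)), by positivity, fun E hE hlt => ?_⟩
  have hmem : ((E.1, fun i => (θ (E.2 i).1, θ (E.2 i).2)) : ℕ × (ℕ → ℝ × ℝ)) ∈
      AbsolutelyContinuousOnInterval.disjWithin (θ a) (θ b) := by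
    refine ⟨fun i hi => ?_, fun i hi j hj hij => ?_⟩
    · exact ⟨hθ.mapsTo_uIcc (hE.1 i hi).1, hθ.mapsTo_uIcc (hE.1 i hi).2⟩
    · have := hE.2 hi hj hij
      simp only [onFun, uIoc, Ioc_disjoint_Ioc, ← hθ.map_max, ← hθ.map_min] at this ⊢
      exact hθ this
  have h1 : ∑ i ∈ Finset.range E.1, dist (θ (E.2 i).1) (θ (E.2 i).2) < δ := by
    calc _ ≤ ∑ i ∈ Finset.range E.1, (|K| + 1) * dist (E.2 i).1 (E.2 i).2 := by
          refine Finset.sum_le_sum fun i _ => (hθK _ _).trans ?_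
          rw [Real.dist_eq]
          gcongr
          linarith [le_abs_self K]
      _ = (|K| + 1) * ∑ i ∈ Finset.range E.1, dist (E.2 i).1 (E.2 i).2 := (Finset.mul_sum _ _ _).symm
      _ < (|K| + 1) * (δ / (|K| + 1)) := by
          gcongr
          exact hlt.trans_le (min_le_left _ _)
      _ = δ := by field_simp
  have h2 := H _ hmem h1
  have h3 := hlt.trans_le (min_le_right _ _)
  calc _ ≤ ∑ i ∈ Finset.range E.1, D * (dist (G (θ (E.2 i).1)) (G (θ (E.2 i).2)) +
          dist (E.2 i).1 (E.2 i).2) := by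
        refine Finset.sum_le_sum fun i hi => (hF _ (hE.1 i hi).1 _ (hE.1 i hi).2).trans ?_
        rw [Real.dist_eq, Real.dist_eq]
        gcongr
        linarith [le_abs_self C]
    _ = D * (∑ i ∈ Finset.range E.1, dist (G (θ (E.2 i).1)) (G (θ (E.2 i).2)) +
          ∑ i ∈ Finset.range E.1, dist (E.2 i).1 (E.2 i).2) := by
        rw [← Finset.mul_sum, Finset.sum_add_distrib]
    _ < D * (ε / (2 * D) + ε / (2 * D)) := by gcongr
    _ = ε := by field_simp; norm_num

/-- No derivative of `M` is needed: `f` vanishes at `t`, so the difference quotient of the product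
is `M` times that of `f`. -/
theorem hasDerivAt_mul_of_eq_zero {M f : ℝ → ℝ} {f' t : ℝ} (hM : ContinuousAt M t) (h0 : f t = 0)
    (hf : HasDerivAt f f' t) : HasDerivAt (fun s => M s * f s) (M t * f') t := by
  rw [hasDerivAt_iff_tendsto_slope] at hf ⊢
  refine ((hM.tendsto.mono_left nhdsWithin_le_nhds).mul hf).congr fun s => ?_
  simp only [slope_def_field, h0, mul_zero, sub_zero]
  ring

/-- `V` solves a Riccati equation `V' = A 2 V² + A 1 V + A 0` along the characteristics of `b`, with
coefficients that are continuously differentiable in `t`. -/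
structure IsRiccati (L : ℝ) (b : ℝ → ℝ → ℝ) (A At : Fin 3 → ℝ → ℝ → ℝ) (V : ℝ → ℝ → ℝ) :
    Prop where
  cont : ∀ k, Continuous (uncurry (A k))
  cont_t : ∀ k, Continuous (uncurry (At k))
  deriv : ∀ k x t, HasDerivAt (A k x) (At k x t) t
  cont_V : Continuous (uncurry V)
  along : ∀ x t, ∀ y ∈ Ioo 0 L, HasDerivAt (fun y => V y (flow b x t y))
    (A 2 y (flow b x t y) * V y (flow b x t y) ^ 2 + A 1 y (flow b x t y) * V y (flow b x t y) +
      A 0 y (flow b x t y)) y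

/-- The coefficient of the linear equation for the difference of `V` on two characteristics. -/
def riccatiCoeff (b : ℝ → ℝ → ℝ) (A : Fin 3 → ℝ → ℝ → ℝ) (V : ℝ → ℝ → ℝ) (x t t' y : ℝ) : ℝ :=
  A 2 y (flow b x t' y) * (V y (flow b x t' y) + V y (flow b x t y)) + A 1 y (flow b x t' y)

/-- The inhomogeneity of the linear equation for the difference quotient of `V`. -/
def riccatiSource (b bt : ℝ → ℝ → ℝ) (At : Fin 3 → ℝ → ℝ → ℝ) (V : ℝ → ℝ → ℝ) (x t t' y : ℝ) : ℝ :=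
  flowSlope b bt x t t' y *
    (meanSlope (At 2) y (flow b x t y) (flow b x t' y) * V y (flow b x t y) ^ 2 +
      meanSlope (At 1) y (flow b x t y) (flow b x t' y) * V y (flow b x t y) +
      meanSlope (At 0) y (flow b x t y) (flow b x t' y))

/-- The factor by which differences of `V` are transported. -/
def riccatiFactor (b : ℝ → ℝ → ℝ) (A : Fin 3 → ℝ → ℝ → ℝ) (V : ℝ → ℝ → ℝ) (x t t' y : ℝ) : ℝ :=
  Real.exp (∫ η in y..x, riccatiCoeff b A V x t t' η)

/-- The contribution of the coefficients to difference quotients of `V`. -/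
def riccatiRest (b bt : ℝ → ℝ → ℝ) (A At : Fin 3 → ℝ → ℝ → ℝ) (V : ℝ → ℝ → ℝ) (x t t' : ℝ) : ℝ :=
  ∫ y in (0 : ℝ)..x, riccatiFactor b A V x t t' y * riccatiSource b bt At V x t t' y

namespace IsRiccati

variable {L B : ℝ} {b bt : ℝ → ℝ → ℝ} {A At : Fin 3 → ℝ → ℝ → ℝ} {V : ℝ → ℝ → ℝ}

section continuity

variable {X : Type*} [TopologicalSpace X] {x t t' y : X → ℝ}

theorem continuous_coeff (h : IsRiccati L b A At V) (hb : IsField b bt B) (hx : Continuous x)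
    (ht : Continuous t) (ht' : Continuous t') (hy : Continuous y) :
    Continuous fun p => riccatiCoeff b A V (x p) (t p) (t' p) (y p) := by
  have hψ := hb.continuous_flow_comp hx ht hy
  have hψ' := hb.continuous_flow_comp hx ht' hy
  exact (((h.cont 2).comp (hy.prodMk hψ')).mul ((h.cont_V.comp (hy.prodMk hψ')).add
    (h.cont_V.comp (hy.prodMk hψ)))).add ((h.cont 1).comp (hy.prodMk hψ'))

theorem continuous_source (h : IsRiccati L b A At V) (hb : IsField b bt B) (hx : Continuous x)
    (ht : Continuous t) (ht' : Continuous t') (hy : Continuous y) :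
    Continuous fun p => riccatiSource b bt At V (x p) (t p) (t' p) (y p) := by
  have hψ := hb.continuous_flow_comp hx ht hy
  have hψ' := hb.continuous_flow_comp hx ht' hy
  have hV := h.cont_V.comp (hy.prodMk hψ)
  have hA (k : Fin 3) := continuous_meanSlope (h.cont_t k) hy hψ hψ'
  exact (hb.continuous_flowSlope_comp hx ht ht' hy).mul
    ((((hA 2).mul (hV.pow 2)).add ((hA 1).mul hV)).add (hA 0))

theorem continuous_factor (h : IsRiccati L b A At V) (hb : IsField b bt B) (hx : Continuous x)
    (ht : Continuous t) (ht' : Continuous t') (hy : Continuous y) :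
    Continuous fun p => riccatiFactor b A V (x p) (t p) (t' p) (y p) :=
  Real.continuous_exp.comp (continuous_integral_comp
    (g := fun p η => riccatiCoeff b A V (x p) (t p) (t' p) η)
    (h.continuous_coeff hb (hx.comp continuous_fst) (ht.comp continuous_fst)
      (ht'.comp continuous_fst) continuous_snd) hy hx)

theorem continuous_rest (h : IsRiccati L b A At V) (hb : IsField b bt B) (hx : Continuous x)
    (ht : Continuous t) (ht' : Continuous t') :
    Continuous fun p => riccatiRest b bt A At V (x p) (t p) (t' p) :=
  continuous_integral_comp
    (g := fun p y => riccatiFactor b A V (x p) (t p) (t' p) y *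
      riccatiSource b bt At V (x p) (t p) (t' p) y)
    ((h.continuous_factor hb (hx.comp continuous_fst) (ht.comp continuous_fst)
      (ht'.comp continuous_fst) continuous_snd).mul (h.continuous_source hb
      (hx.comp continuous_fst) (ht.comp continuous_fst) (ht'.comp continuous_fst) continuous_snd))
    continuous_const hx

end continuity

/-- The increments of `V` at `x` in terms of those at `0`. -/
theorem sub_eq (h : IsRiccati L b A At V) (hb : IsField b bt B) {x : ℝ} (hx : x ∈ Icc 0 L)
    (t t' : ℝ) : V x t' - V x t =
      riccatiFactor b A V x t t' 0 * (V 0 (flow b x t' 0) - V 0 (flow b x t 0)) +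
        (t' - t) * riccatiRest b bt A At V x t t' := by
  have hP : Continuous (riccatiCoeff b A V x t t') := h.continuous_coeff hb continuous_const
    continuous_const continuous_const continuous_id
  have hQ : Continuous (riccatiSource b bt At V x t t') := h.continuous_source hb continuous_const
    continuous_const continuous_const continuous_id
  have hM : Continuous (riccatiFactor b A V x t t') := h.continuous_factor hb continuous_const
    continuous_const continuous_const continuous_id
  have hMd (y : ℝ) : HasDerivAt (riccatiFactor b A V x t t')
      (-(riccatiFactor b A V x t t' y * riccatiCoeff b A V x t t' y)) y := by
    have := ((hasDerivAt_primitive hP x y).neg).exp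
    simp only [Pi.neg_apply, ← intervalIntegral.integral_symm] at this
    refine this.congr_deriv ?_
    rw [riccatiFactor]
    ring
  have hVc (t : ℝ) : Continuous fun y => V y (flow b x t y) :=
    h.cont_V.comp (continuous_id.prodMk (hb.continuous_flow_right x t))
  -- The difference `Δ` of `V` on the two characteristics satisfies `dΔ/dy = P Δ + (t' - t) Q`, with
  -- `P` the coefficient and `Q` the source defined above. The quadratic term splits into `A 2`
  -- times the sum of the two values of `V` times `Δ`, plus the increment of `A 2` times `V²`;
  -- increments of coefficients are mean slopes times the distance of the characteristics.
  -- `riccatiFactor` is the integrating factor.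
  have key : ∫ y in (0 : ℝ)..x, (t' - t) *
      (riccatiFactor b A V x t t' y * riccatiSource b bt At V x t t' y) =
      riccatiFactor b A V x t t' x * (V x (flow b x t' x) - V x (flow b x t x)) -
        riccatiFactor b A V x t t' 0 * (V 0 (flow b x t' 0) - V 0 (flow b x t 0)) := by
    refine intervalIntegral.integral_eq_sub_of_hasDerivAt_of_le (f := fun y =>
      riccatiFactor b A V x t t' y * (V y (flow b x t' y) - V y (flow b x t y))) hx.1
      (hM.mul ((hVc t').sub (hVc t))).continuousOn (fun y hy => ?_)
      (((hM.mul hQ).const_mul _).intervalIntegrable _ _)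
    have hy' : y ∈ Ioo 0 L := ⟨hy.1, hy.2.trans_le hx.2⟩
    refine ((hMd y).mul ((h.along x t' y hy').sub (h.along x t y hy'))).congr_deriv ?_
    have e (k : Fin 3) := sub_eq_meanSlope_mul (h.cont_t k) (h.deriv k) y (flow b x t y)
      (flow b x t' y)
    have ef : flow b x t' y - flow b x t y = (t' - t) * flowSlope b bt x t t' y :=
      hb.flow_sub_flow x t t' y
    simp only [ef] at e
    simp only [riccatiCoeff, riccatiSource, Pi.sub_apply]
    linear_combination riccatiFactor b A V x t t' y *
      (V y (flow b x t y) ^ 2 * e 2 + V y (flow b x t y) * e 1 + e 0)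
  rw [intervalIntegral.integral_const_mul] at key
  simp only [hb.flow_self] at key
  have h1 : riccatiFactor b A V x t t' x = 1 := by simp [riccatiFactor]
  rw [h1, one_mul] at key
  rw [riccatiRest]
  linarith

theorem monotone_flow (hb : IsField b bt B) (x y : ℝ) : Monotone fun t => flow b x t y :=
  monotone_of_hasDerivAt_nonneg (fun t => hb.hasDerivAt_flow_left x t y)
    fun _ => (IsField.flowDeriv_pos _ _ _ _ _).le

/-- By `sub_eq`, increments of `V x` are controlled by those of `V 0` at the feet of the
characteristics and by those of `t`; the foot is a monotone Lipschitz function of `t`. -/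
theorem absolutelyContinuous (h : IsRiccati L b A At V) (hb : IsField b bt B)
    (h0 : ∀ a c, AbsolutelyContinuousOnInterval (V 0) a c) {x : ℝ} (hx : x ∈ Icc 0 L) (a c : ℝ) :
    AbsolutelyContinuousOnInterval (V x) a c := by
  have hK : IsCompact (uIcc a c ×ˢ uIcc a c) := isCompact_uIcc.prod isCompact_uIcc
  obtain ⟨C₁, hC₁⟩ := hK.exists_bound_of_continuousOn
    (h.continuous_factor hb (x := fun _ : ℝ × ℝ => x) continuous_const continuous_snd
      continuous_fst continuous_const (y := fun _ => 0)).continuousOn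
  obtain ⟨C₂, hC₂⟩ := hK.exists_bound_of_continuousOn
    (h.continuous_rest hb (x := fun _ : ℝ × ℝ => x) continuous_const continuous_snd
      continuous_fst).continuousOn
  refine absolutelyContinuousOnInterval_of_abs_sub_le (C := max C₁ C₂) (h0 _ _)
    (monotone_flow hb x 0) (fun s t => hb.abs_flow_sub_flow_le x t s 0) fun s hs t ht => ?_
  rw [h.sub_eq hb hx, mul_add]
  refine (abs_add_le _ _).trans ?_
  rw [abs_mul, abs_mul, mul_comm |s - t|]
  gcongr
  · exact (hC₁ (s, t) ⟨hs, ht⟩).trans (le_max_left _ _)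
  · exact (hC₂ (s, t) ⟨hs, ht⟩).trans (le_max_right _ _)

/-- The factors in `sub_eq` are merely continuous in `t'`, but each multiplies a function that
vanishes at `t' = t`. -/
theorem hasDerivAt (h : IsRiccati L b A At V) (hb : IsField b bt B) {x : ℝ} (hx : x ∈ Icc 0 L)
    {t : ℝ} (ht : DifferentiableAt ℝ (V 0) (flow b x t 0)) :
    HasDerivAt (V x) (riccatiFactor b A V x t t 0 * flowDeriv b bt x t 0 *
      _root_.deriv (V 0) (flow b x t 0) + riccatiRest b bt A At V x t t) t := by
  have h1 : HasDerivAt (fun t' => V 0 (flow b x t' 0) - V 0 (flow b x t 0))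
      (_root_.deriv (V 0) (flow b x t 0) * flowDeriv b bt x t 0) t :=
    (ht.hasDerivAt.comp t (hb.hasDerivAt_flow_left x t 0)).sub_const _
  have h2 : Continuous fun t' => riccatiFactor b A V x t t' 0 :=
    h.continuous_factor hb continuous_const continuous_const continuous_id continuous_const
  have h3 : Continuous fun t' => riccatiRest b bt A At V x t t' :=
    h.continuous_rest hb continuous_const continuous_const continuous_id
  have h4 := (hasDerivAt_mul_of_eq_zero (f := fun t' => V 0 (flow b x t' 0) - V 0 (flow b x t 0))
    h2.continuousAt (sub_self _) h1).add
    (hasDerivAt_mul_of_eq_zero (f := fun s => s - t)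
    h3.continuousAt (sub_self _) ((hasDerivAt_id t).sub_const t))
  refine ((h4.add_const (V x t)).congr_of_eventuallyEq
    (Eventually.of_forall fun t' => ?_)).congr_deriv ?_
  · have := h.sub_eq hb hx t t'
    simp only [Pi.add_apply]
    linarith
  · ring

/-- Properties that hold almost everywhere hold almost everywhere at the foot of the
characteristics. -/
theorem _root_.EulerPeriodic.IsField.ae_flow (hb : IsField b bt B) {q : ℝ → Prop}
    (hq : ∀ᵐ s, q s) (x y : ℝ) : ∀ᵐ t, q (flow b x t y) := by
  rw [ae_iff] at hq ⊢
  -- The exceptional set lies in the image of a null set under the inverse flow, which is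
  -- differentiable and therefore preserves null sets.
  have himg := addHaar_image_eq_zero_of_differentiableOn_of_addHaar_eq_zero volume
    (f := fun s => flow b y s x) (s := {s | ¬q s})
    (fun s _ => (hb.hasDerivAt_flow_left y s x).differentiableAt.differentiableWithinAt) hq
  refine measure_mono_null (fun t ht => ?_) himg
  exact ⟨flow b x t y, ht, by simp only [hb.flow_flow, hb.flow_self]⟩

theorem ae_hasDerivAt (h : IsRiccati L b A At V) (hb : IsField b bt B)
    (h0 : ∀ a c, AbsolutelyContinuousOnInterval (V 0) a c) {x : ℝ} (hx : x ∈ Icc 0 L) :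
    ∀ᵐ t, HasDerivAt (V x) (riccatiFactor b A V x t t 0 * flowDeriv b bt x t 0 *
      _root_.deriv (V 0) (flow b x t 0) + riccatiRest b bt A At V x t t) t := by
  have hd : ∀ᵐ s, DifferentiableAt ℝ (V 0) s := by
    have : ∀ n : ℕ, ∀ᵐ s, s ∈ uIcc (-n : ℝ) n → DifferentiableAt ℝ (V 0) s :=
      fun n => (h0 _ _).ae_differentiableAt
    filter_upwards [ae_all_iff.2 this] with s hs
    obtain ⟨n, hn⟩ := exists_nat_ge |s|
    exact hs n (by rw [uIcc_of_le (by linarith [abs_nonneg s])]; exact abs_le.1 hn)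
  filter_upwards [hb.ae_flow hd x 0] with t ht using h.hasDerivAt hb hx ht

end IsRiccati

/-! ### Algebra of bounds for continuously differentiable coefficients. -/

/-- `f x t` is continuous, and continuously differentiable in `t` with derivative `ft`; both are
bounded by `g`. -/
structure C1Bound (g : ℝ) (f ft : ℝ → ℝ → ℝ) : Prop where
  cont : Continuous (uncurry f)
  cont_t : Continuous (uncurry ft)
  deriv : ∀ x t, HasDerivAt (f x) (ft x t) t
  bound : ∀ x t, |f x t| ≤ g
  bound_t : ∀ x t, |ft x t| ≤ g

/-- Existential version of `C1Bound`. -/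
def HasC1Bound (g : ℝ) (f : ℝ → ℝ → ℝ) : Prop := ∃ ft, C1Bound g f ft

namespace HasC1Bound

variable {g g₁ g₂ : ℝ} {f h : ℝ → ℝ → ℝ}

theorem nonneg (hf : HasC1Bound g f) : 0 ≤ g := by
  obtain ⟨ft, hf⟩ := hf
  exact (abs_nonneg _).trans (hf.bound 0 0)

theorem mono (hf : HasC1Bound g₁ f) (hg : g₁ ≤ g₂) : HasC1Bound g₂ f := by
  obtain ⟨ft, hf⟩ := hf
  exact ⟨ft, hf.cont, hf.cont_t, hf.deriv, fun x t => (hf.bound x t).trans hg,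
    fun x t => (hf.bound_t x t).trans hg⟩

theorem add (hf : HasC1Bound g₁ f) (hh : HasC1Bound g₂ h) :
    HasC1Bound (g₁ + g₂) (fun x t => f x t + h x t) := by
  obtain ⟨ft, hf⟩ := hf
  obtain ⟨ht, hh⟩ := hh
  exact ⟨fun x t => ft x t + ht x t, hf.cont.add hh.cont, hf.cont_t.add hh.cont_t,
    fun x t => (hf.deriv x t).add (hh.deriv x t),
    fun x t => (abs_add_le _ _).trans (add_le_add (hf.bound x t) (hh.bound x t)),
    fun x t => (abs_add_le _ _).trans (add_le_add (hf.bound_t x t) (hh.bound_t x t))⟩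

theorem mul (hf : HasC1Bound g₁ f) (hh : HasC1Bound g₂ h) :
    HasC1Bound (2 * g₁ * g₂) (fun x t => f x t * h x t) := by
  have h1 := hf.nonneg
  have h2 := hh.nonneg
  have h12 := mul_nonneg h1 h2
  obtain ⟨ft, hf⟩ := hf
  obtain ⟨ht, hh⟩ := hh
  have prod {a b x y : ℝ} (hx : |a| ≤ x) (hy : |b| ≤ y) : |a * b| ≤ x * y := by
    rw [abs_mul]
    exact mul_le_mul hx hy (abs_nonneg _) ((abs_nonneg _).trans hx)
  refine ⟨fun x t => ft x t * h x t + f x t * ht x t, hf.cont.mul hh.cont,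
    (hf.cont_t.mul hh.cont).add (hf.cont.mul hh.cont_t),
    fun x t => (hf.deriv x t).mul (hh.deriv x t), fun x t => ?_, fun x t => ?_⟩
  · exact (prod (hf.bound x t) (hh.bound x t)).trans (by linarith)
  · refine (abs_add_le _ _).trans ((add_le_add (prod (hf.bound_t x t) (hh.bound x t))
      (prod (hf.bound x t) (hh.bound_t x t))).trans (by linarith))

theorem const_mul (hf : HasC1Bound g f) (a : ℝ) : HasC1Bound (|a| * g) (fun x t => a * f x t) := by
  obtain ⟨ft, hf⟩ := hf
  refine ⟨fun x t => a * ft x t, hf.cont.const_mul a, hf.cont_t.const_mul a,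
    fun x t => (hf.deriv x t).const_mul a, fun x t => ?_, fun x t => ?_⟩ <;>
  · rw [abs_mul]
    gcongr
    first | exact hf.bound x t | exact hf.bound_t x t

theorem absolutelyContinuous (hf : HasC1Bound g f) (x a c : ℝ) :
    AbsolutelyContinuousOnInterval (f x) a c := by
  have h0 := hf.nonneg
  obtain ⟨ft, hf⟩ := hf
  have : LipschitzWith g.toNNReal (f x) := by
    refine lipschitzWith_of_nnnorm_deriv_le (fun t => (hf.deriv x t).differentiableAt) fun t => ?_
    rw [(hf.deriv x t).deriv, ← NNReal.coe_le_coe, Real.coe_toNNReal _ h0]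
    exact hf.bound_t x t
  exact this.lipschitzOnWith.absolutelyContinuousOnInterval

end HasC1Bound

/-! ### The Riccati variable of the system. -/

/-- The exponent `β` for which `σ ^ (-β) ∂ₓmᵢ` solves a Riccati equation. -/
def expo (κ : ℝ) : ℝ := (1 - κ) / (2 * κ)

/-- A small perturbation `m` of a background with constant gap `σ₀ = w₁ - w₀`. -/
structure PerturbedState (κ c A K σ₀ η : ℝ) (α α' : ℝ → ℝ) (w w' : Fin 2 → ℝ → ℝ)
    (m p : Fin 2 → ℝ → ℝ → ℝ) : Prop where
  bg : IsBackground κ c A α α' w w'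
  κ_pos : 0 < κ
  σ₀_pos : 0 < σ₀
  reg_α' : HasC1Bound A fun _ t => α' t
  gap : ∀ t, w 1 t - w 0 t = σ₀
  pow_le : ∀ s ∈ Icc (σ₀ / 2) (2 * σ₀), ∀ r ∈ ({expo κ, -expo κ, expo κ - 1, -expo κ - 1} : Set ℝ),
    s ^ r ≤ K
  adm : Adm κ c (fun _ => η) m p
  small : 4 * η ≤ σ₀

/-- The gap between the perturbed Riemann invariants. -/
def gapFn (σ₀ : ℝ) (m : Fin 2 → ℝ → ℝ → ℝ) (x t : ℝ) : ℝ := σ₀ + (m 1 x t + -1 * m 0 x t)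

/-- A primitive of `s ^ (-β - 1)`. -/
def gapPrim (κ σ₀ s : ℝ) : ℝ := ∫ τ in σ₀..s, τ ^ (-expo κ - 1)

/-- The `x`-derivative of `mᵢ`. -/
def slopeX (κ : ℝ) (α : ℝ → ℝ) (w : Fin 2 → ℝ → ℝ) (m p : Fin 2 → ℝ → ℝ → ℝ) (i : Fin 2)
    (x t : ℝ) : ℝ :=
  speed κ w m i x t * (1 / 2 * α t * (m 0 x t + m 1 x t) - p i x t)

/-- The correction `(α / 4κ) Ω(σ)`. -/
def corr (κ σ₀ : ℝ) (α : ℝ → ℝ) (m : Fin 2 → ℝ → ℝ → ℝ) (x t : ℝ) : ℝ :=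
  1 / (4 * κ) * (α t * gapPrim κ σ₀ (gapFn σ₀ m x t))

/-- The Riccati variable. -/
def riccatiVar (κ σ₀ : ℝ) (α : ℝ → ℝ) (w : Fin 2 → ℝ → ℝ) (m p : Fin 2 → ℝ → ℝ → ℝ) (i : Fin 2)
    (x t : ℝ) : ℝ :=
  gapFn σ₀ m x t ^ (-expo κ) * slopeX κ α w m p i x t + corr κ σ₀ α m x t

/-- The coefficients of the Riccati equation. -/
def riccatiCoeffs (κ σ₀ : ℝ) (α α' : ℝ → ℝ) (w : Fin 2 → ℝ → ℝ) (m : Fin 2 → ℝ → ℝ → ℝ)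
    (i : Fin 2) : Fin 3 → ℝ → ℝ → ℝ :=
  ![fun x t => speed κ w m i x t * (-(1 + κ) * (gapFn σ₀ m x t ^ expo κ *
      (corr κ σ₀ α m x t * corr κ σ₀ α m x t)) + (-1 / 2 * (α t * corr κ σ₀ α m x t) +
      1 / (4 * κ) * (α' t * gapPrim κ σ₀ (gapFn σ₀ m x t)))),
    fun x t => speed κ w m i x t * (2 * (1 + κ) * (gapFn σ₀ m x t ^ expo κ * corr κ σ₀ α m x t) +
      1 / 2 * α t),
    fun x t => -(1 + κ) * (speed κ w m i x t * gapFn σ₀ m x t ^ expo κ)]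

/-- `m` solves the system, and its `t`-derivative `p` the differentiated system along
characteristics. -/
structure IsSol (κ L : ℝ) (α α' : ℝ → ℝ) (w w' : Fin 2 → ℝ → ℝ) (m p : Fin 2 → ℝ → ℝ → ℝ) :
    Prop where
  left : ∀ j, ∀ x ∈ Ioo 0 L, ∀ t, HasDerivAt (fun y => m j y t) (slopeX κ α w m p j x t) x
  along : ∀ i x t, ∀ y ∈ Ioo 0 L, HasDerivAt (fun y => p i y (flow (speed κ w m i) x t y))
    (srcDeriv κ α α' w w' m p i y (flow (speed κ w m i) x t y) -
      speedDeriv κ w w' m p i y (flow (speed κ w m i) x t y) *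
        p i y (flow (speed κ w m i) x t y)) y

theorem apply_zero_add_apply_one (f : Fin 2 → ℝ) (i : Fin 2) : f 0 + f 1 = f i + f (i + 1) := by
  fin_cases i
  · rfl
  · exact add_comm _ _

theorem hasDerivAt_gapPrim (κ : ℝ) {σ₀ s : ℝ} (h₀ : 0 < σ₀) (hs : 0 < s) :
    HasDerivAt (gapPrim κ σ₀) (s ^ (-expo κ - 1)) s := by
  have hc : ContinuousOn (fun τ : ℝ => τ ^ (-expo κ - 1)) (Ioi 0) := fun τ hτ =>
    (Real.continuousAt_rpow_const τ _ (Or.inl (ne_of_gt hτ))).continuousWithinAt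
  have hsub : uIcc σ₀ s ⊆ Ioi 0 := fun τ hτ => (lt_min h₀ hs).trans_le hτ.1
  exact intervalIntegral.integral_hasDerivAt_right (hc.mono hsub).intervalIntegrable
    (hc.stronglyMeasurableAtFilter isOpen_Ioi s hs) (hc.continuousAt (Ioi_mem_nhds hs))

namespace PerturbedState

variable {κ c A K L σ₀ η : ℝ} {α α' : ℝ → ℝ} {w w' : Fin 2 → ℝ → ℝ} {m p : Fin 2 → ℝ → ℝ → ℝ}

theorem η_nonneg (H : PerturbedState κ c A K σ₀ η α α' w w' m p) : 0 ≤ η := (H.adm.reg 0 0).nonneg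

theorem bound_m (H : PerturbedState κ c A K σ₀ η α α' w w' m p) (j : Fin 2) :
    HasC1Bound η (m j) :=
  ⟨p j, H.adm.cont j, H.adm.cont' j, fun x => (H.adm.reg j x).deriv,
    fun x => (H.adm.reg j x).bound, fun x => (H.adm.reg j x).bound'⟩

theorem bound_α (H : PerturbedState κ c A K σ₀ η α α' w w' m p) : HasC1Bound A fun _ t => α t :=
  ⟨fun _ t => α' t, H.bg.cont_α.comp continuous_snd, H.bg.cont_α'.comp continuous_snd,
    fun _ => H.bg.reg_α.deriv, fun _ => H.bg.reg_α.bound, fun _ => H.bg.reg_α.bound'⟩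

theorem bound_speed (H : PerturbedState κ c A K σ₀ η α α' w w' m p) (i : Fin 2) :
    HasC1Bound (speedBound κ c A) (speed κ w m i) :=
  ⟨_, H.bg.cont_speed H.adm i, H.bg.cont_speedDeriv H.adm i,
    fun x => (H.bg.reg_speed H.adm i x).deriv, fun x => (H.bg.reg_speed H.adm i x).bound,
    fun x => (H.bg.reg_speed H.adm i x).bound'⟩

theorem bound_lam (H : PerturbedState κ c A K σ₀ η α α' w w' m p) (i : Fin 2) :
    HasC1Bound (lamNorm κ * (A + 1)) (fun x t => lam κ i fun j => w j t + m j x t) :=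
  ⟨_, IsBackground.cont_lam H.bg.cont_w H.adm.cont i,
    IsBackground.cont_lam H.bg.cont_w' H.adm.cont' i,
    fun x => (H.bg.reg_lam H.adm i x).deriv, fun x => (H.bg.reg_lam H.adm i x).bound,
    fun x => (H.bg.reg_lam H.adm i x).bound'⟩

theorem bound_gap (H : PerturbedState κ c A K σ₀ η α α' w w' m p) :
    HasC1Bound (2 * η) (fun x t => m 1 x t + -1 * m 0 x t) :=
  ((H.bound_m 1).add ((H.bound_m 0).const_mul (-1))).mono (by rw [abs_neg, abs_one]; linarith)

theorem gapFn_mem (H : PerturbedState κ c A K σ₀ η α α' w w' m p) (x t : ℝ) :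
    gapFn σ₀ m x t ∈ Icc (σ₀ / 2) (2 * σ₀) := by
  obtain ⟨_, hD⟩ := H.bound_gap
  have h1 := abs_le.1 (hD.bound x t)
  have h2 := H.small
  have h3 := H.σ₀_pos
  unfold gapFn
  constructor <;> linarith [h1.1, h1.2]

theorem gapFn_pos (H : PerturbedState κ c A K σ₀ η α α' w w' m p) (x t : ℝ) :
    0 < gapFn σ₀ m x t := by linarith [(H.gapFn_mem x t).1, H.σ₀_pos]

theorem K_pos (H : PerturbedState κ c A K σ₀ η α α' w w' m p) : 0 < K :=
  (Real.rpow_pos_of_pos (H.gapFn_pos 0 0) _).trans_le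
    (H.pow_le _ (H.gapFn_mem 0 0) (expo κ) (by simp))

theorem comp_gap (H : PerturbedState κ c A K σ₀ η α α' w w' m p) {F F' : ℝ → ℝ} {a d : ℝ}
    (hF : ∀ s, 0 < s → HasDerivAt F (F' s) s) (hF' : ContinuousOn F' (Ioi 0))
    (ha : ∀ x t, |F (gapFn σ₀ m x t)| ≤ a) (hd : ∀ s ∈ Icc (σ₀ / 2) (2 * σ₀), |F' s| ≤ d) :
    HasC1Bound (a + d * (2 * η)) (fun x t => F (gapFn σ₀ m x t)) := by
  have ha0 : 0 ≤ a := (abs_nonneg _).trans (ha 0 0)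
  have hd0 : 0 ≤ d := (abs_nonneg _).trans (hd _ (H.gapFn_mem 0 0))
  have hη := H.η_nonneg
  obtain ⟨ft, hD⟩ := H.bound_gap
  have hc : Continuous (uncurry (gapFn σ₀ m)) := hD.cont.const_add σ₀
  have hFc : ContinuousOn F (Ioi 0) := fun s hs => (hF s hs).continuousAt.continuousWithinAt
  refine ⟨fun x t => F' (gapFn σ₀ m x t) * ft x t,
    hFc.comp_continuous hc (fun y => H.gapFn_pos _ _),
    (hF'.comp_continuous hc (fun y => H.gapFn_pos _ _)).mul hD.cont_t, fun x t => ?_,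
    fun x t => (ha x t).trans (by nlinarith), fun x t => ?_⟩
  · exact (hF _ (H.gapFn_pos x t)).comp t ((hD.deriv x t).const_add σ₀)
  · rw [abs_mul]
    have := mul_le_mul (hd _ (H.gapFn_mem x t)) (hD.bound_t x t) (abs_nonneg _) hd0
    linarith

theorem bound_pow (H : PerturbedState κ c A K σ₀ η α α' w w' m p) {r : ℝ}
    (hr : r ∈ ({expo κ, -expo κ} : Set ℝ)) :
    HasC1Bound (K + |r| * K * 2) (fun x t => gapFn σ₀ m x t ^ r) := by
  have hr1 : r ∈ ({expo κ, -expo κ, expo κ - 1, -expo κ - 1} : Set ℝ) := by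
    rcases hr with rfl | rfl <;> simp
  have hr2 : r - 1 ∈ ({expo κ, -expo κ, expo κ - 1, -expo κ - 1} : Set ℝ) := by
    rcases hr with rfl | rfl <;> simp
  have hpos {s : ℝ} (hs : s ∈ Icc (σ₀ / 2) (2 * σ₀)) : 0 < s := by
    linarith [hs.1, H.σ₀_pos]
  refine (H.comp_gap (F := fun s => s ^ r) (F' := fun s => r * s ^ (r - 1)) (a := K)
    (d := |r| * K) (fun s hs => Real.hasDerivAt_rpow_const (Or.inl hs.ne')) ?_ (fun x t => ?_)
    (fun s hs => ?_)).mono ?_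
  · exact continuousOn_const.mul fun τ hτ =>
      (Real.continuousAt_rpow_const τ _ (Or.inl (ne_of_gt hτ))).continuousWithinAt
  · rw [abs_of_pos (Real.rpow_pos_of_pos (H.gapFn_pos x t) _)]
    exact H.pow_le _ (H.gapFn_mem x t) r hr1
  · rw [abs_mul, abs_of_pos (Real.rpow_pos_of_pos (hpos hs) _)]
    gcongr
    exact H.pow_le s hs _ hr2
  · have := H.K_pos
    have := H.adm.le_one 0
    gcongr
    linarith

/-- The primitive is based at the unperturbed gap `σ₀`, hence of order `η`. This makes the
correction and the free term of the Riccati equation small. -/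
theorem bound_prim (H : PerturbedState κ c A K σ₀ η α α' w w' m p) :
    HasC1Bound (4 * K * η) (fun x t => gapPrim κ σ₀ (gapFn σ₀ m x t)) := by
  have hK := H.K_pos
  have hσ := H.σ₀_pos
  have hle {s : ℝ} (hs : s ∈ Icc (σ₀ / 2) (2 * σ₀)) : |s ^ (-expo κ - 1)| ≤ K := by
    rw [abs_of_pos (Real.rpow_pos_of_pos (by linarith [hs.1]) _)]
    exact H.pow_le s hs _ (by simp)
  refine (H.comp_gap (F := gapPrim κ σ₀) (a := 2 * K * η) (d := K)
    (fun s hs => hasDerivAt_gapPrim κ H.σ₀_pos hs) ?_ (fun x t => ?_) (fun s hs => hle hs)).mono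
    (by linarith)
  · exact fun τ hτ => (Real.continuousAt_rpow_const τ _ (Or.inl (ne_of_gt hτ))).continuousWithinAt
  · have h1 : |gapPrim κ σ₀ (gapFn σ₀ m x t)| ≤ K * |gapFn σ₀ m x t - σ₀| := by
      rw [← Real.norm_eq_abs]
      refine intervalIntegral.norm_integral_le_of_norm_le_const fun τ hτ => hle ?_
      have hm := H.gapFn_mem x t
      have := uIoc_subset_uIcc hτ
      exact ⟨(le_min (by linarith) hm.1).trans this.1, this.2.trans (max_le (by linarith) hm.2)⟩
    obtain ⟨_, hD⟩ := H.bound_gap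
    have h2 := hD.bound x t
    have e : gapFn σ₀ m x t - σ₀ = m 1 x t + -1 * m 0 x t := add_sub_cancel_left _ _
    rw [e] at h1
    nlinarith

theorem bound_corr (H : PerturbedState κ c A K σ₀ η α α' w w' m p) :
    HasC1Bound (2 * A * K / κ * η) (corr κ σ₀ α m) := by
  refine ((H.bound_α.mul H.bound_prim).const_mul (1 / (4 * κ))).mono (le_of_eq ?_)
  have := H.κ_pos
  rw [abs_of_pos (by positivity)]
  field_simp

theorem speed_mul_lam (H : PerturbedState κ c A K σ₀ η α α' w w' m p) (i : Fin 2) (x t : ℝ) :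
    speed κ w m i x t * (lam κ i fun j => w j t + m j x t) = 1 :=
  inv_mul_cancel₀ (H.bg.lam_pos H.adm i x t).ne'

section along

variable {x t y : ℝ}

theorem m_along (H : PerturbedState κ c A K σ₀ η α α' w w' m p) (S : IsSol κ L α α' w w' m p)
    (hy : y ∈ Ioo 0 L) {ψ : ℝ → ℝ} {ψ' : ℝ} (hψ : HasDerivAt ψ ψ' y) (j : Fin 2) :
    HasDerivAt (fun y => m j y (ψ y)) (slopeX κ α w m p j y (ψ y) + p j y (ψ y) * ψ') y :=
  hasDerivAt_along (H.adm.cont' j) (fun x => (H.adm.reg j x).deriv) hψ (S.left j y hy _)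

/-- Put `j = i + 1`. Along the `i`-th characteristic the derivatives of `mⱼ` and `mᵢ` differ by `bᵢ
(λᵢ - λⱼ) aⱼ`, and, with indices in `Fin 2`, `λ₁ - λ₀ = 2κσ`. The background does not contribute
because its gap is constant. So the gap sees only the slope of the other component. -/
theorem gapFn_along (H : PerturbedState κ c A K σ₀ η α α' w w' m p) (S : IsSol κ L α α' w w' m p)
    (i : Fin 2) (hy : y ∈ Ioo 0 L) {ψ : ℝ → ℝ} (hψ : HasDerivAt ψ (speed κ w m i y (ψ y)) y) :
    HasDerivAt (fun y => gapFn σ₀ m y (ψ y)) (-(2 * κ * speed κ w m i y (ψ y) *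
      gapFn σ₀ m y (ψ y) * slopeX κ α w m p (i + 1) y (ψ y))) y := by
  refine (((H.m_along S hy hψ 1).add ((H.m_along S hy hψ 0).const_mul (-1))).const_add
    σ₀).congr_deriv ?_
  have h0 := H.speed_mul_lam 0 y (ψ y)
  have h1 := H.speed_mul_lam 1 y (ψ y)
  have hg := H.gap (ψ y)
  simp only [lam, zero_add, show (1 + 1 : Fin 2) = 0 from rfl] at h0 h1
  obtain ⟨rfl⟩ : σ₀ = w 1 (ψ y) - w 0 (ψ y) := hg.symm
  fin_cases i
  · simp only [Fin.zero_eta, Fin.isValue, zero_add, slopeX, gapFn]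
    generalize speed κ w m 0 y (ψ y) = b0 at *
    generalize speed κ w m 1 y (ψ y) = b1 at *
    linear_combination (1 / 2 * α (ψ y) * (m 0 y (ψ y) + m 1 y (ψ y)) - p 1 y (ψ y)) *
      (b0 * h1 - b1 * h0)
  · simp only [Fin.mk_one, Fin.isValue, show (1 + 1 : Fin 2) = 0 from rfl, slopeX, gapFn]
    generalize speed κ w m 0 y (ψ y) = b0 at *
    generalize speed κ w m 1 y (ψ y) = b1 at *
    linear_combination (1 / 2 * α (ψ y) * (m 0 y (ψ y) + m 1 y (ψ y)) - p 0 y (ψ y)) *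
      (b0 * h1 - b1 * h0)

theorem speed_along (H : PerturbedState κ c A K σ₀ η α α' w w' m p) (S : IsSol κ L α α' w w' m p)
    (i : Fin 2) (hy : y ∈ Ioo 0 L) {ψ : ℝ → ℝ} (hψ : HasDerivAt ψ (speed κ w m i y (ψ y)) y) :
    HasDerivAt (fun y => speed κ w m i y (ψ y))
      (speed κ w m i y (ψ y) * speedDeriv κ w w' m p i y (ψ y) - speed κ w m i y (ψ y) ^ 2 *
        lam κ i fun j => slopeX κ α w m p j y (ψ y)) y := by
  have h1 : HasDerivAt (fun x => speed κ w m i x (ψ y))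
      (-(lam κ i fun j => slopeX κ α w m p j y (ψ y)) /
        (lam κ i fun j => w j (ψ y) + m j y (ψ y)) ^ 2) y := by
    refine HasDerivAt.fun_inv ?_ (H.bg.lam_pos H.adm i y (ψ y)).ne'
    exact (((S.left i y hy (ψ y)).const_add _).const_mul _).add
      (((S.left (i + 1) y hy (ψ y)).const_add _).const_mul _)
  refine (hasDerivAt_along (H.bg.cont_speedDeriv H.adm i)
    (fun x => (H.bg.reg_speed H.adm i x).deriv) hψ h1).congr_deriv ?_
  rw [div_eq_mul_inv, ← inv_pow, show (lam κ i fun j => w j (ψ y) + m j y (ψ y))⁻¹ =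
    speed κ w m i y (ψ y) from rfl]
  ring

/-- The relation `aᵢ = bᵢ (α (m₀ + m₁) / 2 - pᵢ)` is differentiated along its own characteristic,
where every factor has a derivative; the terms with `∂ₜbᵢ` cancel. The two terms that contain `aⱼ`
obstruct a scalar equation. -/
theorem slopeX_along (H : PerturbedState κ c A K σ₀ η α α' w w' m p) (S : IsSol κ L α α' w w' m p)
    (i : Fin 2) (x t : ℝ) (hy : y ∈ Ioo 0 L) {a aj b : ℝ}
    (ha : a = slopeX κ α w m p i y (flow (speed κ w m i) x t y))
    (haj : aj = slopeX κ α w m p (i + 1) y (flow (speed κ w m i) x t y))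
    (hb : b = speed κ w m i y (flow (speed κ w m i) x t y)) :
    HasDerivAt (fun y => slopeX κ α w m p i y (flow (speed κ w m i) x t y))
      (b * (-(1 + κ) * a ^ 2 - (1 - κ) * a * aj +
        1 / 2 * α (flow (speed κ w m i) x t y) * (a + aj))) y := by
  have hψ := (H.bg.isField H.adm i).hasDerivAt_flow x t y
  have hp := S.along i x t y hy
  set ψ := flow (speed κ w m i) x t with hψdef
  have hα : HasDerivAt (fun y => α (ψ y)) (α' (ψ y) * speed κ w m i y (ψ y)) y :=
    (H.bg.reg_α.deriv (ψ y)).comp y hψ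
  have hM := (H.m_along S hy hψ 0).add (H.m_along S hy hψ 1)
  refine ((H.speed_along S i hy hψ).mul (((hα.const_mul (1 / 2)).mul hM).sub hp)).congr_deriv ?_
  have e := apply_zero_add_apply_one (fun j => slopeX κ α w m p j y (ψ y)) i
  simp only [Pi.mul_apply, Pi.sub_apply, Pi.add_apply, srcDeriv, lam, ← hb, ← ha, ← haj] at e ⊢
  have ha' : a = b * (1 / 2 * α (ψ y) * (m 0 y (ψ y) + m 1 y (ψ y)) - p i y (ψ y)) := by
    rw [ha, hb, slopeX]
  linear_combination (1 / 2 * b * α (ψ y)) * e +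
    (b * ((1 + κ) * a + (1 - κ) * aj)) * ha'

/-- By `gapFn_along`, differentiating `σ^(-β)` produces `2κβ bᵢ σ^(-β) aᵢ aⱼ`, and `2κβ = 1 - κ`
makes it cancel the cross term of `slopeX_along`. The other foreign term, `α bᵢ σ^(-β) aⱼ / 2`, is
cancelled by the correction `(α / 4κ) Ω(σ)`, since `Ω' = σ^(-β-1)`. The remaining coefficients
involve `m` and `α'` but no derivative of `m`, so they are continuously differentiable in `t`. -/
theorem riccati_along (H : PerturbedState κ c A K σ₀ η α α' w w' m p)
    (S : IsSol κ L α α' w w' m p) (i : Fin 2) (x t : ℝ) (hy : y ∈ Ioo 0 L) {V : ℝ → ℝ → ℝ}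
    {R : Fin 3 → ℝ → ℝ → ℝ} (hV : V = riccatiVar κ σ₀ α w m p i)
    (hR : R = riccatiCoeffs κ σ₀ α α' w m i) :
    HasDerivAt (fun y => V y (flow (speed κ w m i) x t y))
      (R 2 y (flow (speed κ w m i) x t y) * V y (flow (speed κ w m i) x t y) ^ 2 +
        R 1 y (flow (speed κ w m i) x t y) * V y (flow (speed κ w m i) x t y) +
        R 0 y (flow (speed κ w m i) x t y)) y := by
  have hψ := (H.bg.isField H.adm i).hasDerivAt_flow x t y
  have ha := H.slopeX_along S i x t hy rfl rfl rfl
  set ψ := flow (speed κ w m i) x t with hψdef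
  have hα : HasDerivAt (fun y => α (ψ y)) (α' (ψ y) * speed κ w m i y (ψ y)) y :=
    (H.bg.reg_α.deriv (ψ y)).comp y hψ
  have hg := H.gapFn_along S i hy hψ
  have hσ := H.gapFn_pos y (ψ y)
  have hpow := (Real.hasDerivAt_rpow_const (p := -expo κ) (Or.inl hσ.ne')).comp y hg
  have hprim := (hasDerivAt_gapPrim κ H.σ₀_pos hσ).comp y hg
  subst hV hR
  refine ((hpow.mul ha).add ((hα.mul hprim).const_mul (1 / (4 * κ)))).congr_deriv ?_
  simp only [Function.comp_apply, riccatiCoeffs, riccatiVar, corr, Matrix.cons_val]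
  have e1 : gapFn σ₀ m y (ψ y) ^ (-expo κ - 1) =
      gapFn σ₀ m y (ψ y) ^ (-expo κ) / gapFn σ₀ m y (ψ y) := Real.rpow_sub_one hσ.ne' _
  have e2 : gapFn σ₀ m y (ψ y) ^ expo κ * gapFn σ₀ m y (ψ y) ^ (-expo κ) = 1 := by
    rw [← Real.rpow_add hσ, add_neg_cancel, Real.rpow_zero]
  have e3 : expo κ * (2 * κ) = 1 - κ := by
    have := H.κ_pos
    unfold expo
    field_simp
  have hκ := H.κ_pos.ne'
  rw [e1]
  generalize gapFn σ₀ m y (ψ y) ^ (-expo κ) = T at *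
  generalize gapFn σ₀ m y (ψ y) ^ expo κ = s at *
  generalize gapPrim κ σ₀ (gapFn σ₀ m y (ψ y)) = Ω at *
  generalize gapFn σ₀ m y (ψ y) = σ at *
  generalize speed κ w m i y (ψ y) = b at *
  generalize slopeX κ α w m p i y (ψ y) = a at *
  generalize slopeX κ α w m p (i + 1) y (ψ y) = aj at *
  generalize expo κ = β at *
  have hi := mul_inv_cancel₀ hσ.ne'
  have hj := mul_inv_cancel₀ hκ
  linear_combination (b * T * a * aj) * e3 + ((1 + κ) * b * T * a ^ 2) * e2 +
    (2 * κ * β * b * T * a * aj) * hi -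
    (1 / 2 * α (ψ y) * T * b * aj) * (κ * κ⁻¹ * hi + hj)

end along

end PerturbedState

/-! ### Uniform bounds and the second `t`-derivative. -/

namespace IsRiccati

variable {L B C v d : ℝ} {b bt : ℝ → ℝ → ℝ} {A At : Fin 3 → ℝ → ℝ → ℝ} {V : ℝ → ℝ → ℝ}

theorem factor_pos (x t t' y : ℝ) : 0 < riccatiFactor b A V x t t' y := Real.exp_pos _

theorem factor_le (h2 : ∀ x t, |A 2 x t| ≤ C) (h1 : ∀ x t, |A 1 x t| ≤ C)
    (hV : ∀ x t, |V x t| ≤ v) {x y : ℝ} (hx : x ∈ Icc 0 L) (hy : y ∈ Icc 0 L) (t t' : ℝ) :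
    riccatiFactor b A V x t t' y ≤ Real.exp ((C * (2 * v) + C) * L) := by
  have hC : 0 ≤ C := (abs_nonneg _).trans (h1 0 0)
  have hv : 0 ≤ v := (abs_nonneg _).trans (hV 0 0)
  refine Real.exp_le_exp.2 ((le_abs_self _).trans ((abs_intervalIntegral_le
    (B := C * (2 * v) + C) (fun η => ?_) y x).trans ?_))
  · refine (abs_add_le _ _).trans (add_le_add ?_ (h1 _ _))
    rw [abs_mul]
    refine mul_le_mul (h2 _ _) ((abs_add_le _ _).trans ?_) (abs_nonneg _) hC
    linarith [hV η (flow b x t' η), hV η (flow b x t η)]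
  · gcongr
    rw [abs_le]
    constructor <;> linarith [hx.1, hx.2, hy.1, hy.2]

/-- The bound `d` of the free coefficient is kept apart from `C`: with `v` and `d` of order `η`, the
whole remainder is of order `η`. -/
theorem abs_rest_le (hb : IsField b bt B) (h2 : ∀ x t, |A 2 x t| ≤ C) (h1 : ∀ x t, |A 1 x t| ≤ C)
    (ht2 : ∀ x t, |At 2 x t| ≤ C) (ht1 : ∀ x t, |At 1 x t| ≤ C) (ht0 : ∀ x t, |At 0 x t| ≤ d)
    (hV : ∀ x t, |V x t| ≤ v) {x : ℝ} (hx : x ∈ Icc 0 L) (t : ℝ) :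
    |riccatiRest b bt A At V x t t| ≤ Real.exp ((C * (2 * v) + C) * L) *
      (Real.exp (B * L) * (C * v ^ 2 + C * v + d)) * L := by
  have hC : 0 ≤ C := (abs_nonneg _).trans (h1 0 0)
  have hv : 0 ≤ v := (abs_nonneg _).trans (hV 0 0)
  have hd : 0 ≤ d := (abs_nonneg _).trans (ht0 0 0)
  have hB := hb.nonneg
  have key : ‖riccatiRest b bt A At V x t t‖ ≤ Real.exp ((C * (2 * v) + C) * L) *
      (Real.exp (B * L) * (C * v ^ 2 + C * v + d)) * |x - 0| := by
    refine intervalIntegral.norm_integral_le_of_norm_le_const fun y hy => ?_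
    rw [uIoc_of_le hx.1] at hy
    have hy' : y ∈ Icc 0 L := ⟨hy.1.le, hy.2.trans hx.2⟩
    rw [Real.norm_eq_abs, abs_mul, abs_of_pos (factor_pos _ _ _ _)]
    refine mul_le_mul (factor_le h2 h1 hV hx hy' t t) ?_ (abs_nonneg _) (Real.exp_pos _).le
    rw [riccatiSource, abs_mul, IsField.flowSlope_self, abs_of_pos (IsField.flowDeriv_pos _ _ _ _ _)]
    refine mul_le_mul ((hb.flowDeriv_le x t y).trans (Real.exp_le_exp.2 ?_)) ?_ (abs_nonneg _)
      (Real.exp_pos _).le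
    · gcongr
      rw [abs_le]
      constructor <;> linarith [hx.1, hx.2, hy.1, hy'.2]
    · simp only [meanSlope_self]
      refine (abs_add_le _ _).trans (add_le_add ((abs_add_le _ _).trans (add_le_add ?_ ?_))
        (ht0 _ _))
      · rw [abs_mul, abs_pow]
        gcongr
        exacts [ht2 _ _, hV _ _]
      · rw [abs_mul]
        gcongr
        exacts [ht1 _ _, hV _ _]
  rw [Real.norm_eq_abs, sub_zero, abs_of_nonneg hx.1] at key
  refine key.trans ?_
  gcongr
  exact hx.2

end IsRiccati

namespace PerturbedState

/-- Each term of the free coefficient contains the correction or the primitive, which vanish for `m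
= 0`; hence the factor `η`. The constant is chosen before the solution and serves all small
solutions. -/
theorem exists_bound_coeffs (κ c A K : ℝ) : ∃ C, 0 ≤ C ∧ ∀ {σ₀ η : ℝ} {α α' : ℝ → ℝ}
    {w w' : Fin 2 → ℝ → ℝ} {m p : Fin 2 → ℝ → ℝ → ℝ},
    PerturbedState κ c A K σ₀ η α α' w w' m p → ∀ i,
      HasC1Bound (C * η) (riccatiCoeffs κ σ₀ α α' w m i 0) ∧
      HasC1Bound C (riccatiCoeffs κ σ₀ α α' w m i 1) ∧
      HasC1Bound C (riccatiCoeffs κ σ₀ α α' w m i 2) := by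
  obtain ⟨S, hS⟩ : ∃ S, S = speedBound κ c A := ⟨_, rfl⟩
  obtain ⟨P, hP⟩ : ∃ P, P = K + |expo κ| * K * 2 := ⟨_, rfl⟩
  obtain ⟨Q, hQ⟩ : ∃ Q, Q = 2 * A * K / κ := ⟨_, rfl⟩
  set C₀ := 2 * S * (|-(1 + κ)| * (2 * P * (2 * Q * Q)) +
    (|-1 / 2| * (2 * A * Q) + |1 / (4 * κ)| * (2 * A * (4 * K)))) with hC₀
  set C₁ := 2 * S * (|2 * (1 + κ)| * (2 * P * Q) + |1 / 2| * A) with hC₁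
  set C₂ := |-(1 + κ)| * (2 * S * P) with hC₂
  refine ⟨|C₀| + |C₁| + |C₂|, by positivity, fun {σ₀ η α α' w w' m p} H i => ?_⟩
  have hη := H.η_nonneg
  have hη1 : η ≤ 1 := H.adm.le_one 0
  have hpow : HasC1Bound P fun x t => gapFn σ₀ m x t ^ expo κ := hP ▸ H.bound_pow (by simp)
  have hspeed : HasC1Bound S (speed κ w m i) := hS ▸ H.bound_speed i
  have hcorr : HasC1Bound (Q * η) (corr κ σ₀ α m) := hQ ▸ H.bound_corr
  have hcorr' : HasC1Bound Q (corr κ σ₀ α m) := by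
    refine hcorr.mono (mul_le_of_le_one_right ?_ hη1)
    rw [hQ]
    have := H.K_pos
    have := H.κ_pos
    have := H.bg.A_nonneg
    positivity
  have b1 := abs_nonneg C₀
  have b2 := abs_nonneg C₁
  have b3 := abs_nonneg C₂
  refine ⟨?_, ?_, ?_⟩
  · refine (hspeed.mul (((hpow.mul (hcorr'.mul hcorr)).const_mul (-(1 + κ))).add
      (((H.bound_α.mul hcorr).const_mul (-1 / 2)).add
      ((H.reg_α'.mul H.bound_prim).const_mul (1 / (4 * κ)))))).mono ?_
    refine le_trans (b := C₀ * η) (le_of_eq (by rw [hC₀]; ring)) ?_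
    gcongr
    linarith [le_abs_self C₀]
  · refine (hspeed.mul (((hpow.mul hcorr').const_mul (2 * (1 + κ))).add
      (H.bound_α.const_mul (1 / 2)))).mono ?_
    linarith [le_abs_self C₁]
  · refine ((hspeed.mul hpow).const_mul (-(1 + κ))).mono ?_
    linarith [le_abs_self C₂]

theorem exists_bound_parts (κ c A K : ℝ) : ∃ C, 0 ≤ C ∧ ∀ {σ₀ η : ℝ} {α α' : ℝ → ℝ}
    {w w' : Fin 2 → ℝ → ℝ} {m p : Fin 2 → ℝ → ℝ → ℝ},
    PerturbedState κ c A K σ₀ η α α' w w' m p → ∀ i,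
      HasC1Bound (C * η) (fun x t => 1 / 2 * (α t * (m 0 x t + m 1 x t))) ∧
      HasC1Bound C (fun x t => gapFn σ₀ m x t ^ (-expo κ) * speed κ w m i x t) ∧
      HasC1Bound C (fun x t => gapFn σ₀ m x t ^ expo κ * lam κ i fun j => w j t + m j x t) ∧
      HasC1Bound (C * η) (corr κ σ₀ α m) := by
  set C₀ := |1 / 2| * (2 * A * 2) with hC₀
  set C₁ := 2 * (K + |expo κ| * K * 2) * speedBound κ c A with hC₁
  set C₂ := 2 * (K + |expo κ| * K * 2) * (lamNorm κ * (A + 1)) with hC₂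
  set C₃ := 2 * A * K / κ with hC₃
  refine ⟨|C₀| + |C₁| + |C₂| + |C₃|, by positivity, fun {σ₀ η α α' w w' m p} H i => ?_⟩
  have hη := H.η_nonneg
  have b0 := abs_nonneg C₀
  have b1 := abs_nonneg C₁
  have b2 := abs_nonneg C₂
  have b3 := abs_nonneg C₃
  refine ⟨?_, ?_, ?_, ?_⟩
  · refine ((H.bound_α.mul ((H.bound_m 0).add (H.bound_m 1))).const_mul (1 / 2)).mono ?_
    refine le_trans (b := C₀ * η) (le_of_eq (by rw [hC₀]; ring)) ?_
    gcongr
    linarith [le_abs_self C₀]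
  · refine ((H.bound_pow (by simp)).mul (H.bound_speed i)).mono ?_
    rw [abs_neg]
    linarith [le_abs_self C₁]
  · refine ((H.bound_pow (by simp)).mul (H.bound_lam i)).mono ?_
    linarith [le_abs_self C₂]
  · refine H.bound_corr.mono ?_
    gcongr
    linarith [le_abs_self C₃]

end PerturbedState

/-- `q` is, in terms of characteristics, a `t`-derivative of `pᵢ`, with coefficients controlled
by `C`. -/
structure HasTransportedDeriv (L C η : ℝ) (b p c₀ c₁ : ℝ → ℝ → ℝ) (g : ℝ → ℝ) : Prop where
  cont₀ : Continuous (uncurry c₀)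
  cont₁ : Continuous (uncurry c₁)
  meas : Measurable g
  ae_le : ∀ᵐ t, |g t| ≤ C * (η + |deriv (p 0) t|)
  bound₀ : ∀ x ∈ Icc 0 L, ∀ t, |c₀ x t| ≤ C * η
  bound₁ : ∀ x ∈ Icc 0 L, ∀ t, |c₁ x t| ≤ C
  ac : ∀ x ∈ Icc 0 L, ∀ a c, AbsolutelyContinuousOnInterval (p x) a c
  ae_hasDerivAt : ∀ x ∈ Icc 0 L, ∀ᵐ t, HasDerivAt (p x) (c₀ x t + c₁ x t * g (flow b x t 0)) t

theorem ae_differentiableAt_of_absolutelyContinuous {f : ℝ → ℝ}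
    (h : ∀ a c, AbsolutelyContinuousOnInterval f a c) : ∀ᵐ s, DifferentiableAt ℝ f s := by
  have : ∀ n : ℕ, ∀ᵐ s, s ∈ uIcc (-n : ℝ) n → DifferentiableAt ℝ f s :=
    fun n => (h _ _).ae_differentiableAt
  filter_upwards [ae_all_iff.2 this] with s hs
  obtain ⟨n, hn⟩ := exists_nat_ge |s|
  exact hs n (by rw [uIcc_of_le (by linarith [abs_nonneg s])]; exact abs_le.1 hn)

/-- The Riccati variable is solved for `pᵢ`: from `V = X (U - pᵢ) + Ω` and `W X = 1` follows `pᵢ = U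
- W (V - Ω)`, where `U`, `W`, `Ω` are continuously differentiable in `t`. So `pᵢ` inherits from `V`
the absolute continuity and the formula for the derivative, with `g` the derivative of `V 0`. -/
theorem PerturbedState.exists_transportedDeriv (κ c A K L : ℝ) (hL : 0 ≤ L) :
    ∃ C, 0 ≤ C ∧ ∀ {σ₀ η : ℝ} {α α' : ℝ → ℝ} {w w' : Fin 2 → ℝ → ℝ} {m p : Fin 2 → ℝ → ℝ → ℝ},
      PerturbedState κ c A K σ₀ η α α' w w' m p → IsSol κ L α α' w w' m p →
      (∀ i a c, AbsolutelyContinuousOnInterval (p i 0) a c) →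
      ∀ i, ∃ c₀ c₁ g, HasTransportedDeriv L C η (speed κ w m i) (p i) c₀ c₁ g := by
  obtain ⟨E, hE0, hE⟩ := exists_bound_coeffs κ c A K
  obtain ⟨D, hD0, hD⟩ := exists_bound_parts κ c A K
  set B := speedBound κ c A with hB
  set v := D * (D + 1) + D with hv
  set F := Real.exp ((E * (2 * v) + E) * L) with hF
  set J := Real.exp (B * L) with hJ
  set r := F * (J * (E * (v * v) + E * v + E)) * L with hr
  have hv0 : 0 ≤ v := by positivity
  have hr0 : 0 ≤ r := by positivity
  set C₀ := D + (D * (v + D) + D * (r + D)) with hC₀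
  set C₁ := D * (F * J) with hC₁
  set C₂ := D * (D + 1) + (D * (D + 1) + D) with hC₂
  refine ⟨C₀ + C₁ + C₂, by positivity, fun {σ₀ η α α' w w' m p} H S hac i => ?_⟩
  have hC₀0 : 0 ≤ C₀ := by positivity
  have hC₁0 : 0 ≤ C₁ := by positivity
  have hC₂0 : 0 ≤ C₂ := by positivity
  have hη := H.η_nonneg
  have hη1 : η ≤ 1 := H.adm.le_one 0
  have hb : IsField (speed κ w m i) (speedDeriv κ w w' m p i) B := H.bg.isField H.adm i
  obtain ⟨hR0, hR1, hR2⟩ := hE H i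
  obtain ⟨hU, hX, hW, hΩ⟩ := hD H i
  have hcV : Continuous (uncurry (riccatiVar κ σ₀ α w m p i)) := by
    obtain ⟨_, hp⟩ := H.bound_pow (r := -expo κ) (by simp)
    obtain ⟨_, hΩ⟩ := hΩ
    obtain ⟨_, hU⟩ := hU
    obtain ⟨_, hX⟩ := hX
    refine ((hX.cont.mul (hU.cont.sub (H.adm.cont' i))).add hΩ.cont).congr fun y => ?_
    simp only [Pi.add_apply, Pi.mul_apply, Pi.sub_apply, uncurry, riccatiVar, slopeX]
    ring
  obtain ⟨R0t, hR0⟩ := hR0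
  obtain ⟨R1t, hR1⟩ := hR1
  obtain ⟨R2t, hR2⟩ := hR2
  have hXac := hX.absolutelyContinuous
  have hUac := hU.absolutelyContinuous
  have hWac := hW.absolutelyContinuous
  have hΩac := hΩ.absolutelyContinuous
  obtain ⟨Ut, hU⟩ := hU
  obtain ⟨Xt, hX⟩ := hX
  obtain ⟨Wt, hW⟩ := hW
  obtain ⟨Ωt, hΩ⟩ := hΩ
  set U : ℝ → ℝ → ℝ := fun x t => 1 / 2 * (α t * (m 0 x t + m 1 x t)) with hUdef
  set X : ℝ → ℝ → ℝ := fun x t => gapFn σ₀ m x t ^ (-expo κ) * speed κ w m i x t with hXdef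
  set W : ℝ → ℝ → ℝ := fun x t => gapFn σ₀ m x t ^ expo κ * lam κ i fun j => w j t + m j x t
    with hWdef
  set Ω := corr κ σ₀ α m with hΩdef
  set V := riccatiVar κ σ₀ α w m p i with hVdef
  set R := riccatiCoeffs κ σ₀ α α' w m i with hRdef
  set Rt : Fin 3 → ℝ → ℝ → ℝ := ![R0t, R1t, R2t] with hRt
  have hV (x t : ℝ) : V x t = X x t * (U x t - p i x t) + Ω x t := by
    simp only [hVdef, hXdef, hUdef, riccatiVar, slopeX]
    ring
  have hWX (x t : ℝ) : W x t * X x t = 1 := by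
    have h1 : gapFn σ₀ m x t ^ expo κ * gapFn σ₀ m x t ^ (-expo κ) = 1 := by
      rw [← Real.rpow_add (H.gapFn_pos x t), add_neg_cancel, Real.rpow_zero]
    have h2 := H.speed_mul_lam i x t
    simp only [hWdef, hXdef]
    linear_combination h1 + gapFn σ₀ m x t ^ expo κ * gapFn σ₀ m x t ^ (-expo κ) * h2
  have hp (x t : ℝ) : p i x t = U x t - W x t * (V x t - Ω x t) := by
    rw [hV]
    linear_combination (U x t - p i x t) * hWX x t
  have hric : IsRiccati L (speed κ w m i) R Rt V := by
    refine ⟨fun k => ?_, fun k => ?_, fun k x t => ?_, hcV, fun x t y hy =>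
      H.riccati_along S i x t hy rfl rfl⟩
    · fin_cases k
      exacts [hR0.cont, hR1.cont, hR2.cont]
    · fin_cases k
      exacts [hR0.cont_t, hR1.cont_t, hR2.cont_t]
    · fin_cases k
      exacts [hR0.deriv x t, hR1.deriv x t, hR2.deriv x t]
  have hVb (x t : ℝ) : |V x t| ≤ v * η := by
    rw [hV, hv]
    have h1 : |U x t - p i x t| ≤ (D + 1) * η := by
      refine (abs_sub _ _).trans ?_
      linarith [hU.bound x t, (H.adm.reg i x).bound' t]
    have h2 := mul_le_mul (hX.bound x t) h1 (abs_nonneg _) hD0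
    refine (abs_add_le _ _).trans ?_
    rw [abs_mul]
    linarith [hΩ.bound x t]
  have hVb' (x t : ℝ) : |V x t| ≤ v := (hVb x t).trans (mul_le_of_le_one_right hv0 hη1)
  have hV0ac (a c : ℝ) : AbsolutelyContinuousOnInterval (V 0) a c := by
    have : V 0 = X 0 * (U 0 - p i 0) + Ω 0 := funext fun t => hV 0 t
    rw [this]
    exact ((hXac 0 a c).mul ((hUac 0 a c).sub (hac i a c))).add (hΩac 0 a c)
  have hVac := fun x hx a c => hric.absolutelyContinuous hb hV0ac (x := x) hx a c
  set fac : ℝ → ℝ → ℝ := fun x t => riccatiFactor (speed κ w m i) R V x t t 0 with hfac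
  set θt : ℝ → ℝ → ℝ := fun x t => flowDeriv (speed κ w m i) (speedDeriv κ w w' m p i) x t 0
    with hθt
  set rest : ℝ → ℝ → ℝ := fun x t =>
    riccatiRest (speed κ w m i) (speedDeriv κ w w' m p i) R Rt V x t t with hrest
  have hfc : Continuous (uncurry fac) := hric.continuous_factor hb continuous_fst continuous_snd
    continuous_snd continuous_const
  have hθc : Continuous (uncurry θt) :=
    hb.continuous_flowDeriv_comp continuous_fst continuous_snd continuous_const
  have hrc : Continuous (uncurry rest) :=
    hric.continuous_rest hb continuous_fst continuous_snd continuous_snd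
  have hfb {x : ℝ} (hx : x ∈ Icc 0 L) (t : ℝ) : |fac x t| ≤ F := by
    rw [abs_of_pos (IsRiccati.factor_pos _ _ _ _)]
    exact IsRiccati.factor_le hR2.bound hR1.bound hVb' hx ⟨le_rfl, hL⟩ t t
  have hθb {x : ℝ} (hx : x ∈ Icc 0 L) (t : ℝ) : |θt x t| ≤ J := by
    rw [abs_of_pos (IsField.flowDeriv_pos _ _ _ _ _)]
    refine (hb.flowDeriv_le x t 0).trans (Real.exp_le_exp.2 ?_)
    have := hb.nonneg
    gcongr
    rw [zero_sub, abs_neg, abs_of_nonneg hx.1]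
    exact hx.2
  have hrb {x : ℝ} (hx : x ∈ Icc 0 L) (t : ℝ) : |rest x t| ≤ r * η := by
    have hη2 : η * η ≤ η := mul_le_of_le_one_right hη hη1
    refine (IsRiccati.abs_rest_le hb (At := Rt) hR2.bound hR1.bound hR2.bound_t hR1.bound_t
      hR0.bound_t hVb hx t).trans ?_
    calc _ ≤ F * (J * ((E * (v * v) + E * v + E) * η)) * L := by
          have a1 : v * η ≤ v := mul_le_of_le_one_right hv0 hη1
          have a2 : v * v * (η * η) ≤ v * v * η := by gcongr
          have a3 : Real.exp ((E * (2 * (v * η)) + E) * L) ≤ F := by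
            rw [hF]
            gcongr
          have a4 : E * (v * η) ^ 2 + E * (v * η) + E * η ≤ (E * (v * v) + E * v + E) * η := by
            nlinarith [mul_le_mul_of_nonneg_left a2 hE0]
          gcongr
      _ = r * η := by rw [hr]; ring
  refine ⟨fun x t => Ut x t - (Wt x t * (V x t - Ω x t) + W x t * (rest x t - Ωt x t)),
    fun x t => -(W x t * (fac x t * θt x t)), deriv (V 0), ?_, ?_, measurable_deriv _, ?_, ?_, ?_,
    ?_, ?_⟩
  · exact hU.cont_t.sub ((hW.cont_t.mul (hcV.sub hΩ.cont)).add (hW.cont.mul (hrc.sub hΩ.cont_t)))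
  · exact (hW.cont.mul (hfc.mul hθc)).neg
  · filter_upwards [ae_differentiableAt_of_absolutelyContinuous (hac i)] with t ht
    have h1 : HasDerivAt (V 0) (Xt 0 t * (U 0 t - p i 0 t) +
        X 0 t * (Ut 0 t - deriv (p i 0) t) + Ωt 0 t) t := by
      have : V 0 = X 0 * (U 0 - p i 0) + Ω 0 := funext fun t => hV 0 t
      rw [this]
      exact ((hX.deriv 0 t).mul ((hU.deriv 0 t).sub ht.hasDerivAt)).add (hΩ.deriv 0 t)
    rw [h1.deriv]
    have h2 : |U 0 t - p i 0 t| ≤ (D + 1) * η := by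
      refine (abs_sub _ _).trans ?_
      linarith [hU.bound 0 t, (H.adm.reg i 0).bound' t]
    have h3 : |Ut 0 t - deriv (p i 0) t| ≤ D * η + |deriv (p i 0) t| := by
      refine (abs_sub _ _).trans ?_
      linarith [hU.bound_t 0 t]
    have h4 := mul_le_mul (hX.bound_t 0 t) h2 (abs_nonneg _) hD0
    have h5 := mul_le_mul (hX.bound 0 t) h3 (abs_nonneg _) hD0
    have h6 := abs_nonneg (deriv (p i 0) t)
    calc _ ≤ |Xt 0 t| * |U 0 t - p i 0 t| + |X 0 t| * |Ut 0 t - deriv (p i 0) t| + |Ωt 0 t| := by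
          refine (abs_add_le _ _).trans (add_le_add ((abs_add_le _ _).trans_eq ?_) le_rfl)
          rw [abs_mul, abs_mul]
      _ ≤ C₂ * (η + |deriv (p i 0) t|) := by
          have := hΩ.bound_t 0 t
          have h7 : 0 ≤ D * (D + 1) * |deriv (p i 0) t| := by positivity
          have h8 : 0 ≤ D * D * |deriv (p i 0) t| := by positivity
          have h9 : 0 ≤ D * η := by positivity
          have h10 : 0 ≤ D * |deriv (p i 0) t| := by positivity
          rw [hC₂]
          nlinarith
      _ ≤ _ := by
          gcongr
          linarith
  · intro x hx t
    have h2 : |V x t - Ω x t| ≤ (v + D) * η := by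
      refine (abs_sub _ _).trans ?_
      linarith [hVb x t, hΩ.bound x t]
    have h3 : |rest x t - Ωt x t| ≤ (r + D) * η := by
      refine (abs_sub _ _).trans ?_
      linarith [hrb hx t, hΩ.bound_t x t]
    have h4 := mul_le_mul (hW.bound_t x t) h2 (abs_nonneg _) hD0
    have h5 := mul_le_mul (hW.bound x t) h3 (abs_nonneg _) hD0
    calc _ ≤ |Ut x t| + (|Wt x t| * |V x t - Ω x t| + |W x t| * |rest x t - Ωt x t|) := by
          refine (abs_sub _ _).trans (add_le_add le_rfl ((abs_add_le _ _).trans_eq ?_))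
          rw [abs_mul, abs_mul]
      _ ≤ C₀ * η := by
          rw [hC₀]
          linarith [hU.bound_t x t]
      _ ≤ _ := by
          gcongr
          linarith
  · intro x hx t
    rw [abs_neg, abs_mul (W x t), abs_mul (fac x t)]
    refine le_trans (b := C₁) ?_ (by linarith)
    exact mul_le_mul (hW.bound x t) (mul_le_mul (hfb hx t) (hθb hx t) (abs_nonneg _)
      (Real.exp_pos _).le) (by positivity) hD0
  · intro x hx a c
    have : p i x = U x - W x * (V x - Ω x) := funext fun t => hp x t
    rw [this]
    exact (hUac x a c).sub ((hWac x a c).mul ((hVac x hx a c).sub (hΩac x a c)))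
  · intro x hx
    filter_upwards [hric.ae_hasDerivAt hb hV0ac hx] with t ht
    have : p i x = U x - W x * (V x - Ω x) := funext fun t => hp x t
    rw [this]
    refine ((hU.deriv x t).sub ((hW.deriv x t).mul (ht.sub (hΩ.deriv x t)))).congr_deriv ?_
    simp only [Pi.sub_apply, hfac, hθt, hrest]
    ring

/-! ### Small solutions of class `C^{1,1/2}`. -/

section solution

variable {κ c A K L σ₀ ε η : ℝ} {α α' : ℝ → ℝ} {w w' m₀ m₀' : Fin 2 → ℝ → ℝ} {G : ℝ → ℝ}
  {m p : Fin 2 → ℝ → ℝ → ℝ}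

theorem Adm.mono (h : Adm κ c G m p) (hG : ∀ x, G x ≤ η) (h1 : η ≤ 1) (hc : lamNorm κ * η ≤ c) :
    Adm κ c (fun _ => η) m p :=
  ⟨h.cont, h.cont', fun i x => (h.reg i x).mono (hG x), h.per, fun _ => h1, fun _ => hc⟩

theorem IsBackground.isSol (h : IsBackground κ c A α α' w w')
    (hm₀ : ∀ i, Reg ε (m₀ i) (m₀' i)) (hm₀' : ∀ i, Continuous (m₀' i)) (hm : Adm κ c G m p)
    (hfix : ∀ i, m i = iterStep κ L α w m₀ m i)
    (hfix' : ∀ i, p i = iterStepDeriv κ L α α' w w' m₀' m p i) : IsSol κ L α α' w w' m p where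
  left j x hx t := by
    have := h.hasDerivAt_iterStep hm₀ hm₀' hm j hx t
    rw [← hfix, ← hfix'] at this
    refine this.congr_deriv ?_
    rw [src, slopeX]
    ring
  along i x t y hy := by
    have := (h.isField hm i).hasDerivAt_transportDeriv_along (h.cont_srcDeriv hm i)
      (v₀' := m₀' i) x t y
    have e {z : ℝ} (hz : z ∈ Icc 0 L) (s : ℝ) : p i z s = transportDeriv (speed κ w m i)
        (speedDeriv κ w w' m p i) (srcDeriv κ α α' w w' m p i) (m₀' i) z s := by
      rw [hfix' i, iterStepDeriv, clamp_of_mem hz]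
    rw [← e (Ioo_subset_Icc_self hy)] at this
    refine this.congr_of_eventuallyEq ?_
    filter_upwards [Icc_mem_nhds hy.1 hy.2] with z hz using e hz _

/-- Existence of small solutions of class `C^{1,1/2}`. -/
theorem IsBackground.exists_isSol (h : IsBackground κ c A α α' w w') (hκ : 0 < κ) (hσ₀ : 0 < σ₀)
    (hα' : HasC1Bound A fun _ t => α' t) (hgap : ∀ t, w 1 t - w 0 t = σ₀)
    (hpow : ∀ s ∈ Icc (σ₀ / 2) (2 * σ₀),
      ∀ r ∈ ({expo κ, -expo κ, expo κ - 1, -expo κ - 1} : Set ℝ), s ^ r ≤ K) (hL : 0 ≤ L) :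
    ∃ δ > 0, ∃ D, 0 ≤ D ∧ ∀ ε, 0 ≤ ε → ε ≤ δ → ∀ m₀ m₀' : Fin 2 → ℝ → ℝ,
      (∀ i, Reg ε (m₀ i) (m₀' i)) → (∀ i, Continuous (m₀' i)) →
      (∀ i t, m₀ i (t + 1) = m₀ i t) →
      ∃ m p, PerturbedState κ c A K σ₀ (D * ε) α α' w w' m p ∧ IsSol κ L α α' w w' m p ∧
        ∀ i, m i 0 = m₀ i ∧ p i 0 = m₀' i := by
  have hT := h.transportBound_pos hL
  have hS := h.srcBound_nonneg
  have hN := lamNorm_pos κ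
  have hc := h.c_pos
  set D := 2 * transportBound κ c A L *
    Real.exp (2 * transportBound κ c A L * srcBound κ c A * L) with hD
  have hD0 : 0 < D := by positivity
  -- The entries of the minimum give `η = D * ε` the properties `η ≤ 1`, `lamNorm κ * η ≤ c` and `4
  -- * η ≤ σ₀` of a perturbed state.
  refine ⟨min 1 (min (c / lamNorm κ) (σ₀ / 4)) / D, by positivity, D, hD0.le,
    fun ε hε hεδ m₀ m₀' hm₀ hm₀' hper => ?_⟩
  rw [le_div_iff₀ hD0, le_min_iff, le_min_iff, le_div_iff₀ hN] at hεδ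
  obtain ⟨h1, h2, h3⟩ := hεδ
  have hmaj (x : ℝ) : majorant κ c A L ε x ≤ D * ε := by
    have := (clamp_mem hL x).2
    calc _ = 2 * transportBound κ c A L *
          Real.exp (2 * transportBound κ c A L * srcBound κ c A * clamp L x) * ε := by
            rw [majorant]; ring
      _ ≤ _ := by rw [hD]; gcongr
  have hc1 : lamNorm κ * (D * ε) ≤ c := by linarith
  obtain ⟨m, p, hm, hfix, hfix'⟩ := h.exists_fixedPoint hL hε hm₀ hm₀' hper
    (fun x => (hmaj x).trans (by linarith))
    (fun x => (mul_le_mul_of_nonneg_left (hmaj x) hN.le).trans hc1)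
  refine ⟨m, p, ⟨h, hκ, hσ₀, hα', hgap, hpow, hm.mono hmaj (by linarith) hc1, by linarith⟩,
    h.isSol hm₀ hm₀' hm hfix hfix', fun i => ⟨?_, ?_⟩⟩
  · ext t
    rw [hfix i, iterStep, clamp_of_mem ⟨le_rfl, hL⟩, (h.isField hm i).transport_zero]
  · ext t
    rw [hfix' i, iterStepDeriv, clamp_of_mem ⟨le_rfl, hL⟩, (h.isField hm i).transportDeriv_zero]

end solution

/-! ### Weak derivatives in one dimension. -/

/-- `g` is the weak derivative of the real function `f` on `(a, b)`. -/
def IsWeakDeriv (a b : ℝ) (f g : ℝ → ℝ) : Prop :=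
  ∀ φ : ℝ → ℝ, IsTest a b φ → ∫ t in Ioo a b, deriv φ t * f t = -∫ t in Ioo a b, φ t * g t

section weak

variable {a b : ℝ} {f g h : ℝ → ℝ} {φ χ : ℝ → ℝ}

theorem exists_isTest_integral_eq_one (hab : a < b) :
    ∃ φ, IsTest a b φ ∧ ∫ t in a..b, φ t = 1 := by
  let B : ContDiffBump ((a + b) / 2) := ⟨(b - a) / 8, (b - a) / 4, by linarith, by linarith⟩
  have hsupp : tsupport (B.normed volume) ⊆ Ioo a b := by
    rw [B.tsupport_normed_eq]
    intro t ht
    rw [Metric.mem_closedBall, Real.dist_eq, abs_le] at ht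
    have : B.rOut = (b - a) / 4 := rfl
    constructor <;> linarith [ht.1, ht.2]
  refine ⟨B.normed volume, ⟨B.contDiff_normed, B.hasCompactSupport_normed, hsupp⟩, ?_⟩
  rw [← B.integral_normed (μ := volume)]
  refine intervalIntegral.integral_eq_integral_of_support_subset ?_
  exact (subset_tsupport _).trans (hsupp.trans Ioo_subset_Ioc_self)

/-- To the right of the support of `χ` the primitive vanishes because the total integral is zero;
hence it is again a test function. -/
theorem isTest_primitive (hχ : IsTest a b χ) (h0 : ∫ t in a..b, χ t = 0) :
    IsTest a b (fun t => ∫ s in a..t, χ s) ∧ deriv (fun t => ∫ s in a..t, χ s) = χ := by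
  have hc : Continuous χ := hχ.1.continuous
  have hd (t : ℝ) : HasDerivAt (fun t => ∫ s in a..t, χ s) (χ t) t :=
    intervalIntegral.integral_hasDerivAt_right (hc.intervalIntegrable _ _)
      hc.stronglyMeasurable.stronglyMeasurableAtFilter hc.continuousAt
  have hderiv : deriv (fun t => ∫ s in a..t, χ s) = χ := funext fun t => (hd t).deriv
  obtain ⟨a', b', ha', hb', hsub⟩ : ∃ a' b', a < a' ∧ b' < b ∧ tsupport χ ⊆ Icc a' b' := by
    rcases (tsupport χ).eq_empty_or_nonempty with he | hne
    · exact ⟨a + 1, b - 1, by linarith, by linarith, he ▸ empty_subset _⟩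
    · have hK : IsCompact (tsupport χ) := hχ.2.1
      obtain ⟨p, hp⟩ := hK.exists_isLeast hne
      obtain ⟨q, hq⟩ := hK.exists_isGreatest hne
      exact ⟨p, q, (hχ.2.2 hp.1).1, (hχ.2.2 hq.1).2, fun t ht => ⟨hp.2 ht, hq.2 ht⟩⟩
  have hz {t : ℝ} (ht : t ∉ Icc a' b') : χ t = 0 :=
    image_eq_zero_of_notMem_tsupport fun h => ht (hsub h)
  have hsupp : support (fun t => ∫ s in a..t, χ s) ⊆ Icc a' b' := by
    intro t ht
    by_contra hn
    refine ht ?_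
    rcases lt_or_ge t a' with h | h
    · refine (intervalIntegral.integral_congr (g := fun _ => 0) fun s hs => hz fun h' => ?_).trans
        (by simp)
      rcases mem_uIcc.1 hs with hs | hs <;> linarith [hs.1, hs.2, h'.1]
    · have h1 : b' < t := by
        by_contra h2
        exact hn ⟨h, not_lt.1 h2⟩
      have h2 : ∫ s in t..b, χ s = 0 := by
        refine (intervalIntegral.integral_congr (g := fun _ => 0) fun s hs => hz fun h' => ?_).trans
          (by simp)
        rcases mem_uIcc.1 hs with hs | hs <;> linarith [hs.1, hs.2, h'.2]
      have h3 := intervalIntegral.integral_add_adjacent_intervals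
        (hc.intervalIntegrable (μ := volume) a t) (hc.intervalIntegrable (μ := volume) t b)
      change ∫ s in a..t, χ s = 0
      linarith
  have hts : tsupport (fun t => ∫ s in a..t, χ s) ⊆ Icc a' b' :=
    closure_minimal hsupp isClosed_Icc
  refine ⟨⟨?_, ?_, fun t ht => ?_⟩, hderiv⟩
  · rw [contDiff_infty_iff_deriv]
    refine ⟨fun t => (hd t).differentiableAt, ?_⟩
    rw [hderiv]
    exact hχ.1
  · exact isCompact_Icc.of_isClosed_subset (isClosed_tsupport _) hts
  · have := hts ht
    exact ⟨ha'.trans_le this.1, this.2.trans_lt hb'⟩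

theorem integrableOn_test_mul (hf : IntegrableOn f (Ioo a b)) {ψ : ℝ → ℝ} (hc : Continuous ψ)
    (hs : HasCompactSupport ψ) : IntegrableOn (fun t => ψ t * f t) (Ioo a b) := by
  obtain ⟨C, hC⟩ := hs.exists_bound_of_continuous hc
  exact hf.bdd_mul hc.aestronglyMeasurable (Filter.Eventually.of_forall hC)

/-- The lemma of du Bois-Reymond. -/
theorem exists_ae_eq_const_of_isWeakDeriv_zero (hab : a < b) (hf : IntegrableOn f (Ioo a b))
    (h : IsWeakDeriv a b f fun _ => 0) : ∃ c, ∀ᵐ t, t ∈ Ioo a b → f t = c := by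
  obtain ⟨ψ, hψ, hψ1⟩ := exists_isTest_integral_eq_one hab
  refine ⟨∫ t in Ioo a b, ψ t * f t, ?_⟩
  set c := ∫ t in Ioo a b, ψ t * f t with hc
  have key := isOpen_Ioo.ae_eq_zero_of_integral_contDiff_smul_eq_zero (U := Ioo a b)
    (f := (Ioo a b).indicator fun t => f t - c) (μ := volume)
    (((integrable_indicator_iff measurableSet_Ioo).2 (hf.sub (integrableOn_const
      (C := c) (by simp)))).locallyIntegrable.locallyIntegrableOn _) fun φ hφ hφc hφs => ?_
  · filter_upwards [key] with t ht hmem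
    have := ht hmem
    rw [indicator_of_mem hmem, sub_eq_zero] at this
    exact this
  have hφt : IsTest a b φ := ⟨hφ, hφc, hφs⟩
  obtain ⟨k, hk⟩ : ∃ k, k = ∫ t in a..b, φ t := ⟨_, rfl⟩
  -- Subtracting `k ψ` makes the integral zero, so the difference is the derivative of a test
  -- function and can be fed into the weak equation.
  have hχ : IsTest a b (fun t => φ t - k * ψ t) := by
    refine ⟨hφ.sub (contDiff_const.mul hψ.1), hφc.sub hψ.2.1.mul_left, ?_⟩
    exact (tsupport_sub φ _).trans (union_subset hφs ((tsupport_mul_subset_right).trans hψ.2.2))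
  have hφi := hφ.continuous
  have hψi := hψ.1.continuous
  obtain ⟨h1, h2⟩ := isTest_primitive hχ (by
    rw [intervalIntegral.integral_sub (hφi.intervalIntegrable _ _)
      ((hψi.const_mul k).intervalIntegrable _ _), intervalIntegral.integral_const_mul, hψ1, hk]
    ring)
  have h3 := h _ h1
  simp only [h2, mul_zero, integral_zero, neg_zero, sub_mul, mul_assoc] at h3
  have hi1 := integrableOn_test_mul hf hφi hφc
  have hi2 := integrableOn_test_mul hf hψi hψ.2.1
  rw [integral_sub hi1 (hi2.const_mul k), integral_const_mul, ← hc] at h3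
  have e1 : ∫ t, φ t • (Ioo a b).indicator (fun t => f t - c) t =
      ∫ t in Ioo a b, (φ t * f t - c * φ t) := by
    rw [← integral_indicator measurableSet_Ioo]
    congr 1
    ext t
    by_cases ht : t ∈ Ioo a b
    · simp only [ht, indicator_of_mem, smul_eq_mul]
      ring
    · simp [ht]
  have hi3 : IntegrableOn φ (Ioo a b) :=
    (hφi.integrableOn_Icc (a := a) (b := b)).mono_set Ioo_subset_Icc_self
  rw [e1, integral_sub hi1 (hi3.const_mul c), integral_const_mul]
  rw [intervalIntegral.integral_of_le hab.le, integral_Ioc_eq_integral_Ioo] at hk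
  rw [← hk]
  linarith

/-- An absolutely continuous function is weakly differentiable. -/
theorem isWeakDeriv_of_absolutelyContinuous (hab : a ≤ b)
    (hf : AbsolutelyContinuousOnInterval f a b)
    (hg : ∀ᵐ t, t ∈ Ioo a b → HasDerivAt f (g t) t) : IsWeakDeriv a b f g := by
  intro φ hφ
  have hφac : AbsolutelyContinuousOnInterval φ a b :=
    (hφ.1.of_le (by simp)).contDiffOn.absolutelyContinuousOnInterval
  have key := hf.integral_mul_deriv_eq_deriv_mul hφac
  have h0 : φ a = 0 := image_eq_zero_of_notMem_tsupport fun h => lt_irrefl _ (hφ.2.2 h).1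
  have h1 : φ b = 0 := image_eq_zero_of_notMem_tsupport fun h => lt_irrefl _ (hφ.2.2 h).2
  rw [h0, h1, mul_zero, mul_zero, sub_zero, zero_sub, intervalIntegral.integral_of_le hab,
    intervalIntegral.integral_of_le hab, integral_Ioc_eq_integral_Ioo,
    integral_Ioc_eq_integral_Ioo] at key
  simp only [mul_comm (deriv φ _), mul_comm (φ _)]
  rw [key]
  congr 1
  refine integral_congr_ae ?_
  rw [EventuallyEq, ae_restrict_iff' measurableSet_Ioo]
  filter_upwards [hg] with t ht hmem
  rw [(ht hmem).deriv]

theorem absolutelyContinuous_primitive (hab : a ≤ b) (hg : IntegrableOn g (Ioo a b)) :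
    AbsolutelyContinuousOnInterval (fun t => ∫ s in a..t, g s) a b ∧
      ∀ᵐ t, t ∈ Ioo a b → HasDerivAt (fun t => ∫ s in a..t, g s) (g t) t := by
  have hi : IntervalIntegrable g volume a b := by
    rw [intervalIntegrable_iff_integrableOn_Ioo_of_le hab]
    exact hg
  refine ⟨hi.absolutelyContinuousOnInterval_intervalIntegral left_mem_uIcc, ?_⟩
  filter_upwards [hi.ae_hasDerivAt_integral] with t ht hmem
  refine ht ?_ a left_mem_uIcc
  rw [uIcc_of_le hab]
  exact Ioo_subset_Icc_self hmem

/-- Weakly differentiable functions are primitives of their weak derivative. -/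
theorem IsWeakDeriv.exists_ae_eq (hab : a < b) (hf : IntegrableOn f (Ioo a b))
    (hg : IntegrableOn g (Ioo a b)) (h : IsWeakDeriv a b f g) :
    ∃ c, ∀ᵐ t, t ∈ Ioo a b → f t = c + ∫ s in a..t, g s := by
  obtain ⟨hac, hd⟩ := absolutelyContinuous_primitive hab.le hg
  have hP := isWeakDeriv_of_absolutelyContinuous hab.le hac hd
  have hPi : IntegrableOn (fun t => ∫ s in a..t, g s) (Ioo a b) :=
    (hac.continuousOn.integrableOn_compact isCompact_uIcc).mono_set
      (Ioo_subset_Icc_self.trans Icc_subset_uIcc)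
  obtain ⟨c, hc⟩ := exists_ae_eq_const_of_isWeakDeriv_zero
    (f := fun t => f t - ∫ s in a..t, g s) hab (hf.sub hPi) fun φ hφ => by
      simp only [mul_sub, mul_zero, integral_zero, neg_zero]
      rw [integral_sub (integrableOn_test_mul hf hφ.deriv_cont hφ.2.1.deriv)
        (integrableOn_test_mul hPi hφ.deriv_cont hφ.2.1.deriv), h φ hφ, hP φ hφ, sub_self]
  refine ⟨c, ?_⟩
  filter_upwards [hc] with t ht hmem
  linarith [ht hmem]

/-- A continuous function with an integrable weak derivative is absolutely continuous. -/
theorem IsWeakDeriv.absolutelyContinuous (hab : a < b) (hf : IntegrableOn f (Ioo a b))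
    (hg : IntegrableOn g (Ioo a b)) (h : IsWeakDeriv a b f g) {F : ℝ → ℝ}
    (hF : ContinuousOn F (Icc a b)) (hFf : ∀ᵐ t, t ∈ Ioo a b → F t = f t) :
    AbsolutelyContinuousOnInterval F a b ∧
      (∀ t ∈ Icc a b, F t = F a + ∫ s in a..t, g s) ∧
      ∀ᵐ t, t ∈ Ioo a b → HasDerivAt F (g t) t := by
  obtain ⟨c, hc⟩ := h.exists_ae_eq hab hf hg
  obtain ⟨hac, hd⟩ := absolutelyContinuous_primitive hab.le hg
  have hcont : ContinuousOn (fun t => c + ∫ s in a..t, g s) (Icc a b) := by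
    have := hac.continuousOn
    rw [uIcc_of_le hab.le] at this
    exact continuousOn_const.add this
  have heq : EqOn F (fun t => c + ∫ s in a..t, g s) (Icc a b) := by
    refine Measure.eqOn_Icc_of_ae_eq volume hab.ne ?_ hF hcont
    rw [← restrict_Ioo_eq_restrict_Icc, EventuallyEq, ae_restrict_iff' measurableSet_Ioo]
    filter_upwards [hc, hFf] with t h1 h2 hmem
    rw [h2 hmem, h1 hmem]
  have hFa : F a = c := by
    rw [heq ⟨le_rfl, hab.le⟩]
    simp
  have heq' : ∀ t ∈ Icc a b, F t = F a + ∫ s in a..t, g s := fun t ht => by rw [heq ht, hFa]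
  refine ⟨?_, heq', ?_⟩
  · have hconst : AbsolutelyContinuousOnInterval (fun _ : ℝ => c) a b :=
      contDiffOn_const.absolutelyContinuousOnInterval
    rw [absolutelyContinuousOnInterval_iff]
    have := hconst.add hac
    rw [absolutelyContinuousOnInterval_iff] at this
    intro ε hε
    obtain ⟨δ, hδ, H⟩ := this ε hε
    refine ⟨δ, hδ, fun E hE hlt => (le_of_eq (Finset.sum_congr rfl fun i hi => ?_)).trans_lt
      (H E hE hlt)⟩
    have hm := hE.1 i hi
    rw [uIcc_of_le hab.le] at hm
    rw [heq hm.1, heq hm.2]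
    rfl
  · filter_upwards [hd] with t ht hmem
    refine ((ht hmem).const_add c).congr_of_eventuallyEq ?_
    filter_upwards [Icc_mem_nhds hmem.1 hmem.2] with s hs using heq hs

/-- Both candidates have the same pairing with every test function, and the fundamental lemma of the
calculus of variations applies. -/
theorem IsWeakDeriv.ae_eq {g' : ℝ → ℝ} (hf : IsWeakDeriv a b f g) (hh : IsWeakDeriv a b h g')
    (hg : IntegrableOn g (Ioo a b)) (hg' : IntegrableOn g' (Ioo a b))
    (hfh : ∀ᵐ t, t ∈ Ioo a b → f t = h t) : ∀ᵐ t, t ∈ Ioo a b → g t = g' t := by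
  have key := isOpen_Ioo.ae_eq_zero_of_integral_contDiff_smul_eq_zero (U := Ioo a b)
    (f := (Ioo a b).indicator fun t => g t - g' t) (μ := volume)
    (((integrable_indicator_iff measurableSet_Ioo).2
      (hg.sub hg')).locallyIntegrable.locallyIntegrableOn _) fun φ hφ hφc hφs => ?_
  · filter_upwards [key] with t ht hmem
    have := ht hmem
    rw [indicator_of_mem hmem, sub_eq_zero] at this
    exact this
  have e1 : ∫ t, φ t • (Ioo a b).indicator (fun t => g t - g' t) t =
      ∫ t in Ioo a b, (φ t * g t - φ t * g' t) := by
    rw [← integral_indicator measurableSet_Ioo]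
    congr 1
    ext t
    by_cases ht : t ∈ Ioo a b
    · simp only [ht, indicator_of_mem, smul_eq_mul]
      ring
    · simp [ht]
  have e2 : ∫ t in Ioo a b, deriv φ t * f t = ∫ t in Ioo a b, deriv φ t * h t := by
    refine integral_congr_ae ?_
    rw [EventuallyEq, ae_restrict_iff' measurableSet_Ioo]
    filter_upwards [hfh] with t ht hmem
    rw [ht hmem]
  rw [e1, integral_sub (integrableOn_test_mul hg hφ.continuous hφc)
    (integrableOn_test_mul hg' hφ.continuous hφc)]
  have h1 := hf φ ⟨hφ, hφc, hφs⟩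
  have h2 := hh φ ⟨hφ, hφc, hφs⟩
  linarith

end weak

theorem _root_.AbsolutelyContinuousOnInterval.congr_of_eqOn {f g : ℝ → ℝ} {a b : ℝ}
    (hf : AbsolutelyContinuousOnInterval f a b) (h : EqOn g f (uIcc a b)) :
    AbsolutelyContinuousOnInterval g a b := by
  rw [absolutelyContinuousOnInterval_iff] at hf ⊢
  intro ε hε
  obtain ⟨δ, hδ, H⟩ := hf ε hε
  refine ⟨δ, hδ, fun E hE hlt => (le_of_eq (Finset.sum_congr rfl fun i hi => ?_)).trans_lt
    (H E hE hlt)⟩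
  rw [h (hE.1 i hi).1, h (hE.1 i hi).2]

theorem _root_.AbsolutelyContinuousOnInterval.sub_eq_integral {f g : ℝ → ℝ} {a b : ℝ}
    (hab : a ≤ b) (hf : AbsolutelyContinuousOnInterval f a b)
    (hg : ∀ᵐ t, t ∈ Ioo a b → HasDerivAt f (g t) t) : f b - f a = ∫ t in a..b, g t := by
  rw [← hf.integral_deriv_eq_sub, intervalIntegral.integral_of_le hab,
    intervalIntegral.integral_of_le hab, integral_Ioc_eq_integral_Ioo,
    integral_Ioc_eq_integral_Ioo]
  refine setIntegral_congr_ae measurableSet_Ioo ?_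
  filter_upwards [hg] with t ht hmem using (ht hmem).deriv

/-! ### One-dimensional Sobolev embeddings. -/

section embedding

variable {a b e : ℝ} {f g : ℝ → ℝ}

theorem integral_abs_le_mul_sqrt (hab : a ≤ b) (he : 0 < e) (hg : IntervalIntegrable g volume a b)
    (hg2 : IntervalIntegrable (fun t => g t ^ 2) volume a b) (hle : ∫ t in a..b, g t ^ 2 ≤ e ^ 2) :
    ∫ t in a..b, |g t| ≤ e * √(b - a) := by
  rcases hab.eq_or_lt with rfl | hlt
  · simp
  set s := √(b - a) with hs
  have hs0 : 0 < s := Real.sqrt_pos.2 (sub_pos.2 hlt)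
  have hss : s * s = b - a := Real.mul_self_sqrt (sub_nonneg.2 hab)
  -- Cauchy–Schwarz through a weighted inequality of arithmetic and geometric means, the weight
  -- being such that each half integrates to at most `e * s / 2`.
  have h1 : ∫ t in a..b, |g t| ≤ ∫ t in a..b, (s / (2 * e) * g t ^ 2 + e / (2 * s)) := by
    refine intervalIntegral.integral_mono_on hab hg.abs
      ((hg2.const_mul _).add intervalIntegrable_const) fun t _ => ?_
    have h2 : 0 ≤ (s * |g t| - e) ^ 2 / (2 * e * s) := by positivity
    have h3 : (s * |g t| - e) ^ 2 / (2 * e * s) =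
        s / (2 * e) * |g t| ^ 2 + e / (2 * s) - |g t| := by
      field_simp
      ring
    rw [h3, sq_abs] at h2
    linarith
  refine h1.trans ?_
  rw [intervalIntegral.integral_add (hg2.const_mul _) intervalIntegrable_const,
    intervalIntegral.integral_const_mul, intervalIntegral.integral_const, ← hss, smul_eq_mul]
  calc _ ≤ s / (2 * e) * e ^ 2 + s * s * (e / (2 * s)) := by gcongr
    _ = e * s := by field_simp; ring

/-- The embedding of `H¹` in `L∞` on intervals of length one. -/
theorem abs_le_of_absolutelyContinuous (he : 0 < e)
    (hf : AbsolutelyContinuousOnInterval f a (a + 1))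
    (hd : ∀ᵐ t, t ∈ Ioo a (a + 1) → HasDerivAt f (g t) t)
    (hg : IntervalIntegrable g volume a (a + 1))
    (hg2 : IntervalIntegrable (fun t => g t ^ 2) volume a (a + 1))
    (hfle : ∫ t in a..(a + 1), f t ^ 2 ≤ e ^ 2) (hgle : ∫ t in a..(a + 1), g t ^ 2 ≤ e ^ 2)
    {t : ℝ} (ht : t ∈ Icc a (a + 1)) : |f t| ≤ 2 * e := by
  have ha : a ≤ a + 1 := by linarith
  have hcont : ContinuousOn f (uIcc a (a + 1)) := hf.continuousOn
  have h1 : ∫ t in a..(a + 1), |f t| ≤ e := by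
    simpa using integral_abs_le_mul_sqrt ha he hcont.intervalIntegrable
      (hcont.pow 2).intervalIntegrable hfle
  have h2 : ∫ t in a..(a + 1), |g t| ≤ e := by
    simpa using integral_abs_le_mul_sqrt ha he hg hg2 hgle
  have key {s r : ℝ} (hs : s ∈ Icc a (a + 1)) (hr : r ∈ Icc a (a + 1)) (hsr : s ≤ r) :
      |f r - f s| ≤ ∫ t in a..(a + 1), |g t| := by
    have hsub : uIcc s r ⊆ uIcc a (a + 1) := by
      rw [uIcc_of_le hsr, uIcc_of_le ha]
      exact Icc_subset_Icc hs.1 hr.2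
    rw [(hf.mono hsub).sub_eq_integral (g := g) hsr ?_]
    · refine (intervalIntegral.abs_integral_le_integral_abs hsr).trans ?_
      refine intervalIntegral.integral_mono_interval hs.1 hsr hr.2
        (Eventually.of_forall fun _ => abs_nonneg _) hg.abs
    · filter_upwards [hd] with t ht hmem using ht ⟨hs.1.trans_lt hmem.1, hmem.2.trans_le hr.2⟩
  have key' (s : ℝ) (hs : s ∈ Icc a (a + 1)) : |f t| ≤ |f s| + e := by
    have h3 : |f t - f s| ≤ e := by
      rcases le_total s t with h | h
      · exact (key hs ht h).trans h2
      · rw [abs_sub_comm]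
        exact (key ht hs h).trans h2
    linarith [abs_sub_abs_le_abs_sub (f t) (f s)]
  -- The bound by `|f s| + e` is averaged over `s` in the unit interval.
  have h4 : ∫ _ in a..(a + 1), |f t| ≤ ∫ s in a..(a + 1), (|f s| + e) :=
    intervalIntegral.integral_mono_on ha intervalIntegrable_const
      (hcont.abs.intervalIntegrable.add intervalIntegrable_const) key'
  rw [intervalIntegral.integral_add hcont.abs.intervalIntegrable intervalIntegrable_const] at h4
  simp only [intervalIntegral.integral_const, add_sub_cancel_left, smul_eq_mul, one_mul] at h4
  linarith

/-- The embedding of `H¹` in `C^{1/2}`, which is the reason for the exponent in `Reg`. -/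
theorem abs_sub_le_of_absolutelyContinuous {s t : ℝ} (hst : s ≤ t) (he : 0 < e)
    (hf : AbsolutelyContinuousOnInterval f s t)
    (hd : ∀ᵐ r, r ∈ Ioo s t → HasDerivAt f (g r) r) (hg : IntervalIntegrable g volume s t)
    (hg2 : IntervalIntegrable (fun t => g t ^ 2) volume s t)
    (hgle : ∫ r in s..t, g r ^ 2 ≤ e ^ 2) : |f t - f s| ≤ e * √(t - s) := by
  rw [hf.sub_eq_integral hst hd]
  exact (intervalIntegral.abs_integral_le_integral_abs hst).trans
    (integral_abs_le_mul_sqrt hst he hg hg2 hgle)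

end embedding

/-! ### Components of `L²` functions and representatives of Sobolev elements. -/

section L2

variable {a b : ℝ}

theorem memLp_apply (f : L2 a b) (i : Fin 2) :
    MemLp (fun t => f t i) 2 (volume.restrict (Ioo a b)) := by
  refine (Lp.memLp f).of_le ?_ (Eventually.of_forall fun t => PiLp.norm_apply_le _ i)
  exact ((EuclideanSpace.proj (𝕜 := ℝ) i).continuous).comp_aestronglyMeasurable (Lp.memLp f).1

theorem integrableOn_apply (f : L2 a b) (i : Fin 2) : IntegrableOn (fun t => f t i) (Ioo a b) :=
  (memLp_apply f i).integrable (by norm_num)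

theorem integrableOn_apply_sq (f : L2 a b) (i : Fin 2) :
    IntegrableOn (fun t => f t i ^ 2) (Ioo a b) := (memLp_apply f i).integrable_sq

theorem norm_sq_eq (f : L2 a b) : ‖f‖ ^ 2 = ∫ t in Ioo a b, ‖f t‖ ^ 2 := by
  rw [← real_inner_self_eq_norm_sq, L2.inner_def]
  simp only [real_inner_self_eq_norm_sq]

theorem integral_apply_sq_le (f : L2 a b) (i : Fin 2) :
    ∫ t in Ioo a b, f t i ^ 2 ≤ ‖f‖ ^ 2 := by
  rw [norm_sq_eq]
  refine integral_mono (integrableOn_apply_sq f i) (Lp.memLp f).norm.integrable_sq fun t => ?_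
  simp only
  rw [← sq_abs, ← Real.norm_eq_abs]
  gcongr
  exact PiLp.norm_apply_le _ i

theorem integral_smul_apply {ψ : ℝ → ℝ} (f : L2 a b)
    (h : Integrable (fun t => ψ t • f t) (volume.restrict (Ioo a b))) (i : Fin 2) :
    (∫ t in Ioo a b, ψ t • f t) i = ∫ t in Ioo a b, ψ t * f t i :=
  ((EuclideanSpace.proj (𝕜 := ℝ) i).integral_comp_comm h).symm

theorem hasWeakDeriv_iff {f g : L2 a b} : HasWeakDeriv a b f g ↔
    ∀ i : Fin 2, IsWeakDeriv a b (fun t => f t i) (fun t => g t i) := by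
  have e1 {φ : ℝ → ℝ} (hφ : IsTest a b φ) := integral_smul_apply f
    (integrable_test_smul f hφ.deriv_cont hφ.2.1.deriv)
  have e2 {φ : ℝ → ℝ} (hφ : IsTest a b φ) := integral_smul_apply g
    (integrable_test_smul g hφ.1.continuous hφ.2.1)
  constructor
  · intro h i φ hφ
    rw [← e1 hφ, ← e2 hφ, h φ hφ]
    rfl
  · intro h φ hφ
    ext i
    rw [e1 hφ, h i φ hφ, ← e2 hφ]
    rfl

theorem ext_of_ae {f g : L2 a b} (h : ∀ i : Fin 2, ∀ᵐ t, t ∈ Ioo a b → f t i = g t i) : f = g := by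
  refine Lp.ext ?_
  rw [EventuallyEq, ae_restrict_iff' measurableSet_Ioo]
  filter_upwards [h 0, h 1] with t h0 h1 hmem
  ext i
  fin_cases i
  exacts [h0 hmem, h1 hmem]

theorem HasWeakDeriv.unique {f g g' : L2 a b} (h : HasWeakDeriv a b f g)
    (h' : HasWeakDeriv a b f g') : g = g' :=
  ext_of_ae fun i => (hasWeakDeriv_iff.1 h i).ae_eq (hasWeakDeriv_iff.1 h' i)
    (integrableOn_apply g i) (integrableOn_apply g' i) (Eventually.of_forall fun _ _ => rfl)

theorem norm_wderiv_le {k : ℕ} (u : Sobolev a b k) (j : Fin (k + 1)) : ‖wderiv u j‖ ≤ ‖u‖ :=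
  PiLp.norm_apply_le u.1 j

theorem norm_le_sum {k : ℕ} (u : Sobolev a b k) : ‖u‖ ≤ ∑ j, ‖wderiv u j‖ := by
  have h : ‖u‖ = √(∑ j, ‖wderiv u j‖ ^ 2) := PiLp.norm_eq_of_L2 u.1
  rw [h]
  refine Real.sqrt_le_iff.2 ⟨Finset.sum_nonneg fun _ _ => norm_nonneg _, ?_⟩
  exact Finset.sum_sq_le_sq_sum_of_nonneg fun _ _ => norm_nonneg _

theorem Represents.ae_eq {k : ℕ} {f : ℝ → Plane} {u : Sobolev a b k} (h : Represents f u)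
    (i : Fin 2) : ∀ᵐ t, t ∈ Ioo a b → f t i = wderiv u 0 t i := by
  rw [Represents, EventuallyEq, ae_restrict_iff' measurableSet_Ioo] at h
  filter_upwards [h] with t ht hmem
  rw [ht hmem]

/-- The continuous representative of an element of `H²` is of class `C¹`, with absolutely
continuous derivative. -/
theorem Represents.exists_deriv (hab : a < b) {f : ℝ → Plane} {u : Sobolev a b 2}
    (h : Represents f u) (hf : Continuous f) (i : Fin 2) :
    ∃ P : ℝ → ℝ, AbsolutelyContinuousOnInterval P a b ∧
      (∀ t ∈ Ioo a b, HasDerivAt (fun t => f t i) (P t) t) ∧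
      (∀ᵐ t, t ∈ Ioo a b → P t = wderiv u 1 t i) ∧
      ∀ᵐ t, t ∈ Ioo a b → HasDerivAt P (wderiv u 2 t i) t := by
  have h01 : IsWeakDeriv a b (fun t => wderiv u 0 t i) (fun t => wderiv u 1 t i) :=
    hasWeakDeriv_iff.1 (u.2 0) i
  have h12 : IsWeakDeriv a b (fun t => wderiv u 1 t i) (fun t => wderiv u 2 t i) :=
    hasWeakDeriv_iff.1 (u.2 1) i
  have hint (j : Fin 3) := integrableOn_apply (wderiv u j) i
  obtain ⟨c, hc⟩ := h12.exists_ae_eq hab (hint 1) (hint 2)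
  obtain ⟨hac, hd⟩ := absolutelyContinuous_primitive hab.le (hint 2)
  have hconst : AbsolutelyContinuousOnInterval (fun _ : ℝ => c) a b :=
    contDiffOn_const.absolutelyContinuousOnInterval
  -- The continuous version of the first weak derivative, as a primitive of the second.
  set P : ℝ → ℝ := fun t => c + ∫ s in a..t, wderiv u 2 s i with hP
  have hPac : AbsolutelyContinuousOnInterval P a b := hconst.add hac
  have hPc := hPac.continuousOn
  rw [uIcc_of_le hab.le] at hPc
  have hfi : Continuous fun t => f t i := (EuclideanSpace.proj (𝕜 := ℝ) i).continuous.comp hf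
  obtain ⟨-, hF, -⟩ := h01.absolutelyContinuous hab (hint 0) (hint 1) (F := fun t => f t i)
    hfi.continuousOn (h.ae_eq i)
  refine ⟨P, hPac, fun t ht => ?_, ?_, ?_⟩
  · have hPi : IntervalIntegrable P volume a t := by
      refine ContinuousOn.intervalIntegrable (hPc.mono ?_)
      rw [uIcc_of_le ht.1.le]
      exact Icc_subset_Icc_right ht.2.le
    have h1 : HasDerivAt (fun t => f a i + ∫ s in a..t, P s) (P t) t :=
      (intervalIntegral.integral_hasDerivAt_right hPi
        ((hPc.mono Ioo_subset_Icc_self).stronglyMeasurableAtFilter isOpen_Ioo t ht)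
        (hPc.continuousAt (Icc_mem_nhds ht.1 ht.2))).const_add _
    refine h1.congr_of_eventuallyEq ?_
    filter_upwards [Icc_mem_nhds ht.1 ht.2] with s hs
    rw [hF s hs]
    congr 1
    rw [intervalIntegral.integral_of_le hs.1, intervalIntegral.integral_of_le hs.1]
    refine setIntegral_congr_ae measurableSet_Ioc ?_
    have hne : ∀ᵐ x : ℝ, x ≠ b := by simp [ae_iff, measure_singleton]
    filter_upwards [hc, hne] with r hr hrb hmem
    refine hr ⟨hmem.1, lt_of_le_of_ne (hmem.2.trans hs.2) hrb⟩
  · filter_upwards [hc] with t ht hmem using (ht hmem).symm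
  · filter_upwards [hd] with t ht hmem using (ht hmem).const_add c

end L2

/-! ### Regularity of the data. -/

section data

variable {T₀ ε : ℝ} {m₀ : ℝ → Plane}

theorem hasDerivAt_of_locally (hc : Continuous m₀)
    (hloc : ∀ b c : ℝ, ∃ v : Sobolev b c 2, Represents m₀ v) (i : Fin 2) (t : ℝ) :
    HasDerivAt (fun t => m₀ t i) (deriv (fun t => m₀ t i) t) t := by
  obtain ⟨v, hv⟩ := hloc (t - 1) (t + 1)
  obtain ⟨P, -, hd, -, -⟩ := hv.exists_deriv (by linarith) hc i
  exact (hd t ⟨by linarith, by linarith⟩).differentiableAt.hasDerivAt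

theorem absolutelyContinuous_deriv_of_locally (hc : Continuous m₀)
    (hloc : ∀ b c : ℝ, ∃ v : Sobolev b c 2, Represents m₀ v) (i : Fin 2) (a c : ℝ) :
    AbsolutelyContinuousOnInterval (deriv fun t => m₀ t i) a c := by
  obtain ⟨v, hv⟩ := hloc (min a c - 1) (max a c + 1)
  have hlt : min a c - 1 < max a c + 1 := by linarith [min_le_max (a := a) (b := c)]
  obtain ⟨P, hP, hd, -, -⟩ := hv.exists_deriv hlt hc i
  have hsub : uIcc a c ⊆ Ioo (min a c - 1) (max a c + 1) := fun t ht =>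
    ⟨by linarith [ht.1], by linarith [ht.2]⟩
  refine (hP.mono (hsub.trans (Ioo_subset_Icc_self.trans Icc_subset_uIcc))).congr_of_eqOn
    fun t ht => (hd t (hsub ht)).deriv

theorem ae_eq_wderiv (hc : Continuous m₀) {b c : ℝ} (hbc : b < c) {v : Sobolev b c 2}
    (hv : Represents m₀ v) (i : Fin 2) :
    ∀ᵐ t, t ∈ Ioo b c → m₀ t i = wderiv v 0 t i ∧ deriv (fun t => m₀ t i) t = wderiv v 1 t i ∧
      HasDerivAt (deriv fun t => m₀ t i) (wderiv v 2 t i) t := by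
  obtain ⟨P, -, hd, h1, h2⟩ := hv.exists_deriv hbc hc i
  filter_upwards [hv.ae_eq i, h1, h2] with t ht0 ht1 ht2 hmem
  refine ⟨ht0 hmem, ?_, (ht2 hmem).congr_of_eventuallyEq ?_⟩
  · rw [(hd t hmem).deriv, ht1 hmem]
  · filter_upwards [Ioo_mem_nhds hmem.1 hmem.2] with s hs using (hd s hs).deriv

theorem setIntegral_sq_le {b c : ℝ} {f : ℝ → ℝ} (v : L2 b c) (i : Fin 2) (hbc : b ≤ c)
    (h : ∀ᵐ t, t ∈ Ioo b c → f t = v t i) (hv : ‖v‖ ≤ ε) :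
    ∫ t in b..c, f t ^ 2 ≤ ε ^ 2 := by
  rw [intervalIntegral.integral_of_le hbc, integral_Ioc_eq_integral_Ioo]
  calc _ = ∫ t in Ioo b c, v t i ^ 2 := by
        refine setIntegral_congr_ae measurableSet_Ioo ?_
        filter_upwards [h] with t ht hmem
        rw [ht hmem]
    _ ≤ ‖v‖ ^ 2 := integral_apply_sq_le v i
    _ ≤ ε ^ 2 := by gcongr

theorem memLp_deriv_deriv (hc : Continuous m₀)
    (hloc : ∀ b c : ℝ, ∃ v : Sobolev b c 2, Represents m₀ v) (i : Fin 2) (b c : ℝ) :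
    MemLp (deriv (deriv fun t => m₀ t i)) 2 (volume.restrict (Ioo b c)) := by
  rcases lt_or_ge b c with h | h
  · obtain ⟨v, hv⟩ := hloc b c
    refine (memLp_apply (wderiv v 2) i).ae_eq ?_
    rw [EventuallyEq, ae_restrict_iff' measurableSet_Ioo]
    filter_upwards [ae_eq_wderiv hc h hv i] with t ht hmem using (ht hmem).2.2.deriv.symm
  · simp [Ioo_eq_empty_of_le h]

theorem memLp_two_intervalIntegrable {b c : ℝ} {f : ℝ → ℝ} (hbc : b ≤ c)
    (h : MemLp f 2 (volume.restrict (Ioo b c))) :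
    IntervalIntegrable f volume b c ∧ IntervalIntegrable (fun t => f t ^ 2) volume b c := by
  rw [intervalIntegrable_iff_integrableOn_Ioo_of_le hbc,
    intervalIntegrable_iff_integrableOn_Ioo_of_le hbc]
  exact ⟨h.integrable (by norm_num), h.integrable_sq⟩

theorem _root_.Function.Periodic.deriv' {f : ℝ → ℝ} (hf : ∀ t, f (t + 1) = f t) (t : ℝ) :
    deriv f (t + 1) = deriv f t := by
  rw [← deriv_comp_add_const, funext hf]

/-- The data of class `H²` are of class `C^{1,1/2}`, with absolutely continuous derivative. -/
theorem reg_of_represents (hper : ∀ t, m₀ (t + 1) = m₀ t) (hc : Continuous m₀)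
    (hloc : ∀ b c : ℝ, ∃ v : Sobolev b c 2, Represents m₀ v) {M₀ : Sobolev T₀ (T₀ + 1) 2}
    (hM : Represents m₀ M₀) (hε : 0 < ε) (hle : ‖M₀‖ ≤ ε) (i : Fin 2) :
    Reg (4 * ε) (fun t => m₀ t i) (deriv fun t => m₀ t i) ∧
      ∫ t in T₀..(T₀ + 1), deriv (deriv fun t => m₀ t i) t ^ 2 ≤ ε ^ 2 := by
  set f : ℝ → ℝ := fun t => m₀ t i with hf
  have hTT : T₀ ≤ T₀ + 1 := by linarith
  have hfper (t : ℝ) : f (t + 1) = f t := by simp only [hf, hper]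
  have hf'per := Function.Periodic.deriv' hfper
  have hf''per := Function.Periodic.deriv' hf'per
  have hd : ∀ t, HasDerivAt f (deriv f t) t := hasDerivAt_of_locally hc hloc i
  have hac : ∀ a c, AbsolutelyContinuousOnInterval (deriv f) a c :=
    absolutelyContinuous_deriv_of_locally hc hloc i
  have hdd : ∀ᵐ t, HasDerivAt (deriv f) (deriv (deriv f) t) t := by
    filter_upwards [ae_differentiableAt_of_absolutelyContinuous hac] with t ht using ht.hasDerivAt
  have hf'c : Continuous (deriv f) := continuous_iff_continuousAt.2 fun t => by
    refine (hac (t - 1) (t + 1)).continuousOn.continuousAt ?_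
    rw [uIcc_of_le (by linarith)]
    exact Icc_mem_nhds (by linarith) (by linarith)
  have hfac (a c : ℝ) : AbsolutelyContinuousOnInterval f a c := by
    refine ContDiffOn.absolutelyContinuousOnInterval (ContDiff.contDiffOn ?_)
    exact contDiff_one_iff_deriv.2 ⟨fun t => (hd t).differentiableAt, hf'c⟩
  have hae := ae_eq_wderiv hc (by linarith) hM i
  -- Periodicity moves the bounds from `(T₀, T₀ + 1)` to every interval of length one.
  have hint {g : ℝ → ℝ} (hg : ∀ t, g (t + 1) = g t) (hg2 : ∫ t in T₀..(T₀ + 1), g t ^ 2 ≤ ε ^ 2)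
      (t : ℝ) : ∫ t in t..(t + 1), g t ^ 2 ≤ ε ^ 2 := by
    have hp : Periodic (fun t => g t ^ 2) 1 := fun t => by simp only [hg]
    rwa [hp.intervalIntegral_add_eq t T₀]
  have h0 : ∫ t in T₀..(T₀ + 1), f t ^ 2 ≤ ε ^ 2 := by
    refine setIntegral_sq_le (wderiv M₀ 0) i hTT ?_ ((norm_wderiv_le M₀ 0).trans hle)
    filter_upwards [hae] with t ht hmem using (ht hmem).1
  have h1 : ∫ t in T₀..(T₀ + 1), deriv f t ^ 2 ≤ ε ^ 2 := by
    refine setIntegral_sq_le (wderiv M₀ 1) i hTT ?_ ((norm_wderiv_le M₀ 1).trans hle)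
    filter_upwards [hae] with t ht hmem using (ht hmem).2.1
  have h2 : ∫ t in T₀..(T₀ + 1), deriv (deriv f) t ^ 2 ≤ ε ^ 2 := by
    refine setIntegral_sq_le (wderiv M₀ 2) i hTT ?_ ((norm_wderiv_le M₀ 2).trans hle)
    filter_upwards [hae] with t ht hmem using (ht hmem).2.2.deriv
  have hii {a c : ℝ} (hac : a ≤ c) :=
    memLp_two_intervalIntegrable hac (memLp_deriv_deriv hc hloc i a c)
  have hb (t : ℝ) : |f t| ≤ 2 * ε := abs_le_of_absolutelyContinuous hε (hfac t (t + 1))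
    (Eventually.of_forall fun t _ => hd t) (hf'c.intervalIntegrable _ _)
    ((hf'c.pow 2).intervalIntegrable _ _) (hint hfper h0 t) (hint hf'per h1 t)
    ⟨le_rfl, by linarith⟩
  have hb' (t : ℝ) : |deriv f t| ≤ 2 * ε := abs_le_of_absolutelyContinuous hε (hac t (t + 1))
    (hdd.mono fun t ht _ => ht) (hii (by linarith)).1 (hii (by linarith)).2 (hint hf'per h1 t)
    (hint hf''per h2 t) ⟨le_rfl, by linarith⟩
  -- Within distance one the embedding gives the constant `ε`. Beyond it the two sup bounds `2 * ε`
  -- are used, and this is where the factor `4` comes from.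
  have hh {s t : ℝ} (hst : s ≤ t) : |deriv f t - deriv f s| ≤ 4 * ε * √(t - s) := by
    rcases le_total (t - s) 1 with h | h
    · have h3 : ∫ r in s..t, deriv (deriv f) r ^ 2 ≤ ε ^ 2 :=
        (intervalIntegral.integral_mono_interval le_rfl hst (by linarith)
          (Eventually.of_forall fun _ => sq_nonneg _) (hii (by linarith)).2).trans
          (hint hf''per h2 s)
      refine (abs_sub_le_of_absolutelyContinuous hst hε (hac s t) (hdd.mono fun t ht _ => ht)
        (hii hst).1 (hii hst).2 h3).trans ?_
      gcongr
      linarith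
    · have h3 : 1 ≤ √(t - s) := Real.one_le_sqrt.2 h
      have h4 := abs_sub (deriv f t) (deriv f s)
      nlinarith [hb' t, hb' s]
  refine ⟨⟨hd, fun t => (hb t).trans (by linarith), fun t => (hb' t).trans (by linarith),
    fun t s => ?_⟩, h2⟩
  rcases le_total s t with h | h
  · rw [abs_of_nonneg (sub_nonneg.2 h)]
    exact hh h
  · rw [abs_sub_comm, abs_sub_comm t, abs_of_nonneg (sub_nonneg.2 h)]
    exact hh h

end data

/-! ### Continuous curves in `L²` and transport along the flow. -/

/-- The function with values in the plane with given components. -/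
def plane (f : Fin 2 → ℝ → ℝ) (t : ℝ) : Plane := WithLp.toLp 2 fun i => f i t

theorem norm_plane_le (f : Fin 2 → ℝ → ℝ) (t : ℝ) : ‖plane f t‖ ≤ |f 0 t| + |f 1 t| := by
  rw [EuclideanSpace.norm_eq, Fin.sum_univ_two]
  refine Real.sqrt_le_iff.2 ⟨by positivity, ?_⟩
  simp only [plane, Real.norm_eq_abs]
  nlinarith [mul_nonneg (abs_nonneg (f 0 t)) (abs_nonneg (f 1 t))]

theorem continuous_plane {X : Type*} [TopologicalSpace X] {f : Fin 2 → X → ℝ → ℝ}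
    (hf : ∀ i, Continuous (uncurry (f i))) :
    Continuous (uncurry fun x => plane fun i => f i x) :=
  (PiLp.continuous_toLp 2 _).comp (continuous_pi fun i => hf i)

/-- The class in `L²` of a square integrable function (and zero otherwise). -/
def lp (a b : ℝ) (f : ℝ → Plane) : L2 a b :=
  open Classical in if h : MemLp f 2 (volume.restrict (Ioo a b)) then h.toLp f else 0

section lp

variable {a b : ℝ}

theorem coeFn_lp {f : ℝ → Plane} (h : MemLp f 2 (volume.restrict (Ioo a b))) :
    lp a b f =ᵐ[volume.restrict (Ioo a b)] f := by
  rw [lp, dif_pos h]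
  exact h.coeFn_toLp

theorem ae_lp_apply {f : ℝ → Plane} (h : MemLp f 2 (volume.restrict (Ioo a b))) :
    ∀ᵐ t, t ∈ Ioo a b → lp a b f t = f t := by
  rw [← ae_restrict_iff' measurableSet_Ioo]
  exact coeFn_lp h

theorem memLp_of_continuous {E : Type*} [NormedAddCommGroup E] [NormedSpace ℝ E] {f : ℝ → E}
    (hf : Continuous f) : MemLp f 2 (volume.restrict (Ioo a b)) := by
  obtain ⟨C, hC⟩ := (isCompact_Icc (a := a) (b := b)).exists_bound_of_continuousOn hf.continuousOn
  refine MemLp.of_bound hf.aestronglyMeasurable C ?_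
  rw [ae_restrict_iff' measurableSet_Ioo]
  exact Eventually.of_forall fun t ht => hC t (Ioo_subset_Icc_self ht)

/-- The extension of continuous functions on `[a, b]` by constants. -/
def extendIcc (hab : a ≤ b) : C(Icc a b, Plane) →L[ℝ] BoundedContinuousFunction ℝ Plane :=
  LinearMap.mkContinuous
    ({ toFun := fun f => (BoundedContinuousFunction.mkOfCompact f).compContinuous
          ⟨projIcc a b hab, continuous_projIcc⟩
       map_add' := fun _ _ => rfl
       map_smul' := fun _ _ => rfl } : C(Icc a b, Plane) →ₗ[ℝ] BoundedContinuousFunction ℝ Plane)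
    1 fun f => by
      rw [one_mul]
      refine (BoundedContinuousFunction.norm_le (norm_nonneg f)).2 fun t => ?_
      exact f.norm_coe_le_norm _

theorem extendIcc_apply (hab : a ≤ b) (f : C(Icc a b, Plane)) (t : ℝ) :
    extendIcc hab f t = f (projIcc a b hab t) := rfl

/-- The passage from continuous functions on `[a, b]` to their classes in `L²`. -/
def iccLp (hab : a ≤ b) : C(Icc a b, Plane) →L[ℝ] L2 a b :=
  (BoundedContinuousFunction.toLp 2 (volume.restrict (Ioo a b)) ℝ).comp (extendIcc hab)

/-- The class in `L²` factors through `C([a, b])` by a bounded operator, so continuity and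
integration of curves can be treated uniformly in `t`. -/
theorem lp_eq_iccLp (hab : a ≤ b) {f : ℝ → Plane} (hf : Continuous f) :
    lp a b f = iccLp hab ⟨fun t => f t, hf.comp continuous_subtype_val⟩ := by
  refine Lp.ext ((coeFn_lp (memLp_of_continuous hf)).trans ?_)
  rw [iccLp, ContinuousLinearMap.comp_apply]
  refine EventuallyEq.trans ?_ (BoundedContinuousFunction.coeFn_toLp 2 _ ℝ _).symm
  rw [EventuallyEq, ae_restrict_iff' measurableSet_Ioo]
  refine Eventually.of_forall fun t ht => ?_
  rw [extendIcc_apply, projIcc_of_mem hab (Ioo_subset_Icc_self ht)]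
  rfl

theorem continuous_lp (hab : a ≤ b) {F : ℝ → ℝ → Plane} (hF : Continuous (uncurry F)) :
    Continuous fun x => lp a b (F x) := by
  have h (x : ℝ) : Continuous (F x) := hF.comp (by fun_prop : Continuous fun t => (x, t))
  simp only [lp_eq_iccLp hab (h _)]
  refine (iccLp hab).continuous.comp ?_
  exact (ContinuousMap.curry ⟨fun y : ℝ × Icc a b => F y.1 y.2, hF.comp
    (continuous_fst.prodMk (continuous_subtype_val.comp continuous_snd))⟩).continuous

/-- The fundamental theorem of calculus in `x` holds for each `t`. Evaluation at `t` lifts it to a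
vector-valued integral in `C([a, b])`, which `iccLp` maps to `L²`. -/
theorem lp_sub_lp (hab : a ≤ b) {L : ℝ} {F Fx : ℝ → ℝ → Plane} (hF : Continuous (uncurry F))
    (hFx : Continuous (uncurry Fx))
    (hd : ∀ t, ∀ x ∈ Ioo 0 L, HasDerivAt (fun x => F x t) (Fx x t) x) {x : ℝ} (hx : x ∈ Icc 0 L) :
    lp a b (F x) - lp a b (F 0) = ∫ y in (0 : ℝ)..x, lp a b (Fx y) := by
  have h {G : ℝ → ℝ → Plane} (hG : Continuous (uncurry G)) (x : ℝ) : Continuous (G x) :=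
    hG.comp (by fun_prop : Continuous fun t => (x, t))
  have hc : Continuous fun y : ℝ => (⟨fun t => Fx y t, (h hFx y).comp continuous_subtype_val⟩ :
      C(Icc a b, Plane)) :=
    (ContinuousMap.curry ⟨fun y : ℝ × Icc a b => Fx y.1 y.2, hFx.comp
      (continuous_fst.prodMk (continuous_subtype_val.comp continuous_snd))⟩).continuous
  simp only [lp_eq_iccLp hab (h hF _), lp_eq_iccLp hab (h hFx _)]
  rw [(iccLp hab).intervalIntegral_comp_comm (hc.intervalIntegrable _ _), ← map_sub]
  congr 1
  ext1 t
  have h1 := (ContinuousMap.evalCLM ℝ t : C(Icc a b, Plane) →L[ℝ] Plane).intervalIntegral_comp_comm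
    (hc.intervalIntegrable (μ := volume) 0 x)
  have h2 : ∫ y in (0 : ℝ)..x, Fx y t = F x t - F 0 t := by
    refine intervalIntegral.integral_eq_sub_of_hasDerivAt_of_le (f := fun y => F y t) hx.1
      (hF.comp (by fun_prop : Continuous fun x => (x, (t : ℝ)))).continuousOn
      (fun y hy => hd t y ⟨hy.1, hy.2.trans_le hx.2⟩)
      ((hFx.comp (by fun_prop : Continuous fun x => (x, (t : ℝ)))).intervalIntegrable _ _)
  exact h2.symm.trans h1

theorem norm_lp_eq {f : ℝ → Plane} (h : MemLp f 2 (volume.restrict (Ioo a b))) :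
    ‖lp a b f‖ = (eLpNorm f 2 (volume.restrict (Ioo a b))).toReal := by
  rw [Lp.norm_def, eLpNorm_congr_ae (coeFn_lp h)]

end lp

theorem eLpNorm_le_of_bound {T C : ℝ} {f : ℝ → ℝ} (hC : ∀ t, |f t| ≤ C) :
    eLpNorm f 2 (volume.restrict (Ioo T (T + 1))) ≤ ENNReal.ofReal C := by
  refine (eLpNorm_le_of_ae_bound (Eventually.of_forall hC)).trans (le_of_eq ?_)
  simp

theorem eLpNorm_plane_le {μ : Measure ℝ} {f : Fin 2 → ℝ → ℝ}
    (hf : ∀ i, AEStronglyMeasurable (f i) μ) :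
    eLpNorm (plane f) 2 μ ≤ eLpNorm (f 0) 2 μ + eLpNorm (f 1) 2 μ := by
  refine (eLpNorm_mono (g := fun t => ‖f 0 t‖ + ‖f 1 t‖) fun t => ?_).trans
    ((eLpNorm_add_le (hf 0).norm (hf 1).norm (by norm_num)).trans ?_)
  · refine (norm_plane_le f t).trans ?_
    exact le_abs_self _
  · rw [eLpNorm_norm, eLpNorm_norm]

theorem aestronglyMeasurable_plane {μ : Measure ℝ} {f : Fin 2 → ℝ → ℝ}
    (hf : ∀ i, Measurable (f i)) : AEStronglyMeasurable (plane f) μ :=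
  ((PiLp.continuous_toLp 2 _).measurable.comp (measurable_pi_lambda _ hf)).aestronglyMeasurable

/-- Change of variables along the characteristics. -/
theorem IsField.eLpNorm_comp_flow_le {b bt : ℝ → ℝ → ℝ} {B L T : ℝ} (hb : IsField b bt B)
    (h : ℝ → ℝ) {x : ℝ} (hx : x ∈ Icc 0 L) :
    eLpNorm (fun t => h (flow b x t 0)) 2 (volume.restrict (Ioo T (T + 1))) ≤
      ENNReal.ofReal (Real.exp (B * L)) *
        eLpNorm h 2 (volume.restrict (Ioo (T - B * L) (T + 1 + B * L))) := by
  have hB := hb.nonneg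
  set J := ENNReal.ofReal (Real.exp (B * L)) with hJ
  have hL : 0 ≤ L := hx.1.trans hx.2
  have hJ1 : 1 ≤ J := by
    rw [hJ, ← ENNReal.ofReal_one]
    exact ENNReal.ofReal_le_ofReal (Real.one_le_exp (by positivity))
  have hinj : InjOn (fun t => flow b x t 0) (Ioo T (T + 1)) := fun s _ t _ hst => by
    have := congrArg (fun r => flow b 0 r x) hst
    simpa only [hb.flow_flow, hb.flow_self] using this
  have himg := lintegral_image_eq_lintegral_abs_deriv_mul (s := Ioo T (T + 1)) measurableSet_Ioo
    (fun t _ => (hb.hasDerivAt_flow_left x t 0).hasDerivWithinAt) hinj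
    (fun s => ‖h s‖ₑ ^ (2 : ℝ≥0∞).toReal)
  -- The speed is at most `B`, so on the way to its foot a characteristic moves by at most `B * L`.
  have hsub : (fun t => flow b x t 0) '' Ioo T (T + 1) ⊆
      Ioo (T - B * L) (T + 1 + B * L) := by
    rintro _ ⟨t, ht, rfl⟩
    have h1 := abs_le.1 (hb.abs_flow_sub_le x t x 0)
    rw [hb.flow_self, sub_zero, abs_of_nonneg hx.1] at h1
    have h2 : B * x ≤ B * L := mul_le_mul_of_nonneg_left hx.2 hB
    simp only
    constructor <;> linarith [ht.1, ht.2, h1.1, h1.2]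
  have key : ∫⁻ t in Ioo T (T + 1), ‖h (flow b x t 0)‖ₑ ^ (2 : ℝ≥0∞).toReal ≤
      J * ∫⁻ s in Ioo (T - B * L) (T + 1 + B * L), ‖h s‖ₑ ^ (2 : ℝ≥0∞).toReal := by
    refine le_trans ?_ (mul_le_mul_right (lintegral_mono_set hsub) J)
    rw [himg, hJ, ← lintegral_const_mul' _ _ ENNReal.ofReal_ne_top]
    refine lintegral_mono fun t => ?_
    simp only
    rw [← mul_assoc]
    refine le_mul_of_one_le_left zero_le ?_
    rw [← ENNReal.ofReal_mul (Real.exp_pos _).le, ← ENNReal.ofReal_one]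
    refine ENNReal.ofReal_le_ofReal ?_
    rw [abs_of_pos (IsField.flowDeriv_pos _ _ _ _ _)]
    calc (1 : ℝ) = Real.exp (B * L) * Real.exp (-(B * L)) := by rw [← Real.exp_add]; simp
      _ ≤ Real.exp (B * L) * flowDeriv b bt x t 0 := by
          gcongr
          refine le_trans (Real.exp_le_exp.2 (neg_le_neg ?_)) (hb.le_flowDeriv x t 0)
          rw [zero_sub, abs_neg, abs_of_nonneg hx.1]
          exact mul_le_mul_of_nonneg_left hx.2 hB
  rw [eLpNorm_eq_lintegral_rpow_enorm_toReal (by norm_num) (by norm_num),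
    eLpNorm_eq_lintegral_rpow_enorm_toReal (by norm_num) (by norm_num)]
  refine (ENNReal.rpow_le_rpow key (by norm_num)).trans ?_
  rw [ENNReal.mul_rpow_of_nonneg _ _ (by norm_num)]
  gcongr
  -- The factor obtained is the square root of `J`, which is at most `J` as `1 ≤ J`.
  refine (ENNReal.rpow_le_rpow_of_exponent_le hJ1 (y := 1 / (2 : ℝ≥0∞).toReal) (z := 1)
    (by norm_num)).trans ?_
  rw [ENNReal.rpow_one]

/-- A function of the form `c₀ + c₁ g ∘ θ`, where `θ` is the foot of a characteristic. -/
def transported (b c₀ c₁ : ℝ → ℝ → ℝ) (g : ℝ → ℝ) (x t : ℝ) : ℝ :=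
  c₀ x t + c₁ x t * g (flow b x t 0)

section transported

variable {B L T d₀ d₁ e : ℝ} {b bt c₀ c₁ : Fin 2 → ℝ → ℝ → ℝ} {g : Fin 2 → ℝ → ℝ}

theorem measurable_transported (hb : ∀ i, IsField (b i) (bt i) B)
    (hc₀ : ∀ i, Continuous (uncurry (c₀ i))) (hc₁ : ∀ i, Continuous (uncurry (c₁ i)))
    (hg : ∀ i, Measurable (g i)) (i : Fin 2) (x : ℝ) :
    Measurable (transported (b i) (c₀ i) (c₁ i) (g i) x) := by
  have hx : Continuous fun t : ℝ => (x, t) := by fun_prop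
  refine ((hc₀ i).comp hx).measurable.add (((hc₁ i).comp hx).measurable.mul ((hg i).comp ?_))
  exact ((hb i).continuous_flow_comp continuous_const continuous_id continuous_const).measurable

theorem eLpNorm_mul_comp_flow_le (hb : ∀ i, IsField (b i) (bt i) B)
    (h₁ : ∀ i, ∀ x ∈ Icc 0 L, ∀ t, |c₁ i x t| ≤ d₁) {E : ℝ≥0∞} {h : ℝ → ℝ}
    (hE : eLpNorm h 2 (volume.restrict (Ioo (T - B * L) (T + 1 + B * L))) ≤ E) (i : Fin 2)
    {x : ℝ} (hx : x ∈ Icc 0 L) :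
    eLpNorm (fun t => c₁ i x t * h (flow (b i) x t 0)) 2 (volume.restrict (Ioo T (T + 1))) ≤
      ENNReal.ofReal (d₁ * Real.exp (B * L)) * E := by
  have hd₁ : 0 ≤ d₁ := (abs_nonneg _).trans (h₁ i x hx 0)
  rw [ENNReal.ofReal_mul hd₁, mul_assoc]
  refine (eLpNorm_le_mul_eLpNorm_of_ae_le_mul (g := fun t => h (flow (b i) x t 0)) (c := d₁)
    (Eventually.of_forall fun t => ?_) 2).trans ?_
  · rw [norm_mul]
    exact mul_le_mul_of_nonneg_right (h₁ i x hx t) (norm_nonneg _)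
  · gcongr
    exact ((hb i).eLpNorm_comp_flow_le h hx).trans (by gcongr)

theorem eLpNorm_plane_transported_le (hb : ∀ i, IsField (b i) (bt i) B)
    (hc₀ : ∀ i, Continuous (uncurry (c₀ i))) (hc₁ : ∀ i, Continuous (uncurry (c₁ i)))
    (h₀ : ∀ i, ∀ x ∈ Icc 0 L, ∀ t, |c₀ i x t| ≤ d₀) (h₁ : ∀ i, ∀ x ∈ Icc 0 L, ∀ t, |c₁ i x t| ≤ d₁)
    (hg : ∀ i, Measurable (g i)) (he : 0 ≤ e)
    (hge : ∀ i, eLpNorm (g i) 2 (volume.restrict (Ioo (T - B * L) (T + 1 + B * L))) ≤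
      ENNReal.ofReal e) {x : ℝ} (hx : x ∈ Icc 0 L) :
    eLpNorm (plane fun i => transported (b i) (c₀ i) (c₁ i) (g i) x) 2
      (volume.restrict (Ioo T (T + 1))) ≤
      ENNReal.ofReal (2 * (d₀ + d₁ * Real.exp (B * L) * e)) := by
  have hd₀ : 0 ≤ d₀ := (abs_nonneg _).trans (h₀ 0 x hx 0)
  have hd₁ : 0 ≤ d₁ := (abs_nonneg _).trans (h₁ 0 x hx 0)
  have key (i : Fin 2) : eLpNorm (transported (b i) (c₀ i) (c₁ i) (g i) x) 2
      (volume.restrict (Ioo T (T + 1))) ≤ ENNReal.ofReal (d₀ + d₁ * Real.exp (B * L) * e) := by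
    have hc : Continuous fun t : ℝ => (x, t) := by fun_prop
    have hf := (hb i).continuous_flow_comp (x := fun _ : ℝ => x) continuous_const continuous_id
      (y := fun _ => 0) continuous_const
    refine (eLpNorm_add_le ((hc₀ i).comp hc).aestronglyMeasurable
      (((hc₁ i).comp hc).measurable.mul
        ((hg i).comp hf.measurable)).aestronglyMeasurable (by norm_num)).trans ?_
    rw [ENNReal.ofReal_add hd₀ (by positivity), ENNReal.ofReal_mul (by positivity)]
    exact add_le_add (eLpNorm_le_of_bound (h₀ i x hx)) (eLpNorm_mul_comp_flow_le hb h₁ (hge i) i hx)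
  refine (eLpNorm_plane_le fun i =>
    (measurable_transported hb hc₀ hc₁ hg i x).aestronglyMeasurable).trans ?_
  rw [two_mul, ENNReal.ofReal_add (by positivity) (by positivity)]
  exact add_le_add (key 0) (key 1)

theorem memLp_plane_transported (hb : ∀ i, IsField (b i) (bt i) B)
    (hc₀ : ∀ i, Continuous (uncurry (c₀ i))) (hc₁ : ∀ i, Continuous (uncurry (c₁ i)))
    (h₀ : ∀ i, ∀ x ∈ Icc 0 L, ∀ t, |c₀ i x t| ≤ d₀) (h₁ : ∀ i, ∀ x ∈ Icc 0 L, ∀ t, |c₁ i x t| ≤ d₁)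
    (hg : ∀ i, Measurable (g i)) (he : 0 ≤ e)
    (hge : ∀ i, eLpNorm (g i) 2 (volume.restrict (Ioo (T - B * L) (T + 1 + B * L))) ≤
      ENNReal.ofReal e) {x : ℝ} (hx : x ∈ Icc 0 L) :
    MemLp (plane fun i => transported (b i) (c₀ i) (c₁ i) (g i) x) 2
      (volume.restrict (Ioo T (T + 1))) :=
  ⟨aestronglyMeasurable_plane fun i => measurable_transported hb hc₀ hc₁ hg i x,
    (eLpNorm_plane_transported_le hb hc₀ hc₁ h₀ h₁ hg he hge hx).trans_lt ENNReal.ofReal_lt_top⟩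

theorem norm_lp_transported_le (hb : ∀ i, IsField (b i) (bt i) B)
    (hc₀ : ∀ i, Continuous (uncurry (c₀ i))) (hc₁ : ∀ i, Continuous (uncurry (c₁ i)))
    (h₀ : ∀ i, ∀ x ∈ Icc 0 L, ∀ t, |c₀ i x t| ≤ d₀) (h₁ : ∀ i, ∀ x ∈ Icc 0 L, ∀ t, |c₁ i x t| ≤ d₁)
    (hg : ∀ i, Measurable (g i)) (he : 0 ≤ e)
    (hge : ∀ i, eLpNorm (g i) 2 (volume.restrict (Ioo (T - B * L) (T + 1 + B * L))) ≤
      ENNReal.ofReal e) {x : ℝ} (hx : x ∈ Icc 0 L) :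
    ‖lp T (T + 1) (plane fun i => transported (b i) (c₀ i) (c₁ i) (g i) x)‖ ≤
      2 * (d₀ + d₁ * Real.exp (B * L) * e) := by
  have hd₀ : 0 ≤ d₀ := (abs_nonneg _).trans (h₀ 0 x hx 0)
  have hd₁ : 0 ≤ d₁ := (abs_nonneg _).trans (h₁ 0 x hx 0)
  rw [norm_lp_eq (memLp_plane_transported hb hc₀ hc₁ h₀ h₁ hg he hge hx)]
  exact ENNReal.toReal_le_of_le_ofReal (by positivity)
    (eLpNorm_plane_transported_le hb hc₀ hc₁ h₀ h₁ hg he hge hx)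

/-- Transport along characteristics gives continuous curves in `L²`. -/
theorem continuousOn_lp_transported (hb : ∀ i, IsField (b i) (bt i) B)
    (hc₀ : ∀ i, Continuous (uncurry (c₀ i))) (hc₁ : ∀ i, Continuous (uncurry (c₁ i)))
    (h₀ : ∀ i, ∀ x ∈ Icc 0 L, ∀ t, |c₀ i x t| ≤ d₀) (h₁ : ∀ i, ∀ x ∈ Icc 0 L, ∀ t, |c₁ i x t| ≤ d₁)
    (hg : ∀ i, Measurable (g i)) (he : 0 ≤ e)
    (hge : ∀ i, eLpNorm (g i) 2 (volume.restrict (Ioo (T - B * L) (T + 1 + B * L))) ≤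
      ENNReal.ofReal e) :
    ContinuousOn (fun x => lp T (T + 1) (plane fun i =>
      transported (b i) (c₀ i) (c₁ i) (g i) x)) (Icc 0 L) := by
  -- Replacing `g` by a continuous function close to it in `L²` gives a continuous curve. The change
  -- of variables along characteristics makes the error uniform in `x`.
  refine continuousOn_of_uniform_approx_of_continuousOn fun u hu => ?_
  obtain ⟨ε, hε, hεu⟩ := Metric.mem_uniformity_dist.1 hu
  -- Keeps the error `2 * d₁ * exp (B * L) * δ` below `ε`; the `+ 1` covers `d₁ = 0`.
  set δ := ε / (4 * (|d₁| + 1) * Real.exp (B * L)) with hδ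
  have hδ0 : 0 < δ := by positivity
  have happ (i : Fin 2) : ∃ h : ℝ → ℝ, Continuous h ∧ eLpNorm (g i - h) 2
      (volume.restrict (Ioo (T - B * L) (T + 1 + B * L))) ≤ ENNReal.ofReal δ := by
    have : MemLp (g i) 2 (volume.restrict (Ioo (T - B * L) (T + 1 + B * L))) :=
      ⟨(hg i).aestronglyMeasurable, (hge i).trans_lt ENNReal.ofReal_lt_top⟩
    obtain ⟨h, -, h1, h2, -⟩ := this.exists_hasCompactSupport_eLpNorm_sub_le (by norm_num)
      (ENNReal.ofReal_pos.2 hδ0).ne'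
    exact ⟨h, h2, h1⟩
  choose h hhc hh using happ
  refine ⟨fun x => lp T (T + 1) (plane fun i => transported (b i) (c₀ i) (c₁ i) (h i) x),
    (continuous_lp (by linarith) (continuous_plane fun i => ?_)).continuousOn, fun x hx => hεu ?_⟩
  · exact (hc₀ i).add ((hc₁ i).mul ((hhc i).comp
      ((hb i).continuous_flow_comp continuous_fst continuous_snd continuous_const)))
  have hd₁ : 0 ≤ d₁ := (abs_nonneg _).trans (h₁ 0 x hx 0)
  have hM1 := memLp_plane_transported hb hc₀ hc₁ h₀ h₁ hg he hge hx
  have hM2 : MemLp (plane fun i => transported (b i) (c₀ i) (c₁ i) (h i) x) 2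
      (volume.restrict (Ioo T (T + 1))) := by
    refine memLp_of_continuous ((continuous_plane (f := fun i =>
      transported (b i) (c₀ i) (c₁ i) (h i)) fun i => ?_).comp (Continuous.prodMk_right x))
    exact (hc₀ i).add ((hc₁ i).mul ((hhc i).comp
      ((hb i).continuous_flow_comp continuous_fst continuous_snd continuous_const)))
  have hsub : lp T (T + 1) (plane fun i => transported (b i) (c₀ i) (c₁ i) (g i) x) -
      lp T (T + 1) (plane fun i => transported (b i) (c₀ i) (c₁ i) (h i) x) =
      lp T (T + 1) (plane fun i => transported (b i) (fun _ _ => 0) (c₁ i) (g i - h i) x) := by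
    have e : (plane fun i => transported (b i) (fun _ _ => 0) (c₁ i) (g i - h i) x) =
        (plane fun i => transported (b i) (c₀ i) (c₁ i) (g i) x) -
          plane fun i => transported (b i) (c₀ i) (c₁ i) (h i) x := by
      ext t i
      simp only [plane, transported, Pi.sub_apply, PiLp.sub_apply]
      ring
    rw [e, lp, lp, lp, dif_pos hM1, dif_pos hM2, dif_pos (hM1.sub hM2), MemLp.toLp_sub]
  rw [dist_eq_norm, hsub]
  refine (norm_lp_transported_le (e := δ) (d₀ := 0) (c₀ := fun _ _ _ => 0) (g := fun i => g i - h i)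
    hb (fun i => continuous_const) hc₁ (fun i x _ t => by simp) h₁
    (fun i => (hg i).sub (hhc i).measurable) hδ0.le hh hx).trans_lt ?_
  rw [hδ, abs_of_nonneg hd₁, zero_add]
  have : 0 < Real.exp (B * L) := Real.exp_pos _
  rw [show 2 * (d₁ * Real.exp (B * L) * (ε / (4 * (d₁ + 1) * Real.exp (B * L)))) =
    ε * (d₁ / (2 * (d₁ + 1))) by field_simp; ring]
  refine mul_lt_of_lt_one_right hε ?_
  rw [div_lt_one (by positivity)]
  linarith

end transported

/-! ### Curves in Sobolev spaces. -/

section curves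

variable {a b : ℝ}

theorem IsWeakDeriv.congr {f g f' g' : ℝ → ℝ} (h : IsWeakDeriv a b f g)
    (hf : ∀ᵐ t, t ∈ Ioo a b → f' t = f t) (hg : ∀ᵐ t, t ∈ Ioo a b → g' t = g t) :
    IsWeakDeriv a b f' g' := by
  intro φ hφ
  have e1 : ∫ t in Ioo a b, deriv φ t * f' t = ∫ t in Ioo a b, deriv φ t * f t := by
    refine setIntegral_congr_ae measurableSet_Ioo ?_
    filter_upwards [hf] with t ht hmem
    rw [ht hmem]
  have e2 : ∫ t in Ioo a b, φ t * g' t = ∫ t in Ioo a b, φ t * g t := by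
    refine setIntegral_congr_ae measurableSet_Ioo ?_
    filter_upwards [hg] with t ht hmem
    rw [ht hmem]
  rw [e1, e2, h φ hφ]

theorem hasWeakDeriv_lp (hab : a ≤ b) {f f' : Fin 2 → ℝ → ℝ}
    (hf : MemLp (plane f) 2 (volume.restrict (Ioo a b)))
    (hf' : MemLp (plane f') 2 (volume.restrict (Ioo a b)))
    (hac : ∀ i, AbsolutelyContinuousOnInterval (f i) a b)
    (hd : ∀ i, ∀ᵐ t, t ∈ Ioo a b → HasDerivAt (f i) (f' i t) t) :
    HasWeakDeriv a b (lp a b (plane f)) (lp a b (plane f')) := by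
  refine hasWeakDeriv_iff.2 fun i =>
    (isWeakDeriv_of_absolutelyContinuous hab (hac i) (hd i)).congr ?_ ?_
  · filter_upwards [ae_lp_apply hf] with t ht hmem
    rw [ht hmem]
    rfl
  · filter_upwards [ae_lp_apply hf'] with t ht hmem
    rw [ht hmem]
    rfl

theorem HasWeakDeriv.sub {f g f' g' : L2 a b} (h : HasWeakDeriv a b f g)
    (h' : HasWeakDeriv a b f' g') : HasWeakDeriv a b (f - f') (g - g') := by
  have := h.add (h'.smul (-1))
  rwa [neg_one_smul, neg_one_smul, ← sub_eq_add_neg, ← sub_eq_add_neg] at this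

/-- The pairing of an element of `L²` with a test function. -/
def testPairing (a b : ℝ) (ψ : ℝ → ℝ) (hc : Continuous ψ) (hs : HasCompactSupport ψ) :
    L2 a b →L[ℝ] Plane :=
  LinearMap.mkContinuous
    ({ toFun := fun f => ∫ t in Ioo a b, ψ t • f t
       map_add' := fun f g => by
        rw [← integral_add (integrable_test_smul f hc hs) (integrable_test_smul g hc hs)]
        refine integral_congr_ae ?_
        filter_upwards [Lp.coeFn_add f g] with t ht
        rw [ht, Pi.add_apply, smul_add]
       map_smul' := fun c f => by
        rw [RingHom.id_apply, ← integral_smul]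
        refine integral_congr_ae ?_
        filter_upwards [Lp.coeFn_smul c f] with t ht
        rw [ht, Pi.smul_apply, smul_comm] } : L2 a b →ₗ[ℝ] Plane)
    ‖(memLp_of_continuous hc : MemLp ψ 2 (volume.restrict (Ioo a b))).toLp ψ‖ fun f => by
      have hψ : MemLp ψ 2 (volume.restrict (Ioo a b)) := memLp_of_continuous hc
      refine (norm_integral_le_integral_norm _).trans ?_
      simp only [norm_smul]
      have h1 := real_inner_le_norm (hψ.norm.toLp fun t => ‖ψ t‖)
        ((Lp.memLp f).norm.toLp fun t => ‖f t‖)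
      rw [L2.inner_def] at h1
      have h2 : ∫ t in Ioo a b, ‖ψ t‖ * ‖f t‖ = ∫ t in Ioo a b,
          inner ℝ ((hψ.norm.toLp fun t => ‖ψ t‖) t) (((Lp.memLp f).norm.toLp fun t => ‖f t‖) t) := by
        refine integral_congr_ae ?_
        filter_upwards [hψ.norm.coeFn_toLp, (Lp.memLp f).norm.coeFn_toLp] with t h1 h2
        rw [h1, h2]
        simp [mul_comm]
      rw [← h2, Lp.norm_toLp, Lp.norm_toLp, eLpNorm_norm, eLpNorm_norm] at h1
      rwa [Lp.norm_toLp, Lp.norm_def]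

theorem testPairing_apply {ψ : ℝ → ℝ} (hc : Continuous ψ) (hs : HasCompactSupport ψ) (f : L2 a b) :
    testPairing a b ψ hc hs f = ∫ t in Ioo a b, ψ t • f t := rfl

/-- Pairing with a test function is a bounded linear map and commutes with the vector-valued
integral. -/
theorem HasWeakDeriv.intervalIntegral {F G : ℝ → L2 a b} (hF : Continuous F) (hG : Continuous G)
    (h : ∀ y, HasWeakDeriv a b (F y) (G y)) (x : ℝ) :
    HasWeakDeriv a b (∫ y in (0 : ℝ)..x, F y) (∫ y in (0 : ℝ)..x, G y) := by
  intro φ hφ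
  have e1 := (testPairing a b _ hφ.deriv_cont hφ.2.1.deriv).intervalIntegral_comp_comm
    (hF.intervalIntegrable (μ := volume) 0 x)
  have e2 := (testPairing a b _ hφ.1.continuous hφ.2.1).intervalIntegral_comp_comm
    (hG.intervalIntegrable (μ := volume) 0 x)
  rw [← testPairing_apply hφ.deriv_cont hφ.2.1.deriv, ← testPairing_apply hφ.1.continuous hφ.2.1,
    ← e1, ← e2, ← intervalIntegral.integral_neg]
  exact intervalIntegral.integral_congr fun y _ => h y φ hφ

/-- The element of the Sobolev space with given weak derivatives. -/
def sob (a b : ℝ) {k : ℕ} (f : Fin (k + 1) → L2 a b) : Sobolev a b k :=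
  open Classical in if h : ∀ j : Fin k, HasWeakDeriv a b (f j.castSucc) (f j.succ) then
    ⟨WithLp.toLp 2 f, h⟩ else 0

theorem wderiv_sob {k : ℕ} {f : Fin (k + 1) → L2 a b}
    (h : ∀ j : Fin k, HasWeakDeriv a b (f j.castSucc) (f j.succ)) (j : Fin (k + 1)) :
    wderiv (sob a b f) j = f j := by
  rw [sob, dif_pos h]
  rfl

theorem continuousOn_of_wderiv {k : ℕ} {M : ℝ → Sobolev a b k} {s : Set ℝ}
    (h : ∀ j, ContinuousOn (fun x => wderiv (M x) j) s) : ContinuousOn M s := by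
  intro x hx
  rw [ContinuousWithinAt, tendsto_iff_norm_sub_tendsto_zero]
  have h1 : Tendsto (fun y => ∑ j, ‖wderiv (M y) j - wderiv (M x) j‖) (𝓝[s] x) (𝓝 0) := by
    rw [← Finset.sum_const_zero (s := (Finset.univ : Finset (Fin (k + 1))))]
    exact tendsto_finsetSum _ fun j _ => tendsto_iff_norm_sub_tendsto_zero.1 (h j x hx)
  exact squeeze_zero (fun _ => norm_nonneg _) (fun y => norm_le_sum (M y - M x)) h1

theorem hasDerivWithinAt_incl {M : ℝ → Sobolev a b 2} {N : Sobolev a b 1} {s : Set ℝ} {x : ℝ}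
    (h : ∀ j : Fin 2, HasDerivWithinAt (fun y => wderiv (M y) j.castSucc) (wderiv N j) s x) :
    HasDerivWithinAt (fun y => incl (M y)) N s x := by
  rw [hasDerivWithinAt_iff_isLittleO]
  have h1 : (fun y => ∑ j : Fin 2, ‖wderiv (M y) j.castSucc - wderiv (M x) j.castSucc -
      (y - x) • wderiv N j‖) =o[𝓝[s] x] fun y => y - x :=
    Asymptotics.IsLittleO.fun_sum fun j _ => (hasDerivWithinAt_iff_isLittleO.1 (h j)).norm_left
  refine (Asymptotics.IsBigO.of_bound 1 (Eventually.of_forall fun y => ?_)).trans_isLittleO h1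
  rw [one_mul, Real.norm_of_nonneg (Finset.sum_nonneg fun _ _ => norm_nonneg _)]
  exact norm_le_sum (incl (M y) - incl (M x) - (y - x) • N)

theorem norm_lp_plane_le {T d : ℝ} {f : Fin 2 → ℝ → ℝ} (hf : ∀ i, Continuous (f i))
    (hd : ∀ i t, |f i t| ≤ d) : ‖lp T (T + 1) (plane f)‖ ≤ 2 * d := by
  have hd0 : 0 ≤ d := (abs_nonneg _).trans (hd 0 0)
  have hc : Continuous (plane f) :=
    (continuous_plane (f := fun i (_ : Unit) => f i) fun i => (hf i).comp continuous_snd).comp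
      (Continuous.prodMk_right ())
  rw [norm_lp_eq (memLp_of_continuous hc)]
  refine ENNReal.toReal_le_of_le_ofReal (by positivity) ((eLpNorm_plane_le fun i =>
    (hf i).aestronglyMeasurable).trans ?_)
  rw [two_mul, ENNReal.ofReal_add hd0 hd0]
  exact add_le_add (eLpNorm_le_of_bound (hd 0)) (eLpNorm_le_of_bound (hd 1))

/-- The enlarged interval lies in one made of `2 * N + 1` periods. The square root of that number is
estimated by the number itself. -/
theorem eLpNorm_periodic_le {T ε R : ℝ} {P : ℝ → ℝ} (hper : ∀ t, P (t + 1) = P t)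
    (hP : ∀ b c, MemLp P 2 (volume.restrict (Ioo b c))) (hε : 0 ≤ ε)
    (hle : ∫ t in T..(T + 1), P t ^ 2 ≤ ε ^ 2) {N : ℕ} (hN : R ≤ N) :
    eLpNorm P 2 (volume.restrict (Ioo (T - R) (T + 1 + R))) ≤ ENNReal.ofReal ((2 * N + 1) * ε) := by
  have hsub : Ioo (T - R) (T + 1 + R) ⊆ Ioo (T - N) (T - N + (2 * N + 1)) :=
    Ioo_subset_Ioo (by linarith) (by linarith)
  refine (eLpNorm_mono_measure P (Measure.restrict_mono hsub le_rfl)).trans ?_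
  rw [(hP _ _).eLpNorm_eq_integral_rpow_norm (by norm_num) (by norm_num)]
  refine ENNReal.ofReal_le_ofReal ?_
  have hp : Periodic (fun t => P t ^ 2) 1 := fun t => by simp only [hper]
  have h1 := hp.intervalIntegral_add_zsmul_eq (2 * N + 1) (T - N) fun b c => by
    rcases le_total b c with h | h
    · exact (memLp_two_intervalIntegrable h (hP b c)).2
    · exact (memLp_two_intervalIntegrable h (hP c b)).2.symm
  rw [hp.intervalIntegral_add_eq _ T, zsmul_eq_mul, zsmul_eq_mul, mul_one] at h1
  push_cast at h1
  have hN0 : (0 : ℝ) ≤ N := N.cast_nonneg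
  have h2 : ∫ t in Ioo (T - N) (T - N + (2 * N + 1)), ‖P t‖ ^ (2 : ℝ≥0∞).toReal =
      (2 * N + 1) * ∫ t in T..(T + 1), P t ^ 2 := by
    rw [← h1, intervalIntegral.integral_of_le (by linarith), integral_Ioc_eq_integral_Ioo]
    simp
  rw [h2]
  have h3 : 0 ≤ ∫ t in T..(T + 1), P t ^ 2 :=
    intervalIntegral.integral_nonneg (by linarith) fun _ _ => sq_nonneg _
  have h4 : (2 * N + 1 : ℝ) ≤ (2 * N + 1) ^ 2 := by nlinarith
  calc _ ≤ (((2 * N + 1) * ε) ^ 2) ^ (2 : ℝ≥0∞).toReal⁻¹ := by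
        rw [mul_pow]
        gcongr
    _ = (2 * N + 1) * ε := by
        rw [ENNReal.toReal_ofNat, ← Real.rpow_natCast, ← Real.rpow_mul (by positivity)]
        norm_num

end curves

/-- The first coefficient in the representation of `∂ₜ∂ₓmᵢ` by characteristics. -/
def slopeCoeff (κ : ℝ) (α α' : ℝ → ℝ) (w w' : Fin 2 → ℝ → ℝ) (m p : Fin 2 → ℝ → ℝ → ℝ) (i : Fin 2)
    (c₀ : ℝ → ℝ → ℝ) (x t : ℝ) : ℝ :=
  speedDeriv κ w w' m p i x t * (1 / 2 * α t * (m 0 x t + m 1 x t) - p i x t) +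
    speed κ w m i x t * (1 / 2 * α' t * (m 0 x t + m 1 x t) + 1 / 2 * α t * (p 0 x t + p 1 x t) -
      c₀ x t)

namespace PerturbedState

variable {κ c A K L σ₀ η C e T : ℝ} {α α' : ℝ → ℝ} {w w' : Fin 2 → ℝ → ℝ}
  {m p c₀ c₁ : Fin 2 → ℝ → ℝ → ℝ} {g : Fin 2 → ℝ → ℝ}

theorem continuous_slopeX (H : PerturbedState κ c A K σ₀ η α α' w w' m p) (i : Fin 2) :
    Continuous (uncurry (slopeX κ α w m p i)) :=
  (H.bg.cont_speed H.adm i).mul ((((H.bg.cont_α.comp continuous_snd).const_mul _).mul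
    ((H.adm.cont 0).add (H.adm.cont 1))).sub (H.adm.cont' i))

theorem continuous_slopeCoeff (H : PerturbedState κ c A K σ₀ η α α' w w' m p) (i : Fin 2)
    {c₀ : ℝ → ℝ → ℝ} (hc : Continuous (uncurry c₀)) :
    Continuous (uncurry (slopeCoeff κ α α' w w' m p i c₀)) :=
  ((H.bg.cont_speedDeriv H.adm i).mul ((((H.bg.cont_α.comp continuous_snd).const_mul _).mul
    ((H.adm.cont 0).add (H.adm.cont 1))).sub (H.adm.cont' i))).add
  ((H.bg.cont_speed H.adm i).mul (((((H.bg.cont_α'.comp continuous_snd).const_mul _).mul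
    ((H.adm.cont 0).add (H.adm.cont 1))).add (((H.bg.cont_α.comp continuous_snd).const_mul _).mul
    ((H.adm.cont' 0).add (H.adm.cont' 1)))).sub hc))

theorem abs_half_mul_le {a m₀ m₁ : ℝ} (ha : |a| ≤ A) (h₀ : |m₀| ≤ η) (h₁ : |m₁| ≤ η) :
    |1 / 2 * a * (m₀ + m₁)| ≤ A * η := by
  have h2 := (abs_add_le m₀ m₁).trans (add_le_add h₀ h₁)
  have hA := (abs_nonneg _).trans ha
  rw [abs_mul, abs_mul, abs_of_pos (by norm_num)]
  calc _ ≤ 1 / 2 * A * (η + η) := by gcongr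
    _ = A * η := by ring

theorem abs_slopeX_le (H : PerturbedState κ c A K σ₀ η α α' w w' m p) (i : Fin 2) (x t : ℝ) :
    |slopeX κ α w m p i x t| ≤ speedBound κ c A * ((A + 1) * η) := by
  have h1 : |1 / 2 * α t * (m 0 x t + m 1 x t)| ≤ A * η := abs_half_mul_le (H.bg.reg_α.bound t)
    ((H.adm.reg 0 x).bound t) ((H.adm.reg 1 x).bound t)
  rw [slopeX, abs_mul]
  refine mul_le_mul ((H.bg.reg_speed H.adm i x).bound t) ((abs_sub _ _).trans ?_) (abs_nonneg _)
    H.bg.speedBound_nonneg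
  linarith [(H.adm.reg i x).bound' t]

theorem abs_slopeCoeff_le (H : PerturbedState κ c A K σ₀ η α α' w w' m p) (i : Fin 2)
    {c₀ : ℝ → ℝ → ℝ} {x t : ℝ} (hc : |c₀ x t| ≤ C * η) :
    |slopeCoeff κ α α' w w' m p i c₀ x t| ≤ speedBound κ c A * ((3 * A + 1 + C) * η) := by
  have h1 : |1 / 2 * α t * (m 0 x t + m 1 x t)| ≤ A * η := abs_half_mul_le (H.bg.reg_α.bound t)
    ((H.adm.reg 0 x).bound t) ((H.adm.reg 1 x).bound t)
  have h2 : |1 / 2 * α' t * (m 0 x t + m 1 x t)| ≤ A * η := abs_half_mul_le (H.bg.reg_α.bound' t)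
    ((H.adm.reg 0 x).bound t) ((H.adm.reg 1 x).bound t)
  have h3 : |1 / 2 * α t * (p 0 x t + p 1 x t)| ≤ A * η := abs_half_mul_le (H.bg.reg_α.bound t)
    ((H.adm.reg 0 x).bound' t) ((H.adm.reg 1 x).bound' t)
  have h4 := H.bg.speedBound_nonneg
  have h5 : |1 / 2 * α t * (m 0 x t + m 1 x t) - p i x t| ≤ A * η + η :=
    (abs_sub _ _).trans (add_le_add h1 ((H.adm.reg i x).bound' t))
  have h6 : |1 / 2 * α' t * (m 0 x t + m 1 x t) + 1 / 2 * α t * (p 0 x t + p 1 x t) - c₀ x t| ≤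
      A * η + A * η + C * η :=
    (abs_sub _ _).trans (add_le_add ((abs_add_le _ _).trans (add_le_add h2 h3)) hc)
  have h7 := mul_le_mul ((H.bg.reg_speed H.adm i x).bound' t) h5 (abs_nonneg _) h4
  have h8 := mul_le_mul ((H.bg.reg_speed H.adm i x).bound t) h6 (abs_nonneg _) h4
  refine (abs_add_le _ _).trans ?_
  rw [abs_mul, abs_mul]
  linarith

theorem hasDerivAt_slopeX (H : PerturbedState κ c A K σ₀ η α α' w w' m p) (i : Fin 2)
    {b c₀ c₁ : ℝ → ℝ → ℝ} {g : ℝ → ℝ} {x t : ℝ}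
    (hp : HasDerivAt (p i x) (c₀ x t + c₁ x t * g (flow b x t 0)) t) :
    HasDerivAt (slopeX κ α w m p i x) (transported b (slopeCoeff κ α α' w w' m p i c₀)
      (fun x t => -(speed κ w m i x t * c₁ x t)) g x t) t := by
  have h1 := (((H.bg.reg_α.deriv t).const_mul (1 / 2)).mul
    (((H.adm.reg 0 x).deriv t).add ((H.adm.reg 1 x).deriv t))).sub hp
  refine (((H.bg.reg_speed H.adm i x).deriv t).mul h1).congr_deriv ?_
  simp only [transported, slopeCoeff, Pi.add_apply, Pi.mul_apply, Pi.sub_apply]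
  ring

theorem absolutelyContinuous_slopeX (H : PerturbedState κ c A K σ₀ η α α' w w' m p) (i : Fin 2)
    {x a b : ℝ} (hp : AbsolutelyContinuousOnInterval (p i x) a b) :
    AbsolutelyContinuousOnInterval (slopeX κ α w m p i x) a b := by
  have hα := (H.bound_α.const_mul (1 / 2)).absolutelyContinuous x a b
  have hm := ((H.bound_m 0).add (H.bound_m 1)).absolutelyContinuous x a b
  exact ((H.bound_speed i).absolutelyContinuous x a b).mul ((hα.mul hm).sub hp)

/-- Solutions with a second derivative transported along characteristics are curves in Sobolev
spaces. -/
theorem exists_sobolev_curve (H : PerturbedState κ c A K σ₀ η α α' w w' m p)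
    (S : IsSol κ L α α' w w' m p) (hL : 0 ≤ L)
    (hT : ∀ i, HasTransportedDeriv L C η (speed κ w m i) (p i) (c₀ i) (c₁ i) (g i)) (he : 0 ≤ e)
    (hge : ∀ i, eLpNorm (g i) 2 (volume.restrict (Ioo (T - speedBound κ c A * L)
      (T + 1 + speedBound κ c A * L))) ≤ ENNReal.ofReal e) :
    ∃ (M : ℝ → Sobolev T (T + 1) 2) (N : ℝ → Sobolev T (T + 1) 1),
      ContinuousOn M (Icc 0 L) ∧ ContinuousOn N (Icc 0 L) ∧
      (∀ x ∈ Icc 0 L, HasDerivWithinAt (fun y => incl (M y)) (N x) (Icc 0 L) x) ∧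
      (∀ x ∈ Icc 0 L, wderiv (M x) 0 = lp T (T + 1) (plane fun i => m i x) ∧
        wderiv (M x) 1 = lp T (T + 1) (plane fun i => p i x) ∧
        wderiv (N x) 0 = lp T (T + 1) (plane fun i => slopeX κ α w m p i x)) ∧
      ∀ x ∈ Icc 0 L,
        ‖M x‖ ≤ 2 * η + 2 * η + 2 * (C * η + C * Real.exp (speedBound κ c A * L) * e) ∧
        ‖N x‖ ≤ 2 * (speedBound κ c A * ((A + 1) * η)) +
          2 * (speedBound κ c A * ((3 * A + 1 + C) * η) +
            speedBound κ c A * C * Real.exp (speedBound κ c A * L) * e) := by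
  have hTT : T ≤ T + 1 := by linarith
  have hB := H.bg.speedBound_nonneg
  have hb (i : Fin 2) := H.bg.isField H.adm i
  set b : Fin 2 → ℝ → ℝ → ℝ := fun i => speed κ w m i with hbdef
  set q : Fin 2 → ℝ → ℝ → ℝ := fun i => transported (b i) (c₀ i) (c₁ i) (g i) with hq
  set d₀ : Fin 2 → ℝ → ℝ → ℝ := fun i => slopeCoeff κ α α' w w' m p i (c₀ i) with hd₀
  set d₁ : Fin 2 → ℝ → ℝ → ℝ := fun i x t => -(speed κ w m i x t * c₁ i x t) with hd₁
  set n : Fin 2 → ℝ → ℝ → ℝ := fun i => transported (b i) (d₀ i) (d₁ i) (g i) with hn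
  have hd₀c (i : Fin 2) : Continuous (uncurry (d₀ i)) := H.continuous_slopeCoeff i (hT i).cont₀
  have hd₁c (i : Fin 2) : Continuous (uncurry (d₁ i)) :=
    ((H.bg.cont_speed H.adm i).mul (hT i).cont₁).neg
  have hd₀b (i : Fin 2) (x : ℝ) (hx : x ∈ Icc 0 L) (t : ℝ) := H.abs_slopeCoeff_le i
    ((hT i).bound₀ x hx t)
  have hd₁b (i : Fin 2) (x : ℝ) (hx : x ∈ Icc 0 L) (t : ℝ) : |d₁ i x t| ≤ speedBound κ c A * C := by
    rw [hd₁, abs_neg, abs_mul]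
    exact mul_le_mul ((H.bg.reg_speed H.adm i x).bound t) ((hT i).bound₁ x hx t) (abs_nonneg _) hB
  have hcx {f : Fin 2 → ℝ → ℝ → ℝ} (hf : ∀ i, Continuous (uncurry (f i))) (x : ℝ) (i : Fin 2) :
      Continuous (f i x) := (hf i).comp (Continuous.prodMk_right x)
  have hmem {f : Fin 2 → ℝ → ℝ → ℝ} (hf : ∀ i, Continuous (uncurry (f i))) (x : ℝ) :
      MemLp (plane fun i => f i x) 2 (volume.restrict (Ioo T (T + 1))) :=
    memLp_of_continuous ((continuous_plane hf).comp (Continuous.prodMk_right x))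
  have hqmem {x : ℝ} (hx : x ∈ Icc 0 L) : MemLp (plane fun i => q i x) 2
      (volume.restrict (Ioo T (T + 1))) := memLp_plane_transported hb (fun i => (hT i).cont₀)
    (fun i => (hT i).cont₁) (fun i => (hT i).bound₀) (fun i => (hT i).bound₁)
    (fun i => (hT i).meas) he hge hx
  have hnmem {x : ℝ} (hx : x ∈ Icc 0 L) : MemLp (plane fun i => n i x) 2
      (volume.restrict (Ioo T (T + 1))) := memLp_plane_transported hb hd₀c hd₁c hd₀b hd₁b
    (fun i => (hT i).meas) he hge hx
  have hsc := H.continuous_slopeX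
  have w1 (x : ℝ) : HasWeakDeriv T (T + 1) (lp T (T + 1) (plane fun i => m i x))
      (lp T (T + 1) (plane fun i => p i x)) :=
    hasWeakDeriv_lp hTT (hmem H.adm.cont x) (hmem H.adm.cont' x)
      (fun i => (H.bound_m i).absolutelyContinuous x _ _)
      fun i => Eventually.of_forall fun t _ => (H.adm.reg i x).deriv t
  have w2 {x : ℝ} (hx : x ∈ Icc 0 L) : HasWeakDeriv T (T + 1) (lp T (T + 1) (plane fun i => p i x))
      (lp T (T + 1) (plane fun i => q i x)) :=
    hasWeakDeriv_lp hTT (hmem H.adm.cont' x) (hqmem hx) (fun i => (hT i).ac x hx _ _)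
      fun i => ((hT i).ae_hasDerivAt x hx).mono fun t ht _ => ht
  have w3 {x : ℝ} (hx : x ∈ Icc 0 L) : HasWeakDeriv T (T + 1)
      (lp T (T + 1) (plane fun i => slopeX κ α w m p i x))
      (lp T (T + 1) (plane fun i => n i x)) :=
    hasWeakDeriv_lp hTT (hmem hsc x) (hnmem hx)
      (fun i => H.absolutelyContinuous_slopeX i ((hT i).ac x hx _ _))
      fun i => ((hT i).ae_hasDerivAt x hx).mono fun t ht _ => H.hasDerivAt_slopeX i ht
  set M : ℝ → Sobolev T (T + 1) 2 := fun x => sob T (T + 1) ![lp T (T + 1) (plane fun i => m i x),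
    lp T (T + 1) (plane fun i => p i x), lp T (T + 1) (plane fun i => q i x)] with hM
  set N : ℝ → Sobolev T (T + 1) 1 := fun x => sob T (T + 1)
    ![lp T (T + 1) (plane fun i => slopeX κ α w m p i x), lp T (T + 1) (plane fun i => n i x)]
    with hN
  have hMj {x : ℝ} (hx : x ∈ Icc 0 L) (j : Fin 3) : wderiv (M x) j =
      (![lp T (T + 1) (plane fun i => m i x), lp T (T + 1) (plane fun i => p i x),
        lp T (T + 1) (plane fun i => q i x)] : Fin 3 → L2 T (T + 1)) j := by
    refine wderiv_sob (fun j => ?_) j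
    fin_cases j
    exacts [w1 x, w2 hx]
  have hNj {x : ℝ} (hx : x ∈ Icc 0 L) (j : Fin 2) : wderiv (N x) j =
      (![lp T (T + 1) (plane fun i => slopeX κ α w m p i x), lp T (T + 1) (plane fun i => n i x)] :
        Fin 2 → L2 T (T + 1)) j := by
    refine wderiv_sob (fun j => ?_) j
    fin_cases j
    exact w3 hx
  have cm := continuous_lp hTT (continuous_plane H.adm.cont)
  have cp := continuous_lp hTT (continuous_plane H.adm.cont')
  have cs := continuous_lp hTT (continuous_plane hsc)
  have cq : ContinuousOn (fun x => lp T (T + 1) (plane fun i => q i x)) (Icc 0 L) :=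
    continuousOn_lp_transported hb (fun i => (hT i).cont₀) (fun i => (hT i).cont₁)
      (fun i => (hT i).bound₀) (fun i => (hT i).bound₁) (fun i => (hT i).meas) he hge
  have cn : ContinuousOn (fun x => lp T (T + 1) (plane fun i => n i x)) (Icc 0 L) :=
    continuousOn_lp_transported hb hd₀c hd₁c hd₀b hd₁b (fun i => (hT i).meas) he hge
  have h0L : (0 : ℝ) ∈ Icc 0 L := ⟨le_rfl, hL⟩
  have cs' : Continuous fun x => lp T (T + 1) (plane fun i => slopeX κ α w m p i (clamp L x)) :=
    cs.comp (continuous_clamp L)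
  -- Continuity of the class of `n` is available on `[0, L]` only; clamping extends the curve to the
  -- line, where primitives can be differentiated without boundary cases.
  have cn' : Continuous fun x => lp T (T + 1) (plane fun i => n i (clamp L x)) :=
    cn.comp_continuous (continuous_clamp L) (clamp_mem hL)
  have im {x : ℝ} (hx : x ∈ Icc 0 L) : lp T (T + 1) (plane fun i => m i x) -
      lp T (T + 1) (plane fun i => m i 0) =
      ∫ y in (0 : ℝ)..x, lp T (T + 1) (plane fun i => slopeX κ α w m p i (clamp L y)) := by
    rw [lp_sub_lp hTT (continuous_plane H.adm.cont) (continuous_plane hsc) (fun t x hx => ?_) hx]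
    · refine intervalIntegral.integral_congr fun y hy => ?_
      rw [uIcc_of_le hx.1] at hy
      simp only [clamp_of_mem (L := L) ⟨hy.1, hy.2.trans hx.2⟩]
    · have := hasDerivAt_pi.2 fun i => S.left i x hx t
      exact ((PiLp.continuousLinearEquiv 2 ℝ
        (fun _ : Fin 2 => ℝ)).symm.toContinuousLinearMap.hasFDerivAt.comp_hasDerivAt x this)
  -- The increment of `p` is not computed pointwise. It is the weak `t`-derivative of the increment
  -- of `m`; weak differentiation under the integral in `im` yields the right-hand side, and weak
  -- derivatives are unique.
  have ip {x : ℝ} (hx : x ∈ Icc 0 L) : lp T (T + 1) (plane fun i => p i x) -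
      lp T (T + 1) (plane fun i => p i 0) =
      ∫ y in (0 : ℝ)..x, lp T (T + 1) (plane fun i => n i (clamp L y)) := by
    refine ((w1 x).sub (w1 0)).unique ?_
    rw [im hx]
    exact HasWeakDeriv.intervalIntegral cs' cn' (fun y => w3 (clamp_mem hL y)) x
  have dint {F : ℝ → L2 T (T + 1)} {G : ℝ → L2 T (T + 1)} (hG : Continuous G)
      (hFG : ∀ x ∈ Icc 0 L, F x - F 0 = ∫ y in (0 : ℝ)..x, G y) {x : ℝ} (hx : x ∈ Icc 0 L) :
      HasDerivWithinAt F (G x) (Icc 0 L) x := by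
    have h1 : HasDerivAt (fun x => F 0 + ∫ y in (0 : ℝ)..x, G y) (G x) x :=
      (intervalIntegral.integral_hasDerivAt_right (hG.intervalIntegrable _ _)
        hG.stronglyMeasurable.stronglyMeasurableAtFilter hG.continuousAt).const_add _
    refine h1.hasDerivWithinAt.congr (fun y hy => ?_) ?_
    · rw [← hFG y hy]
      abel
    · rw [← hFG x hx]
      abel
  refine ⟨M, N, continuousOn_of_wderiv fun j => ?_, continuousOn_of_wderiv fun j => ?_,
    fun x hx => hasDerivWithinAt_incl fun j => ?_, fun x hx => ⟨hMj hx 0, hMj hx 1, hNj hx 0⟩,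
    fun x hx => ⟨(norm_le_sum _).trans ?_, (norm_le_sum _).trans ?_⟩⟩
  · refine ContinuousOn.congr ?_ fun x hx => hMj hx j
    fin_cases j
    exacts [cm.continuousOn, cp.continuousOn, cq]
  · refine ContinuousOn.congr ?_ fun x hx => hNj hx j
    fin_cases j
    exacts [cs.continuousOn, cn]
  · rw [hNj hx]
    refine HasDerivWithinAt.congr ?_ (fun y hy => hMj hy j.castSucc) (hMj hx j.castSucc)
    fin_cases j
    · have := dint cs' (F := fun x => lp T (T + 1) (plane fun i => m i x)) (fun x hx => im hx) hx
      rwa [clamp_of_mem hx] at this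
    · have := dint cn' (F := fun x => lp T (T + 1) (plane fun i => p i x)) (fun x hx => ip hx) hx
      rwa [clamp_of_mem hx] at this
  · rw [Fin.sum_univ_three, hMj hx 0, hMj hx 1, hMj hx 2]
    refine add_le_add (add_le_add ?_ ?_) ?_
    · exact norm_lp_plane_le (hcx H.adm.cont x) fun i => (H.adm.reg i x).bound
    · exact norm_lp_plane_le (hcx H.adm.cont' x) fun i => (H.adm.reg i x).bound'
    · exact norm_lp_transported_le hb (fun i => (hT i).cont₀) (fun i => (hT i).cont₁)
        (fun i => (hT i).bound₀) (fun i => (hT i).bound₁) (fun i => (hT i).meas) he hge hx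
  · rw [Fin.sum_univ_two, hNj hx 0, hNj hx 1]
    refine add_le_add ?_ ?_
    · exact norm_lp_plane_le (hcx hsc x) fun i => H.abs_slopeX_le i x
    · exact norm_lp_transported_le hb hd₀c hd₁c hd₀b hd₁b (fun i => (hT i).meas) he hge hx

end PerturbedState

/-! ### Uniqueness by the energy method. -/

theorem eigenvalue_eq (γ : ℝ) (z : Plane) (i : Fin 2) :
    eigenvalue γ z i = lam ((γ - 1) / 2) i fun j => z j := by
  fin_cases i
  · simp only [eigenvalue, lam, Fin.zero_eta, Matrix.cons_val_zero, zero_add]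
    ring
  · change z 0 + z 1 + (γ - 1) / 2 * (z 1 - z 0) =
      (1 + (γ - 1) / 2) * z 1 + (1 - (γ - 1) / 2) * z 0
    ring

theorem absolutelyContinuous_of_abs_deriv_le {b bt : ℝ → ℝ} {B : ℝ}
    (hb : ∀ t, HasDerivAt b (bt t) t) (hbt : ∀ t, |bt t| ≤ B) (a c : ℝ) :
    AbsolutelyContinuousOnInterval b a c := by
  have hB : 0 ≤ B := (abs_nonneg _).trans (hbt 0)
  have : LipschitzWith B.toNNReal b := by
    refine lipschitzWith_of_nnnorm_deriv_le (fun t => (hb t).differentiableAt) fun t => ?_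
    rw [(hb t).deriv, ← NNReal.coe_le_coe, Real.coe_toNNReal _ hB]
    exact hbt t
  exact this.lipschitzOnWith.absolutelyContinuousOnInterval

/-- The energy identity for periodic functions. -/
theorem integral_energy_eq_zero {T B : ℝ} {b bt F G : ℝ → ℝ} (hb : ∀ t, HasDerivAt b (bt t) t)
    (hbt : ∀ t, |bt t| ≤ B) (hF : AbsolutelyContinuousOnInterval F T (T + 1))
    (hG : ∀ᵐ t, t ∈ Ioo T (T + 1) → HasDerivAt F (G t) t) (hbT : b (T + 1) = b T)
    (hFT : F (T + 1) = F T) :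
    IntegrableOn (fun t => b t * F t * G t + 1 / 2 * bt t * F t ^ 2) (Ioo T (T + 1)) ∧
      ∫ t in Ioo T (T + 1), (b t * F t * G t + 1 / 2 * bt t * F t ^ 2) = 0 := by
  have hTT : T ≤ T + 1 := by linarith
  have hac : AbsolutelyContinuousOnInterval (fun t => 1 / 2 * (b t * (F t * F t))) T (T + 1) :=
    ((absolutelyContinuous_of_abs_deriv_le hb hbt T (T + 1)).mul (hF.mul hF)).const_mul (1 / 2)
  have hd : ∀ᵐ t, t ∈ Ioo T (T + 1) → HasDerivAt (fun t => 1 / 2 * (b t * (F t * F t)))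
      (b t * F t * G t + 1 / 2 * bt t * F t ^ 2) t := by
    filter_upwards [hG] with t ht hmem
    refine (((hb t).mul ((ht hmem).mul (ht hmem))).const_mul (1 / 2)).congr_deriv ?_
    simp only [Pi.mul_apply]
    ring
  constructor
  · have := hac.intervalIntegrable_deriv
    rw [intervalIntegrable_iff_integrableOn_Ioo_of_le hTT] at this
    refine this.congr_fun_ae ?_
    rw [EventuallyEq, ae_restrict_iff' measurableSet_Ioo]
    filter_upwards [hd] with t ht hmem using (ht hmem).deriv
  · rw [← integral_Ioc_eq_integral_Ioo, ← intervalIntegral.integral_of_le hTT,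
      ← hac.sub_eq_integral hTT hd, hbT, hFT, sub_self]

/-- The embedding of `H¹` in `L∞`. -/
theorem ae_abs_wderiv_le {T e : ℝ} (he : 0 < e) (v : Sobolev T (T + 1) 1) (hv : ‖v‖ ≤ e)
    (i : Fin 2) : ∀ᵐ t, t ∈ Ioo T (T + 1) → |wderiv v 0 t i| ≤ 2 * e := by
  have hlt : T < T + 1 := by linarith
  have h01 : IsWeakDeriv T (T + 1) (fun t => wderiv v 0 t i) (fun t => wderiv v 1 t i) :=
    hasWeakDeriv_iff.1 (v.2 0) i
  obtain ⟨k, hk⟩ := h01.exists_ae_eq hlt (integrableOn_apply _ i) (integrableOn_apply _ i)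
  obtain ⟨hac, hd⟩ := absolutelyContinuous_primitive hlt.le (integrableOn_apply (wderiv v 1) i)
  have hconst : AbsolutelyContinuousOnInterval (fun _ : ℝ => k) T (T + 1) :=
    contDiffOn_const.absolutelyContinuousOnInterval
  have hint := memLp_two_intervalIntegrable hlt.le (memLp_apply (wderiv v 1) i)
  filter_upwards [hk] with t ht hmem
  rw [ht hmem]
  refine abs_le_of_absolutelyContinuous he
    (f := fun t => k + ∫ s in T..t, wderiv v 1 s i) (hconst.add hac) (g := fun t => wderiv v 1 t i)
    (hd.mono fun t ht hmem => (ht hmem).const_add k) hint.1 hint.2 ?_ ?_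
    (Ioo_subset_Icc_self hmem)
  · exact setIntegral_sq_le (wderiv v 0) i hlt.le (hk.mono fun t ht hmem => (ht hmem).symm)
      ((norm_wderiv_le v 0).trans hv)
  · exact setIntegral_sq_le (wderiv v 1) i hlt.le (Eventually.of_forall fun _ _ => rfl)
      ((norm_wderiv_le v 1).trans hv)

/-- The class in `L²` of an element of the Sobolev space. -/
def toL2 (a b : ℝ) : Sobolev a b 1 →L[ℝ] L2 a b :=
  (PiLp.proj (𝕜 := ℝ) 2 (fun _ : Fin 2 => L2 a b) 0).comp (Sobolev a b 1).subtypeL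

/-- Gronwall's argument: `exp (-K x) * E x` is nonincreasing and nonnegative, and starts at zero. -/
theorem eqOn_zero_of_deriv_le {L K : ℝ} {E E' : ℝ → ℝ} (h0 : E 0 = 0)
    (hE : ∀ x ∈ Icc 0 L, HasDerivWithinAt E (E' x) (Icc 0 L) x) (hnn : ∀ x, 0 ≤ E x)
    (hle : ∀ x ∈ Icc 0 L, E' x ≤ K * E x) {x : ℝ} (hx : x ∈ Icc 0 L) : E x = 0 := by
  have hd {x : ℝ} (hx : x ∈ Icc 0 L) : HasDerivWithinAt (fun x => Real.exp (-K * x) * E x)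
      (Real.exp (-K * x) * (E' x - K * E x)) (Icc 0 L) x := by
    have h1 : HasDerivAt (fun x => Real.exp (-K * x)) (Real.exp (-K * x) * (-K * 1)) x :=
      ((hasDerivAt_id x).const_mul (-K)).exp
    refine (h1.hasDerivWithinAt.mul (hE x hx)).congr_deriv ?_
    ring
  have hanti : AntitoneOn (fun x => Real.exp (-K * x) * E x) (Icc 0 L) := by
    refine antitoneOn_of_deriv_nonpos (convex_Icc 0 L) (fun x hx => (hd hx).continuousWithinAt)
      (fun x hx => ((hd (interior_subset hx)).mono interior_subset).differentiableWithinAt)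
      fun x hx => ?_
    have hx' := interior_subset hx
    rw [((hd hx').hasDerivAt (mem_interior_iff_mem_nhds.1 hx)).deriv]
    exact mul_nonpos_of_nonneg_of_nonpos (Real.exp_pos _).le (by linarith [hle x hx'])
  have h1 := hanti ⟨le_rfl, hx.1.trans hx.2⟩ hx hx.1
  simp only [h0, mul_zero] at h1
  have h2 := Real.exp_pos (-K * x)
  have h3 := hnn x
  exact le_antisymm (nonpos_of_mul_nonpos_right h1 h2) h3

theorem inner_plane (v w : Plane) : inner ℝ v w = v 0 * w 0 + v 1 * w 1 := by
  simp [PiLp.inner_apply, Fin.sum_univ_two, mul_comm]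

/-- The pointwise estimate of the energy density of a difference of two solutions. -/
theorem energy_density_le {κ a A B Q : ℝ} {F G D b bt p : Fin 2 → ℝ} (hQ : 0 ≤ Q) (ha : |a| ≤ A)
    (hb : ∀ i, |b i| ≤ B) (hbt : ∀ i, |bt i| ≤ B) (hp : ∀ i, |p i| ≤ 2 * Q)
    (heq : ∀ i, D i + b i * G i = b i * (a / 2 * (F 0 + F 1) - lam κ i F * p i)) :
    F 0 * D 0 + F 1 * D 1 + ((b 0 * F 0 * G 0 + 1 / 2 * bt 0 * F 0 ^ 2) +
      (b 1 * F 1 * G 1 + 1 / 2 * bt 1 * F 1 ^ 2)) ≤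
      (1 / 2 * B + 2 * (B * (A + lamNorm κ * (2 * Q)))) * (F 0 ^ 2 + F 1 ^ 2) := by
  have hA : 0 ≤ A := (abs_nonneg _).trans ha
  have hB : 0 ≤ B := (abs_nonneg _).trans (hb 0)
  have hN := (lamNorm_pos κ).le
  have hlamb (i : Fin 2) : |lam κ i F| ≤ lamNorm κ * (|F 0| + |F 1|) := by
    refine abs_lam_le (fun j => ?_) i
    fin_cases j
    · exact le_add_of_nonneg_right (abs_nonneg _)
    · exact le_add_of_nonneg_left (abs_nonneg _)
  have key (i : Fin 2) : F i * D i + (b i * F i * G i + 1 / 2 * bt i * F i ^ 2) ≤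
      |F i| * (B * (A + lamNorm κ * (2 * Q)) * (|F 0| + |F 1|)) + 1 / 2 * B * F i ^ 2 := by
    have r4 : |D i + b i * G i| ≤ B * (A + lamNorm κ * (2 * Q)) * (|F 0| + |F 1|) := by
      rw [heq, abs_mul, mul_assoc]
      refine mul_le_mul (hb i) ((abs_sub _ _).trans ?_) (abs_nonneg _) hB
      rw [abs_mul, abs_mul, add_mul]
      refine add_le_add ?_ ?_
      · refine mul_le_mul ?_ (abs_add_le _ _) (abs_nonneg _) hA
        rw [abs_div, abs_two]
        linarith [abs_nonneg a]
      · calc _ ≤ lamNorm κ * (|F 0| + |F 1|) * (2 * Q) :=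
              mul_le_mul (hlamb i) (hp i) (abs_nonneg _) (by positivity)
          _ = _ := by ring
    have r5 : F i * (D i + b i * G i) ≤
        |F i| * (B * (A + lamNorm κ * (2 * Q)) * (|F 0| + |F 1|)) := by
      refine (le_abs_self _).trans ?_
      rw [abs_mul]
      exact mul_le_mul_of_nonneg_left r4 (abs_nonneg _)
    have r6 : 1 / 2 * bt i * F i ^ 2 ≤ 1 / 2 * B * F i ^ 2 := by
      have := (le_abs_self _).trans (hbt i)
      gcongr
    linarith
  have hss : (|F 0| + |F 1|) * (|F 0| + |F 1|) ≤ 2 * (F 0 ^ 2 + F 1 ^ 2) := by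
    rw [← sq_abs (F 0), ← sq_abs (F 1)]
    nlinarith [sq_nonneg (|F 0| - |F 1|)]
  have hk : 0 ≤ B * (A + lamNorm κ * (2 * Q)) := by positivity
  linarith [mul_le_mul_of_nonneg_left hss hk, key 0, key 1]

namespace IsPeriodicSolution

variable {γ L T A B : ℝ} {α : ℝ → ℝ} {w m₀ : ℝ → Plane} {m m' : ℝ → ℝ → Plane}
  {M M' : ℝ → Sobolev T (T + 1) 2} {bt : Fin 2 → ℝ → ℝ → ℝ}

theorem hasDerivWithinAt_incl (h : IsPeriodicSolution γ L T α w m₀ m M) {x : ℝ}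
    (hx : x ∈ Icc 0 L) : HasDerivWithinAt (fun y => incl (M y)) (dx L M x) (Icc 0 L) x :=
  ((h.contDiffOn.differentiableOn (by norm_num)) x hx).hasDerivWithinAt

theorem hasDerivWithinAt_wderiv (h : IsPeriodicSolution γ L T α w m₀ m M) {x : ℝ}
    (hx : x ∈ Icc 0 L) : HasDerivWithinAt (fun y => wderiv (M y) 0) (wderiv (dx L M x) 0)
      (Icc 0 L) x :=
  (toL2 T (T + 1)).hasFDerivAt.comp_hasDerivWithinAt x (h.hasDerivWithinAt_incl hx)

theorem exists_norm_dx_le (h : IsPeriodicSolution γ L T α w m₀ m M) (hL : 0 < L) :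
    ∃ Q > 0, ∀ x ∈ Icc 0 L, ‖dx L M x‖ ≤ Q := by
  have hc : ContinuousOn (dx L M) (Icc 0 L) :=
    h.contDiffOn.continuousOn_derivWithin (uniqueDiffOn_Icc hL) (by norm_num)
  obtain ⟨Q, hQ⟩ := isCompact_Icc.exists_bound_of_continuousOn hc
  exact ⟨|Q| + 1, by positivity, fun x hx => (hQ x hx).trans (by linarith [le_abs_self Q])⟩

/-- After multiplication by `λᵢ`, which is linear in the state, the equations of two solutions
differ by terms that are linear in `λᵢ` of the difference. -/
theorem ae_equation (h : IsPeriodicSolution γ L T α w m₀ m M) {x : ℝ} (hx : x ∈ Icc 0 L) :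
    ∀ᵐ t, t ∈ Ioo T (T + 1) → ∀ i, eigenvalue γ (w t + m t x) i * wderiv (dx L M x) 0 t i +
      wderiv (M x) 1 t i = α t / 2 * (m t x 0 + m t x 1) := by
  have h1 := h.equation x hx
  rw [ae_restrict_iff' measurableSet_Ioo] at h1
  filter_upwards [h1] with t ht hmem i
  have h2 := ht hmem i
  have h3 := h.eigenvalue_ne_zero x hx t i
  field_simp at h2
  linarith

/-- The left side is half the `x`-derivative of the squared `L²` distance. With `F` the difference,
`G` its `t`-derivative and `b` the speeds of the first solution, subtracting the equations gives `D'
+ b G = b ((α/2)(F₀ + F₁) - λ(F) ∂ₓm')` in each component. The term `b F G` is a `t`-derivative up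
to `-bₜ F² / 2` and so disappears after integration over a period. The second solution enters only
through the bound for `∂ₓm'`. -/
theorem inner_le (h : IsPeriodicSolution γ L T α w m₀ m M)
    (h' : IsPeriodicSolution γ L T α w m₀ m' M') (hw : ∀ t, w (t + 1) = w t)
    (hα : ∀ t, |α t| ≤ A)
    (hbd : ∀ i, ∀ x ∈ Icc 0 L, ∀ t,
      HasDerivAt (fun t => (eigenvalue γ (w t + m t x) i)⁻¹) (bt i x t) t)
    (hb : ∀ i, ∀ x ∈ Icc 0 L, ∀ t, |(eigenvalue γ (w t + m t x) i)⁻¹| ≤ B)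
    (hbt : ∀ i, ∀ x ∈ Icc 0 L, ∀ t, |bt i x t| ≤ B) {Q : ℝ} (hQ0 : 0 < Q) {x : ℝ}
    (hx : x ∈ Icc 0 L) (hQ : ‖dx L M' x‖ ≤ Q) :
    inner ℝ (wderiv (M x) 0 - wderiv (M' x) 0) (wderiv (dx L M x) 0 - wderiv (dx L M' x) 0) ≤
      (1 / 2 * B + 2 * (B * (A + lamNorm ((γ - 1) / 2) * (2 * Q)))) *
        ‖wderiv (M x) 0 - wderiv (M' x) 0‖ ^ 2 := by
  have hlt : T < T + 1 := by linarith
  have hA : 0 ≤ A := (abs_nonneg _).trans (hα 0)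
  have hB : 0 ≤ B := (abs_nonneg _).trans (hb 0 x hx 0)
  have hN := (lamNorm_pos ((γ - 1) / 2)).le
  set d := M x - M' x with hd
  set D := wderiv (M x) 0 - wderiv (M' x) 0 with hD
  set D' := wderiv (dx L M x) 0 - wderiv (dx L M' x) 0 with hD'
  set b : Fin 2 → ℝ → ℝ := fun i t => (eigenvalue γ (w t + m t x) i)⁻¹ with hbdef
  set F : Fin 2 → ℝ → ℝ := fun i t => m t x i - m' t x i with hF
  set G : Fin 2 → ℝ → ℝ := fun i t => wderiv d 1 t i with hG
  have hm := h.represents x hx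
  have hm' := h'.represents x hx
  have hDco : ∀ᵐ t, t ∈ Ioo T (T + 1) → ∀ i, F i t = D t i := by
    have := Lp.coeFn_sub (wderiv (M x) 0) (wderiv (M' x) 0)
    rw [EventuallyEq, ae_restrict_iff' measurableSet_Ioo] at this
    filter_upwards [this, hm.ae_eq 0, hm.ae_eq 1, hm'.ae_eq 0, hm'.ae_eq 1] with t h1 h2 h3 h4 h5 hmem i
    rw [hD, h1 hmem, hF]
    fin_cases i
    · simp only [Fin.zero_eta, h2 hmem, h4 hmem, Pi.sub_apply, PiLp.sub_apply]
    · simp only [Fin.mk_one, h3 hmem, h5 hmem, Pi.sub_apply, PiLp.sub_apply]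
  have hGco : ∀ᵐ t, t ∈ Ioo T (T + 1) → ∀ i, G i t = wderiv (M x) 1 t i - wderiv (M' x) 1 t i := by
    have := Lp.coeFn_sub (wderiv (M x) 1) (wderiv (M' x) 1)
    rw [EventuallyEq, ae_restrict_iff' measurableSet_Ioo] at this
    filter_upwards [this] with t h1 hmem i
    change (wderiv (M x) 1 - wderiv (M' x) 1 : L2 T (T + 1)) t i = _
    rw [h1 hmem]
    rfl
  have hD'co : ∀ᵐ t, t ∈ Ioo T (T + 1) → ∀ i,
      D' t i = wderiv (dx L M x) 0 t i - wderiv (dx L M' x) 0 t i := by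
    have := Lp.coeFn_sub (wderiv (dx L M x) 0) (wderiv (dx L M' x) 0)
    rw [EventuallyEq, ae_restrict_iff' measurableSet_Ioo] at this
    filter_upwards [this] with t h1 hmem i
    rw [hD', h1 hmem]
    rfl
  have hFc (i : Fin 2) : Continuous (F i) :=
    ((EuclideanSpace.proj (𝕜 := ℝ) i).continuous.comp (h.continuous x hx)).sub
      ((EuclideanSpace.proj (𝕜 := ℝ) i).continuous.comp (h'.continuous x hx))
  have hFG (i : Fin 2) : AbsolutelyContinuousOnInterval (F i) T (T + 1) ∧
      ∀ᵐ t, t ∈ Ioo T (T + 1) → HasDerivAt (F i) (G i t) t := by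
    have h1 : IsWeakDeriv T (T + 1) (fun t => wderiv d 0 t i) (fun t => wderiv d 1 t i) :=
      hasWeakDeriv_iff.1 (d.2 0) i
    have h2 := h1.absolutelyContinuous hlt (integrableOn_apply _ i) (integrableOn_apply _ i)
      (hFc i).continuousOn (hDco.mono fun t ht hmem => ht hmem i)
    exact ⟨h2.1, h2.2.2⟩
  have hperm (t : ℝ) (i : Fin 2) : b i (t + 1) = b i t := by
    simp only [hbdef, hw, h.periodic x hx]
  have hperF (t : ℝ) (i : Fin 2) : F i (t + 1) = F i t := by
    simp only [hF, h.periodic x hx, h'.periodic x hx]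
  have hen (i : Fin 2) := integral_energy_eq_zero (b := b i) (bt := bt i x) (hbd i x hx)
    (hbt i x hx) (hFG i).1 (hFG i).2 (hperm T i) (hperF T i)
  have hsum : IntegrableOn (fun t => (b 0 t * F 0 t * G 0 t + 1 / 2 * bt 0 x t * F 0 t ^ 2) +
      (b 1 t * F 1 t * G 1 t + 1 / 2 * bt 1 x t * F 1 t ^ 2)) (Ioo T (T + 1)) :=
    (hen 0).1.add (hen 1).1
  -- Two integrals that vanish by the energy identity are added, so that the remaining estimate is
  -- pointwise and free of `G`.
  have hinner : inner ℝ D D' = ∫ t in Ioo T (T + 1), (inner ℝ (D t) (D' t) +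
      ((b 0 t * F 0 t * G 0 t + 1 / 2 * bt 0 x t * F 0 t ^ 2) +
        (b 1 t * F 1 t * G 1 t + 1 / 2 * bt 1 x t * F 1 t ^ 2))) := by
    rw [integral_add (L2.integrable_inner D D') hsum,
      integral_add (hen 0).1 (hen 1).1, (hen 0).2, (hen 1).2, L2.inner_def]
    simp
  rw [hinner, norm_sq_eq, ← integral_const_mul]
  refine integral_mono_ae ((L2.integrable_inner D D').add hsum)
    ((Lp.memLp D).norm.integrable_sq.const_mul _) ?_
  rw [EventuallyLE, ae_restrict_iff' measurableSet_Ioo]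
  filter_upwards [hDco, hGco, hD'co, h.ae_equation hx, h'.ae_equation hx,
    ae_abs_wderiv_le hQ0 _ hQ 0, ae_abs_wderiv_le hQ0 _ hQ 1] with t e1 e2 e3 e4 e5 e6 e7 hmem
  have q1 := e1 hmem
  have q2 := e2 hmem
  have q3 := e3 hmem
  have q4 := e4 hmem
  have q5 := e5 hmem
  have q6 : ∀ i, |wderiv (dx L M' x) 0 t i| ≤ 2 * Q := by
    intro i
    fin_cases i
    exacts [e6 hmem, e7 hmem]
  have hnorm : ‖D t‖ ^ 2 = F 0 t ^ 2 + F 1 t ^ 2 := by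
    rw [EuclideanSpace.norm_sq_eq, Fin.sum_univ_two, ← q1, ← q1, Real.norm_eq_abs, sq_abs,
      Real.norm_eq_abs, sq_abs]
  have hinn : inner ℝ (D t) (D' t) = F 0 t * D' t 0 + F 1 t * D' t 1 := by
    rw [inner_plane, q1, q1]
  rw [hnorm, hinn]
  refine energy_density_le (F := fun j => F j t) (G := fun j => G j t) (D := fun j => D' t j)
    (b := fun j => b j t) (bt := fun j => bt j x t) (p := fun j => wderiv (dx L M' x) 0 t j)
    hQ0.le (hα t) (fun i => hb i x hx t) (fun i => hbt i x hx t) q6 fun i => ?_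
  have r1 : b i t * eigenvalue γ (w t + m t x) i = 1 :=
    inv_mul_cancel₀ (h.eigenvalue_ne_zero x hx t i)
  have r2 : eigenvalue γ (w t + m t x) i - eigenvalue γ (w t + m' t x) i =
      lam ((γ - 1) / 2) i fun j => F j t := by
    rw [eigenvalue_eq, eigenvalue_eq, lam_sub]
    simp only [PiLp.add_apply, hF]
    congr 1
    ext j
    ring
  simp only []
  rw [← r2, q3, q2]
  have e4 := q4 i
  have e5 := q5 i
  simp only [hF]
  linear_combination (-(wderiv (dx L M x) 0 t i - wderiv (dx L M' x) 0 t i)) * r1 +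
    b i t * e4 - b i t * e5

/-- Uniqueness of periodic solutions, by the energy method. -/
theorem unique (h : IsPeriodicSolution γ L T α w m₀ m M)
    (h' : IsPeriodicSolution γ L T α w m₀ m' M') (hL : 0 < L) (hw : ∀ t, w (t + 1) = w t)
    (hα : ∀ t, |α t| ≤ A)
    (hbd : ∀ i, ∀ x ∈ Icc 0 L, ∀ t,
      HasDerivAt (fun t => (eigenvalue γ (w t + m t x) i)⁻¹) (bt i x t) t)
    (hb : ∀ i, ∀ x ∈ Icc 0 L, ∀ t, |(eigenvalue γ (w t + m t x) i)⁻¹| ≤ B)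
    (hbt : ∀ i, ∀ x ∈ Icc 0 L, ∀ t, |bt i x t| ≤ B) :
    ∀ x ∈ Icc 0 L, ∀ t, m' t x = m t x := by
  have hlt : T < T + 1 := by linarith
  obtain ⟨Q, hQ0, hQ⟩ := h'.exists_norm_dx_le hL
  have h0L : (0 : ℝ) ∈ Icc 0 L := ⟨le_rfl, hL.le⟩
  have hzero {x : ℝ} (hx : x ∈ Icc 0 L) : ‖wderiv (M x) 0 - wderiv (M' x) 0‖ ^ 2 = 0 := by
    refine eqOn_zero_of_deriv_le (E := fun x => ‖wderiv (M x) 0 - wderiv (M' x) 0‖ ^ 2)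
      (L := L) (K := 2 * (1 / 2 * B + 2 * (B * (A + lamNorm ((γ - 1) / 2) * (2 * Q))))) ?_
      (fun x hx => ((h.hasDerivWithinAt_wderiv hx).sub (h'.hasDerivWithinAt_wderiv hx)).norm_sq)
      (fun x => sq_nonneg _) (fun x hx => ?_) hx
    · have : wderiv (M 0) 0 = wderiv (M' 0) 0 := by
        refine Lp.ext ?_
        refine (h.represents 0 h0L).symm.trans (EventuallyEq.trans ?_ (h'.represents 0 h0L))
        exact Eventually.of_forall fun t => (h.initial t).trans (h'.initial t).symm
      simp [this]
    · have := h.inner_le h' hw hα hbd hb hbt hQ0 hx (hQ x hx)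
      rw [mul_assoc]
      exact mul_le_mul_of_nonneg_left this (by norm_num)
  intro x hx
  have heq : wderiv (M x) 0 = wderiv (M' x) 0 := by
    have := hzero hx
    rwa [sq_eq_zero_iff, norm_eq_zero, sub_eq_zero] at this
  -- Equality almost everywhere on one period becomes equality everywhere by continuity and
  -- periodicity.
  have hae : (fun t => m' t x) =ᵐ[volume.restrict (Icc T (T + 1))] fun t => m t x := by
    rw [← restrict_Ioo_eq_restrict_Icc]
    refine (h'.represents x hx).trans ?_
    rw [← heq]
    exact (h.represents x hx).symm
  have hon : EqOn (fun t => m' t x) (fun t => m t x) (Icc T (T + 1)) :=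
    Measure.eqOn_Icc_of_ae_eq volume hlt.ne hae (h'.continuous x hx).continuousOn
      (h.continuous x hx).continuousOn
  have hp : Periodic (fun t => m t x) 1 := h.periodic x hx
  have hp' : Periodic (fun t => m' t x) 1 := h'.periodic x hx
  have hpd : Periodic (fun t => m' t x - m t x) 1 := hp'.sub hp
  intro t
  obtain ⟨y, hy, hyt⟩ := hpd.exists_mem_Ico one_pos t T
  have h1 : m' y x - m y x = 0 := sub_eq_zero.2 (hon (Ico_subset_Icc_self hy))
  have h2 : m' t x - m t x = m' y x - m y x := hyt
  exact sub_eq_zero.1 (h2.trans h1)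

end IsPeriodicSolution

/-! ### The background state. -/

theorem exists_abs_le_of_periodic {f : ℝ → ℝ} (hf : Continuous f) (hper : ∀ t, f (t + 1) = f t) :
    ∃ C, 0 ≤ C ∧ ∀ t, |f t| ≤ C := by
  obtain ⟨C, hC⟩ := isCompact_Icc.exists_bound_of_continuousOn (s := Icc (0 : ℝ) 1) hf.continuousOn
  refine ⟨C, (norm_nonneg _).trans (hC 0 ⟨le_rfl, zero_le_one⟩), fun t => ?_⟩
  have hp : Periodic f 1 := hper
  obtain ⟨y, hy, hyt⟩ := hp.exists_mem_Ico₀ one_pos t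
  rw [hyt]
  exact hC y (Ico_subset_Icc_self hy)

theorem exists_reg_of_periodic {f : ℝ → ℝ} (hf : ContDiff ℝ 2 f) (hper : ∀ t, f (t + 1) = f t) :
    ∃ A, Reg A f (deriv f) ∧ C1Bound A (fun _ t => deriv f t) (fun _ t => deriv (deriv f) t) := by
  have hf1 : ContDiff ℝ 1 (deriv f) := ((contDiff_succ_iff_deriv (n := 1)).1 hf).2.2
  have hd1 : Differentiable ℝ (deriv f) := hf1.differentiable (by norm_num)
  have hc2 : Continuous (deriv (deriv f)) := hf1.continuous_deriv (by norm_num)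
  have hper' := Function.Periodic.deriv' hper
  obtain ⟨C₀, h0, hC₀⟩ := exists_abs_le_of_periodic hf.continuous hper
  obtain ⟨C₁, h1, hC₁⟩ := exists_abs_le_of_periodic hf1.continuous hper'
  obtain ⟨C₂, h2, hC₂⟩ := exists_abs_le_of_periodic hc2 (Function.Periodic.deriv' hper')
  refine ⟨C₀ + 2 * C₁ + C₂, ⟨fun t => (hf.differentiable (by norm_num) t).hasDerivAt,
    fun t => (hC₀ t).trans (by linarith), fun t => (hC₁ t).trans (by linarith), fun t s => ?_⟩,
    hf1.continuous.comp continuous_snd, hc2.comp continuous_snd, fun _ t => (hd1 t).hasDerivAt,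
    fun _ t => (hC₁ t).trans (by linarith), fun _ t => (hC₂ t).trans (by linarith)⟩
  have hsq := Real.sqrt_nonneg |t - s|
  rcases le_total |t - s| 1 with hle | hle
  · have hlip : ‖deriv f t - deriv f s‖ ≤ C₂ * ‖t - s‖ :=
      convex_univ.norm_image_sub_le_of_norm_deriv_le (fun x _ => hd1 x) (fun x _ => hC₂ x)
        (mem_univ s) (mem_univ t)
    have : |t - s| ≤ √|t - s| := Real.le_sqrt_of_sq_le (by nlinarith [abs_nonneg (t - s)])
    calc |deriv f t - deriv f s| ≤ C₂ * |t - s| := hlip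
      _ ≤ C₂ * √|t - s| := by gcongr
      _ ≤ (C₀ + 2 * C₁ + C₂) * √|t - s| := by
        gcongr
        linarith
  · have : 1 ≤ √|t - s| := Real.one_le_sqrt.2 hle
    calc |deriv f t - deriv f s| ≤ |deriv f t| + |deriv f s| := abs_sub _ _
      _ ≤ (C₀ + 2 * C₁ + C₂) * 1 := by linarith [hC₁ t, hC₁ s]
      _ ≤ _ := by gcongr

section background

variable {α : ℝ → ℝ} {u : ℝ}

theorem contDiff_bgVelocity (hα : ContDiff ℝ 2 α) (u : ℝ) : ContDiff ℝ 2 (bgVelocity α u) := by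
  have hI (t : ℝ) : HasDerivAt (fun t => ∫ τ in (0 : ℝ)..t, α τ) (α t) t :=
    intervalIntegral.integral_hasDerivAt_right (hα.continuous.intervalIntegrable _ _)
      (hα.continuous.stronglyMeasurableAtFilter _ _) hα.continuous.continuousAt
  have hI2 : ContDiff ℝ 2 (fun t => ∫ τ in (0 : ℝ)..t, α τ) := by
    refine (contDiff_succ_iff_deriv (n := 1)).2 ⟨fun t => (hI t).differentiableAt, by simp, ?_⟩
    rw [funext fun t => (hI t).deriv]
    exact hα.of_le (by norm_num)
  exact hI2.exp.mul contDiff_const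

theorem bgVelocity_add_one (hα : Continuous α) (hper : ∀ t, α (t + 1) = α t)
    (hmean : ∫ τ in (0 : ℝ)..1, α τ = 0) (t : ℝ) :
    bgVelocity α u (t + 1) = bgVelocity α u t := by
  have hp : Periodic α 1 := hper
  have h1 := hp.intervalIntegral_add_eq t 0
  rw [zero_add, hmean] at h1
  rw [bgVelocity, bgVelocity, ← intervalIntegral.integral_add_adjacent_intervals
    (hα.intervalIntegrable 0 t) (hα.intervalIntegrable t (t + 1)), h1, add_zero]

/-- The sign condition on the primitive of `α` is assumed for nonnegative times; periodicity reduces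
every `t` to `[0, 1)`. -/
theorem le_bgVelocity (hα : Continuous α) (hper : ∀ t, α (t + 1) = α t)
    (hnonneg : ∀ t, 0 ≤ t → 0 ≤ ∫ τ in (0 : ℝ)..t, α τ) (hmean : ∫ τ in (0 : ℝ)..1, α τ = 0)
    (hu : 0 ≤ u) (t : ℝ) : u ≤ bgVelocity α u t := by
  have hp : Periodic (bgVelocity α u) 1 := bgVelocity_add_one hα hper hmean
  obtain ⟨y, hy, hyt⟩ := hp.exists_mem_Ico₀ one_pos t
  rw [hyt]
  exact le_mul_of_one_le_left hu (Real.one_le_exp (hnonneg y hy.1))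

theorem bgRiemann_apply (γ c u : ℝ) (α : ℝ → ℝ) (t : ℝ) (i : Fin 2) :
    bgRiemann γ c u α t i = bgVelocity α u t / 2 + ![-(c / (γ - 1)), c / (γ - 1)] i := by
  fin_cases i
  · exact sub_eq_add_neg _ _
  · rfl

/-- With `v` the background velocity, the eigenvalues are `v - c` and `v + c`, and `v ≥ u`. Both are
thus at least `u - c`, twice the constant `(u - c) / 2`, so that half of the margin is left for
perturbations. -/
theorem exists_isBackground {γ c : ℝ} (hγ : 1 < γ) (hc : 0 < c) (hcu : c < u)
    (hα : ContDiff ℝ 2 α) (hper : ∀ t, α (t + 1) = α t)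
    (hnonneg : ∀ t, 0 ≤ t → 0 ≤ ∫ τ in (0 : ℝ)..t, α τ) (hmean : ∫ τ in (0 : ℝ)..1, α τ = 0) :
    ∃ A, IsBackground ((γ - 1) / 2) ((u - c) / 2) A α (deriv α)
      (fun i t => bgRiemann γ c u α t i) (fun i => deriv fun t => bgRiemann γ c u α t i) ∧
      HasC1Bound A fun _ t => deriv α t := by
  have hw (i : Fin 2) : ContDiff ℝ 2 fun t => bgRiemann γ c u α t i := by
    simp only [bgRiemann_apply]
    exact ((contDiff_bgVelocity hα u).div_const 2).add contDiff_const
  have hwper (i : Fin 2) (t : ℝ) : bgRiemann γ c u α (t + 1) i = bgRiemann γ c u α t i := by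
    simp only [bgRiemann_apply, bgVelocity_add_one hα.continuous hper hmean]
  obtain ⟨A₀, hA₀, hA₀'⟩ := exists_reg_of_periodic hα hper
  choose A₁ hA₁ using fun i => exists_reg_of_periodic (hw i) (hwper i)
  have h0 := hA₀.nonneg
  have h1 (i : Fin 2) := (hA₁ i).1.nonneg
  have hle (i : Fin 2) : A₁ i ≤ A₀ + A₁ 0 + A₁ 1 := by
    fin_cases i
    · simp only [Fin.zero_eta]
      linarith [h1 1]
    · simp only [Fin.mk_one]
      linarith [h1 0]
  have hle₀ : A₀ ≤ A₀ + A₁ 0 + A₁ 1 := by linarith [h1 0, h1 1]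
  refine ⟨A₀ + A₁ 0 + A₁ 1, ⟨by linarith, hA₀.mono hle₀, fun i => (hA₁ i).1.mono (hle i),
    hα.continuous_deriv (by norm_num), fun i => (hw i).continuous_deriv (by norm_num),
    fun i t => ?_, hper, hwper⟩, HasC1Bound.mono ⟨_, hA₀'⟩ hle₀⟩
  have hV := le_bgVelocity hα.continuous hper hnonneg hmean (hc.trans hcu).le t
  have hγ' : γ - 1 ≠ 0 := by linarith
  fin_cases i
  · have : (lam ((γ - 1) / 2) 0 fun j => bgRiemann γ c u α t j) = bgVelocity α u t - c := by
      change (1 + (γ - 1) / 2) * (bgVelocity α u t / 2 - c / (γ - 1)) +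
        (1 - (γ - 1) / 2) * (bgVelocity α u t / 2 + c / (γ - 1)) = _
      field_simp
      ring
    exact (by linarith : _ ≤ bgVelocity α u t - c).trans_eq this.symm
  · have : (lam ((γ - 1) / 2) 1 fun j => bgRiemann γ c u α t j) = bgVelocity α u t + c := by
      change (1 + (γ - 1) / 2) * (bgVelocity α u t / 2 + c / (γ - 1)) +
        (1 - (γ - 1) / 2) * (bgVelocity α u t / 2 - c / (γ - 1)) = _
      field_simp
      ring
    exact (by linarith : _ ≤ bgVelocity α u t + c).trans_eq this.symm

theorem bgRiemann_gap (γ c u : ℝ) (α : ℝ → ℝ) (t : ℝ) :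
    bgRiemann γ c u α t 1 - bgRiemann γ c u α t 0 = 2 * c / (γ - 1) := by
  change bgVelocity α u t / 2 + c / (γ - 1) - (bgVelocity α u t / 2 - c / (γ - 1)) = _
  ring

theorem exists_rpow_le {a b : ℝ} (ha : 0 < a) {S : Set ℝ} (hS : S.Finite) :
    ∃ K, ∀ s ∈ Icc a b, ∀ r ∈ S, s ^ r ≤ K := by
  have (r : ℝ) : ∃ K, 0 ≤ K ∧ ∀ s ∈ Icc a b, s ^ r ≤ K := by
    obtain ⟨K, hK⟩ := isCompact_Icc.exists_bound_of_continuousOn (s := Icc a b)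
      (f := fun s : ℝ => s ^ r)
      (continuousOn_id.rpow_const fun s hs => Or.inl (ha.trans_le hs.1).ne')
    exact ⟨|K|, abs_nonneg K, fun s hs =>
      (le_abs_self _).trans ((hK s hs).trans (le_abs_self K))⟩
  choose K hK0 hK using this
  lift S to Finset ℝ using hS
  exact ⟨∑ r ∈ S, K r, fun s hs r hr => (hK r s hs).trans
    (Finset.single_le_sum (fun r _ => hK0 r) hr)⟩

theorem soundSpeed_pos {a γ ρ : ℝ} (ha : 0 < a) (hγ : 1 < γ) (hρ : 0 < ρ) :
    0 < soundSpeed a γ ρ :=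
  mul_pos (Real.sqrt_pos.2 (mul_pos ha (by linarith))) (Real.rpow_pos_of_pos hρ _)

end background

/-! ### Assembly of existence and uniqueness. -/

/-- The comparison function `η + |P|` is again periodic, and `(η + |P|)² ≤ 2η² + 2P²` bounds its
integral over a period. -/
theorem eLpNorm_le_of_ae_le {T ε η C R : ℝ} {g P : ℝ → ℝ} (hper : ∀ t, P (t + 1) = P t)
    (hP : ∀ b c, MemLp P 2 (volume.restrict (Ioo b c))) (hε : 0 ≤ ε) (hη : 0 ≤ η) (hC : 0 ≤ C)
    (hle : ∫ t in T..(T + 1), P t ^ 2 ≤ ε ^ 2) (hg : ∀ᵐ t, |g t| ≤ C * (η + |P t|)) {N : ℕ}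
    (hN : R ≤ N) : eLpNorm g 2 (volume.restrict (Ioo (T - R) (T + 1 + R))) ≤
      ENNReal.ofReal (C * ((2 * N + 1) * (2 * (η + ε)))) := by
  have hTT : T ≤ T + 1 := by linarith
  have hQ (b c : ℝ) : MemLp (fun t => η + |P t|) 2 (volume.restrict (Ioo b c)) :=
    (memLp_const η).add (hP b c).norm
  have hint : ∫ t in T..(T + 1), (η + |P t|) ^ 2 ≤ (2 * (η + ε)) ^ 2 := by
    have hi := (memLp_two_intervalIntegrable hTT (hP T (T + 1))).2
    have h1 : ∫ t in T..(T + 1), (η + |P t|) ^ 2 ≤ ∫ t in T..(T + 1), (2 * η ^ 2 + 2 * P t ^ 2) := by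
      refine intervalIntegral.integral_mono hTT (memLp_two_intervalIntegrable hTT (hQ T (T + 1))).2
        (intervalIntegrable_const.add (hi.const_mul 2)) fun t => ?_
      rw [← sq_abs (P t)]
      nlinarith [sq_nonneg (η - |P t|)]
    rw [intervalIntegral.integral_add intervalIntegrable_const (hi.const_mul 2),
      intervalIntegral.integral_const, intervalIntegral.integral_const_mul, add_sub_cancel_left,
      one_smul] at h1
    nlinarith [mul_nonneg hη hε]
  have hQle := eLpNorm_periodic_le (T := T) (R := R) (P := fun t => η + |P t|)
    (fun t => by simp only [hper]) hQ (by positivity) hint hN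
  rw [ENNReal.ofReal_mul hC]
  refine (eLpNorm_le_mul_eLpNorm_of_ae_le_mul (g := fun t => η + |P t|) (c := C)
    (ae_restrict_of_ae (hg.mono fun t ht => ?_)) 2).trans (mul_le_mul_right hQle _)
  rw [Real.norm_eq_abs, Real.norm_eq_abs, abs_of_nonneg (by positivity : 0 ≤ η + |P t|)]
  exact ht

theorem eigenvalue_add_plane (γ : ℝ) (w : ℝ → Plane) (m : Fin 2 → ℝ → ℝ → ℝ) (i : Fin 2)
    (x t : ℝ) : eigenvalue γ (w t + plane (fun i => m i x) t) i =
      lam ((γ - 1) / 2) i fun j => w t j + m j x t :=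
  eigenvalue_eq _ _ _

/-- A classical small solution with transported second derivative is a solution in the required
sense. Its speeds have bounded `t`-derivatives, which is all that `unique` asks for; the competitor
is arbitrary. -/
theorem PerturbedState.exists_isPeriodicSolution {γ c A K σ₀ η L C e T : ℝ} {α α' : ℝ → ℝ}
    {w m₀ : ℝ → Plane} {w' : Fin 2 → ℝ → ℝ} {m p c₀ c₁ : Fin 2 → ℝ → ℝ → ℝ} {g : Fin 2 → ℝ → ℝ}
    (H : PerturbedState ((γ - 1) / 2) c A K σ₀ η α α' (fun i t => w t i) w' m p)
    (S : IsSol ((γ - 1) / 2) L α α' (fun i t => w t i) w' m p) (hL : 0 < L)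
    (hT : ∀ i, HasTransportedDeriv L C η (speed ((γ - 1) / 2) (fun i t => w t i) m i) (p i) (c₀ i)
      (c₁ i) (g i)) (he : 0 ≤ e)
    (hge : ∀ i, eLpNorm (g i) 2 (volume.restrict (Ioo (T - speedBound ((γ - 1) / 2) c A * L)
      (T + 1 + speedBound ((γ - 1) / 2) c A * L))) ≤ ENNReal.ofReal e)
    (h0 : ∀ i t, m i 0 t = m₀ t i) :
    ∃ M : ℝ → Sobolev T (T + 1) 2,
      IsPeriodicSolution γ L T α w m₀ (fun t x => plane (fun i => m i x) t) M ∧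
      (∀ x ∈ Icc 0 L, ∀ y ∈ Icc 0 L, ‖M x‖ + ‖dx L M y‖ ≤
        2 * η + 2 * η + 2 * (C * η + C * Real.exp (speedBound ((γ - 1) / 2) c A * L) * e) +
        (2 * (speedBound ((γ - 1) / 2) c A * ((A + 1) * η)) +
          2 * (speedBound ((γ - 1) / 2) c A * ((3 * A + 1 + C) * η) +
            speedBound ((γ - 1) / 2) c A * C *
              Real.exp (speedBound ((γ - 1) / 2) c A * L) * e))) ∧
      ∀ (m' : ℝ → ℝ → Plane) (M' : ℝ → Sobolev T (T + 1) 2),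
        IsPeriodicSolution γ L T α w m₀ m' M' →
        ∀ x ∈ Icc 0 L, ∀ t, m' t x = plane (fun i => m i x) t := by
  obtain ⟨M, N, hM, hN, hMN, hrep, hle⟩ := H.exists_sobolev_curve S hL.le hT he hge
  have hdx {x : ℝ} (hx : x ∈ Icc 0 L) : dx L M x = N x :=
    (hMN x hx).derivWithin (uniqueDiffOn_Icc hL x hx)
  have hcont (x : ℝ) {f : Fin 2 → ℝ → ℝ → ℝ} (hf : ∀ i, Continuous (uncurry (f i))) :
      Continuous (plane fun i => f i x) := (continuous_plane hf).comp (Continuous.prodMk_right x)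
  have hsl (i : Fin 2) : Continuous (uncurry (slopeX ((γ - 1) / 2) α (fun i t => w t i) m p i)) :=
    H.continuous_slopeX i
  have hsol : IsPeriodicSolution γ L T α w m₀ (fun t x => plane (fun i => m i x) t) M :=
    { periodic := fun x _ t => by simp only [plane, H.adm.per]
      continuous := fun x _ => hcont x H.adm.cont
      represents := fun x hx => by
        rw [Represents, (hrep x hx).1]
        exact (coeFn_lp (memLp_of_continuous (hcont x H.adm.cont))).symm
      continuousOn := hM
      contDiffOn := by
        have : ContDiffOn ℝ (0 + 1) (fun x => incl (M x)) (Icc 0 L) := by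
          refine (contDiffOn_succ_iff_derivWithin (uniqueDiffOn_Icc hL)).2
            ⟨fun x hx => (hMN x hx).differentiableWithinAt, by simp, ?_⟩
          rw [contDiffOn_zero]
          exact hN.congr fun x hx => hdx hx
        simpa using this
      eigenvalue_ne_zero := fun x _ t i => by
        rw [eigenvalue_add_plane]
        exact (H.bg.lam_pos H.adm i x t).ne'
      equation := fun x hx => by
        rw [hdx hx, (hrep x hx).2.1, (hrep x hx).2.2]
        filter_upwards [coeFn_lp (memLp_of_continuous (hcont x H.adm.cont')),
          coeFn_lp (memLp_of_continuous (hcont x hsl))] with t h1 h2 i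
        rw [h1, h2, eigenvalue_add_plane]
        change (lam ((γ - 1) / 2) i fun j => w t j + m j x t)⁻¹ *
          (1 / 2 * α t * (m 0 x t + m 1 x t) - p i x t) + 1 / _ * p i x t =
            α t / 2 * _ * (m 0 x t + m 1 x t)
        rw [one_div (lam _ _ _)]
        ring
      initial := fun t => by
        ext i
        exact h0 i t }
  refine ⟨M, hsol, fun x hx y hy => ?_, fun m' M' h' => ?_⟩
  · rw [hdx hy]
    exact add_le_add (hle x hx).1 (hle y hy).2
  · have hreg (i : Fin 2) (x : ℝ) := H.bg.reg_speed H.adm i x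
    have hinv (i : Fin 2) (x t : ℝ) : (eigenvalue γ (w t + plane (fun i => m i x) t) i)⁻¹ =
        speed ((γ - 1) / 2) (fun i t => w t i) m i x t :=
      congrArg Inv.inv (eigenvalue_add_plane γ w m i x t)
    refine hsol.unique h' hL (A := A) (B := speedBound ((γ - 1) / 2) c A)
      (bt := speedDeriv ((γ - 1) / 2) (fun i t => w t i) w' m p) (fun t => ?_) H.bg.reg_α.bound
      (fun i x _ t => ?_) (fun i x _ t => ?_) fun i x _ t => (hreg i x).bound' t
    · ext i
      exact H.bg.per_w i t
    · simp only [hinv]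
      exact (hreg i x).deriv t
    · rw [hinv]
      exact (hreg i x).bound t

/-- Existence and uniqueness of small periodic solutions over a given background. -/
theorem IsBackground.exists_isPeriodicSolution {γ c A σ₀ L T : ℝ} {α α' : ℝ → ℝ}
    {w : ℝ → Plane} {w' : Fin 2 → ℝ → ℝ}
    (h : IsBackground ((γ - 1) / 2) c A α α' (fun i t => w t i) w') (hγ : 1 < γ) (hσ₀ : 0 < σ₀)
    (hα' : HasC1Bound A fun _ t => α' t) (hgap : ∀ t, w t 1 - w t 0 = σ₀) (hL : 0 < L) :
    ∃ ε₀ > 0, ∃ C₀ > 0, ∀ ε : ℝ, 0 < ε → ε < ε₀ → ∀ m₀ : ℝ → Plane, (∀ t, m₀ (t + 1) = m₀ t) →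
      Continuous m₀ → (∀ b c : ℝ, ∃ v : Sobolev b c 2, Represents m₀ v) →
      ∀ M₀ : Sobolev T (T + 1) 2, Represents m₀ M₀ → ‖M₀‖ ≤ ε →
        ∃ (m : ℝ → ℝ → Plane) (M : ℝ → Sobolev T (T + 1) 2),
          IsPeriodicSolution γ L T α w m₀ m M ∧
          (∀ x ∈ Icc 0 L, ∀ y ∈ Icc 0 L, ‖M x‖ + ‖dx L M y‖ ≤ C₀ * ε) ∧
          (∀ (m' : ℝ → ℝ → Plane) (M' : ℝ → Sobolev T (T + 1) 2),
            IsPeriodicSolution γ L T α w m₀ m' M' → ∀ x ∈ Icc 0 L, ∀ t, m' t x = m t x) := by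
  set κ := (γ - 1) / 2 with hκ
  have hκ0 : 0 < κ := by
    rw [hκ]
    linarith
  obtain ⟨K, hK⟩ := exists_rpow_le (a := σ₀ / 2) (b := 2 * σ₀) (by positivity)
    (S := {expo κ, -expo κ, expo κ - 1, -expo κ - 1}) (Set.toFinite _)
  obtain ⟨δ, hδ, D, hD, hex⟩ := h.exists_isSol hκ0 hσ₀ hα' hgap hK hL.le
  obtain ⟨C, hC, hCT⟩ := PerturbedState.exists_transportedDeriv κ c A K L hL.le
  set B := speedBound κ c A with hB
  have hB0 : 0 ≤ B := h.speedBound_nonneg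
  have hA0 : 0 ≤ A := h.A_nonneg
  obtain ⟨N, hN⟩ := exists_nat_ge (B * L)
  set E := C * ((2 * N + 1) * (2 * (4 * D + 1))) with hE
  have hE0 : 0 ≤ E := by positivity
  -- Data of size `ε` in `H²` have size `4 * ε` in `C^{1,1/2}`, hence `δ / 4` and `η = 4Dε`; the
  -- `L²` size of `g` is at most `E * ε`. All contributions are linear in `ε`, and the final `+ 1`
  -- makes the constant positive.
  refine ⟨δ / 4, by positivity, 2 * (4 * D) + 2 * (4 * D) + 2 * (C * (4 * D) +
    C * Real.exp (B * L) * E) + (2 * (B * ((A + 1) * (4 * D))) +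
      2 * (B * ((3 * A + 1 + C) * (4 * D)) + B * C * Real.exp (B * L) * E)) + 1, by positivity,
    fun ε hε hεδ m₀ hper hc hloc M₀ hM₀ hle => ?_⟩
  have hreg := reg_of_represents hper hc hloc hM₀ hε hle
  have hac := absolutelyContinuous_deriv_of_locally hc hloc
  have hcd (i : Fin 2) : Continuous (deriv fun t => m₀ t i) := continuous_iff_continuousAt.2
    fun t => by
      refine (hac i (t - 1) (t + 1)).continuousOn.continuousAt ?_
      rw [uIcc_of_le (by linarith)]
      exact Icc_mem_nhds (by linarith) (by linarith)
  have hperi (i : Fin 2) (t : ℝ) : m₀ (t + 1) i = m₀ t i := by rw [hper]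
  obtain ⟨m, p, H, S, h0⟩ := hex (4 * ε) (by positivity) (by linarith) (fun i t => m₀ t i)
    (fun i => deriv fun t => m₀ t i) (fun i => (hreg i).1) hcd hperi
  choose c₀ c₁ g hg using hCT H S fun i a c => by
    rw [(h0 i).2]
    exact hac i a c
  have hη : 0 ≤ D * (4 * ε) := by positivity
  have hge (i : Fin 2) := eLpNorm_le_of_ae_le (T := T)
    (Function.Periodic.deriv' (Function.Periodic.deriv' (hperi i)))
    (memLp_deriv_deriv hc hloc i) hε.le hη hC (hreg i).2 (by
      have := (hg i).ae_le
      rwa [(h0 i).2] at this) hN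
  obtain ⟨M, hM, hbound, huniq⟩ := H.exists_isPeriodicSolution S hL hg (by positivity) hge
    (m₀ := m₀) fun i t => congrFun (h0 i).1 t
  refine ⟨_, M, hM, fun x hx y hy => (hbound x hx y hy).trans ?_, huniq⟩
  have hEε : C * ((2 * N + 1) * (2 * (D * (4 * ε) + ε))) = E * ε := by
    rw [hE]
    ring
  rw [hEε]
  refine le_trans (le_of_eq ?_) (mul_le_mul_of_nonneg_right (le_add_of_nonneg_right zero_le_one)
    hε.le)
  ring

end EulerPeriodic

end

theorem theorem4p1
    (a γ ρ u L T₀ : ℝ) (α : ℝ → ℝ)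
    (ha : 0 < a) (hγ : 1 < γ) (hρ : 0 < ρ) (hL : 0 < L)
    (hsupersonic : soundSpeed a γ ρ < u)
    (hα : ContDiff ℝ 2 α) (hαper : ∀ t, α (t + 1) = α t)
    (hαnonneg : ∀ t, 0 ≤ t → 0 ≤ ∫ τ in (0 : ℝ)..t, α τ)
    (hαmean : ∫ τ in (0 : ℝ)..1, α τ = 0) :
    ∃ ε₀ > 0, ∃ C₀ > 0, ∀ ε : ℝ, 0 < ε → ε < ε₀ →
      -- the Riemann invariants `(r_l, s_l)` of the boundary data, and the datum `m₀`
      ∀ wl m₀ : ℝ → Plane,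
        (∀ t, wl (t + 1) = wl t) →
        (∀ t, m₀ t = wl t - bgRiemann γ (soundSpeed a γ ρ) u α t) →
        Continuous m₀ →
        (∀ b c : ℝ, ∃ v : Sobolev b c 2, Represents m₀ v) →
        ∀ M₀ : Sobolev T₀ (T₀ + 1) 2, Represents m₀ M₀ → ‖M₀‖ ≤ ε →
          ∃ (m : ℝ → ℝ → Plane) (M : ℝ → Sobolev T₀ (T₀ + 1) 2),
            IsPeriodicSolution γ L T₀ α (bgRiemann γ (soundSpeed a γ ρ) u α) m₀ m M ∧
            (∀ x ∈ Icc 0 L, ∀ y ∈ Icc 0 L, ‖M x‖ + ‖dx L M y‖ ≤ C₀ * ε) ∧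
            (∀ (m' : ℝ → ℝ → Plane) (M' : ℝ → Sobolev T₀ (T₀ + 1) 2),
              IsPeriodicSolution γ L T₀ α (bgRiemann γ (soundSpeed a γ ρ) u α) m₀ m' M' →
              ∀ x ∈ Icc 0 L, ∀ t, m' t x = m t x) := by
  have hc := soundSpeed_pos ha hγ hρ
  obtain ⟨A, hA, hA'⟩ := exists_isBackground hγ hc hsupersonic hα hαper hαnonneg hαmean
  obtain ⟨ε₀, hε₀, C₀, hC₀, h⟩ := hA.exists_isPeriodicSolution (T := T₀) hγ
    (div_pos (mul_pos two_pos hc) (sub_pos.2 hγ)) hA' (bgRiemann_gap γ _ u α) hL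
  refine ⟨ε₀, hε₀, C₀, hC₀, fun ε hε hεlt wl m₀ hwl hm₀ => h ε hε hεlt m₀ fun t => ?_⟩
  have hw : bgRiemann γ (soundSpeed a γ ρ) u α (t + 1) = bgRiemann γ (soundSpeed a γ ρ) u α t := by
    ext i
    exact hA.per_w i t
  rw [hm₀, hm₀, hwl, hw]
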